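/- Let $\mathfrak f_{n,2}$ be the free two-step nilpotent real Lie algebra on generators $z_1,\dots,z_n$; write $\mathfrak f_{n,2}=V_1\oplus V_2$ with $V_1=\operatorname{span}\{z_i\}$ and $V_2=[\mathfrak f_{n,2},\mathfrak f_{n,2}]=\operatorname{span}\{[z_i,z_j]\}$. For $A\in GL_n(\mathbb Z)$ let $f^A$ be the automorphism of $\mathfrak f_{n,2}$ with $f^A(z_j)=\sum_i A_{ij}z_i$, and let $p_1,p_2\in\mathbb Z[x]$ be the characteristic polynomials of $f^A|_{V_1}$ and $f^A|_{V_2}$. An automorphism $\varphi$ of a real Lie algebra $\mathfrak n$ is *Anosov* if $\mathfrak n$ has a finite basis with rational structure constants with respect to which $\varphi$ is given by a matrix in $GL_N(\mathbb Z)$ without (complex) eigenvalues of modulus one; $\mathfrak n$ is *Anosov* if it has an Anosov automorphism. A two-step nilpotent Lie algebra $\mathfrak n$ has *type* $(n_1,n_2)$ if $n_1=\dim \mathfrak n/[\mathfrak n,\mathfrak n]$ and $n_2=\dim[\mathfrak n,\mathfrak n]$. Polynomials $(p_1,p_2)$ are *associated* to an automorphism $\varphi$ of such an $\mathfrak n$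 if they are the polynomials of some $f^A$, $A\in GL_{n_1}(\mathbb Z)$, for which there is a surjective Lie algebra homomorphism $\pi:\mathfrak f_{n_1,2}\to\mathfrak n$ with $\ker\pi\subseteq[\mathfrak f_{n_1,2},\mathfrak f_{n_1,2}]$ and $\pi\circ f^A=\varphi\circ\pi$. **Theorem.** Let $\mathfrak n$ be a real two-step nilpotent Anosov Lie algebra of type $(n_1,n_2)$. (1) If $n_1\in\{3,4,5\}$, then $\mathfrak n\cong\mathfrak f_{n_1,2}/\mathfrak i$, where $(n_1,n_2)$ and $\mathfrak i$ are one of the following: - $(3,3)$, $\mathfrak i=0$; - $(4,6)$, $\mathfrak i=0$; - $(4,4)$, $\mathfrak i=\operatorname{span}\{[z_2,z_1],[z_4,z_3]\}$, the span of the orbit of $[z_2,z_1]$ under the transitive Klein four-group permuting $z_1,\dots,z_4$; - $(4,2)$, $\mathfrak i=\operatorname{span}\{[z_2,z_1],[z_3,z_2],[z_4,z_3],[z_1,z_4]\}$, the span of the orbit of $[z_2,z_1]$ under the cyclic permutations of $z_1,\dots,z_4$; - $(5,10)$, $\mathfrak i=0$; - $(5,9)$, $\mathfrak i=[E_1,E_1]$,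 where here and in the next two items $E_1=\operatorname{span}\{z_1,z_2\}$ and $E_2=\operatorname{span}\{z_3,z_4,z_5\}$; - $(5,6)$, $\mathfrak i=[E_1,E_1]\oplus[E_2,E_2]$; - $(5,3)$, $\mathfrak i=[E_1,E_1]\oplus[E_1,E_2]$; - $(5,5)$, $\mathfrak i=\operatorname{span}\{[z_2,z_1],[z_3,z_2],[z_4,z_3],[z_5,z_4],[z_1,z_5]\}$, the span of the orbit of $[z_2,z_1]$ under the cyclic permutations of $z_1,\dots,z_5$; - $(5,5)$, $\mathfrak i=\operatorname{span}\{[z_1,z_2],\,[z_1,z_3],\,[z_4,z_5],\,[z_2,z_4]-[z_3,z_5],\,[z_2,z_5]+[z_3,z_4]\}$. (2) Let $\varphi$ be an Anosov automorphism of $\mathfrak n$ with associated polynomials $(p_1,p_2)$. If $p_1$ is irreducible over $\mathbb Q$ and its Galois group acts doubly transitively on the roots of $p_1$, then $\mathfrak n\cong\mathfrak f_{n_1,2}$. -/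

import Mathlib

noncomputable section

/-! ### Nilpotent Lie algebras -/

/-- `L` is a real two-step nilpotent Lie algebra of type `(n₁, n₂)`: `[L, [L, L]] = 0`,
`[L, L] ≠ 0`, `dim L / [L, L] = n₁` and `dim [L, L] = n₂`. -/
structure IsTwoStepOfType (L : Type*) [LieRing L] [LieAlgebra ℝ L] (n₁ n₂ : ℕ) : Prop where
  lcs_two : LieModule.lowerCentralSeries ℝ L L 2 = ⊥
  lcs_one : LieModule.lowerCentralSeries ℝ L L 1 ≠ ⊥
  finite : FiniteDimensional ℝ L
  finrank_one : Module.finrank ℝ (L ⧸ LieModule.lowerCentralSeries ℝ L L 1) = n₁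
  finrank_two : Module.finrank ℝ (LieModule.lowerCentralSeries ℝ L L 1) = n₂

/-- The free `r`-step nilpotent real Lie algebra `𝔣_{n,r}` on `n` generators. -/
abbrev FreeNilpotent (n r : ℕ) : Type :=
  FreeLieAlgebra ℝ (Fin n) ⧸
    LieModule.lowerCentralSeries ℝ (FreeLieAlgebra ℝ (Fin n)) (FreeLieAlgebra ℝ (Fin n)) r

namespace FreeNilpotent

variable {n r : ℕ}

/-- The projection of the free Lie algebra onto `𝔣_{n,r}`. -/
def proj (n r : ℕ) : FreeLieAlgebra ℝ (Fin n) →ₗ⁅ℝ⁆ FreeNilpotent n r :=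
  { (LieSubmodule.Quotient.mk' (LieModule.lowerCentralSeries ℝ (FreeLieAlgebra ℝ (Fin n))
      (FreeLieAlgebra ℝ (Fin n)) r) : FreeLieAlgebra ℝ (Fin n) →ₗ[ℝ] FreeNilpotent n r) with
    map_lie' := fun {x y} => LieSubmodule.Quotient.mk_bracket _ x y }

theorem proj_surjective : Function.Surjective (proj n r) :=
  LieSubmodule.Quotient.surjective_mk' _

theorem proj_eq_zero {x : FreeLieAlgebra ℝ (Fin n)} :
    proj n r x = 0 ↔ x ∈ LieModule.lowerCentralSeries ℝ (FreeLieAlgebra ℝ (Fin n))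
      (FreeLieAlgebra ℝ (Fin n)) r :=
  LieSubmodule.Quotient.mk_eq_zero _

/-- The generators `z₁, …, zₙ` of `𝔣_{n,r}` (indexed from `0`). -/
def gen (n r : ℕ) (i : Fin n) : FreeNilpotent n r := proj n r (FreeLieAlgebra.of ℝ i)

theorem lcs_eq_bot :
    LieModule.lowerCentralSeries ℝ (FreeNilpotent n r) (FreeNilpotent n r) r = ⊥ := by
  rw [← LieIdeal.lowerCentralSeries_map_eq r (f := proj n r) proj_surjective, LieIdeal.map_eq_bot_iff]
  intro x hx
  exact (LieHom.mem_ker (f := proj n r)).2 (proj_eq_zero.2 hx)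

theorem lift_eq_zero (v : Fin n → FreeNilpotent n r) (x : FreeLieAlgebra ℝ (Fin n))
    (hx : x ∈ LieModule.lowerCentralSeries ℝ (FreeLieAlgebra ℝ (Fin n))
      (FreeLieAlgebra ℝ (Fin n)) r) :
    FreeLieAlgebra.lift ℝ v x = 0 := by
  have h := LieIdeal.map_lowerCentralSeries_le r (f := FreeLieAlgebra.lift ℝ v)
  rw [lcs_eq_bot] at h
  have h2 := h (LieIdeal.mem_map hx)
  simpa using h2

/-- The endomorphism of the Lie algebra `𝔣_{n,r}` that sends the generator `zⱼ` to `v j`. -/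
def hom (v : Fin n → FreeNilpotent n r) : FreeNilpotent n r →ₗ⁅ℝ⁆ FreeNilpotent n r :=
  { (Submodule.liftQ _ (FreeLieAlgebra.lift ℝ v : FreeLieAlgebra ℝ (Fin n) →ₗ[ℝ] FreeNilpotent n r)
      (fun x hx => lift_eq_zero v x hx) : FreeNilpotent n r →ₗ[ℝ] FreeNilpotent n r) with
    map_lie' := by
      intro x y
      obtain ⟨x, rfl⟩ := proj_surjective x
      obtain ⟨y, rfl⟩ := proj_surjective y
      rw [← LieHom.map_lie]
      exact LieHom.map_lie (FreeLieAlgebra.lift ℝ v) x y }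

theorem hom_gen (v : Fin n → FreeNilpotent n r) (j : Fin n) : hom v (gen n r j) = v j :=
  FreeLieAlgebra.lift_of_apply v j

/-- The endomorphism `f^A` of `𝔣_{n,r}` induced by an integer matrix `A`, which acts on the span of
the generators by `A`: the `j`-th generator goes to `∑ᵢ Aᵢⱼ zᵢ`. -/
def matrixHom (r : ℕ) (A : Matrix (Fin n) (Fin n) ℤ) : FreeNilpotent n r →ₗ⁅ℝ⁆ FreeNilpotent n r :=
  hom fun j => ∑ i, (A i j : ℝ) • gen n r i

/-- The action of a permutation on `𝔣_{n,r}` by permuting the generators. -/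
def permHom (r : ℕ) (σ : Equiv.Perm (Fin n)) : FreeNilpotent n r →ₗ⁅ℝ⁆ FreeNilpotent n r :=
  hom fun j => gen n r (σ j)

/-- The ideal `𝔦(G, w)` of `𝔣_{n,r}` generated by the orbit of `w` under a group `G` of
permutations of the generators. -/
def orbitIdeal (G : Subgroup (Equiv.Perm (Fin n))) (w : FreeNilpotent n r) :
    LieIdeal ℝ (FreeNilpotent n r) :=
  LieSubmodule.lieSpan ℝ (FreeNilpotent n r) {x | ∃ σ ∈ G, x = permHom r σ w}

/-- The ideal of `𝔣_{n,r}` generated by the brackets `[zᵢ, zⱼ]` with `i ∈ S` and `j ∈ T`;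
in `𝔣_{n,2}` it is `[span {zᵢ : i ∈ S}, span {zⱼ : j ∈ T}]`. -/
def bracketIdeal (r : ℕ) (S T : Set (Fin n)) : LieIdeal ℝ (FreeNilpotent n r) :=
  LieSubmodule.lieSpan ℝ (FreeNilpotent n r) {x | ∃ i ∈ S, ∃ j ∈ T, x = ⁅gen n r i, gen n r j⁆}

end FreeNilpotent

/-! ### Anosov Lie algebras and their polynomials -/

/-- `φ` is an Anosov automorphism of the real Lie algebra `L`: for some basis of `L` with rational
structure constants, `φ` is represented by a matrix in `GL_N(ℤ)` with no complex eigenvalue of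
modulus one. -/
def IsAnosovAut {L : Type*} [LieRing L] [LieAlgebra ℝ L] (φ : L ≃ₗ⁅ℝ⁆ L) : Prop :=
  ∃ (N : ℕ) (B : Module.Basis (Fin N) ℝ L) (M : GL (Fin N) ℤ),
    (∀ i j k, ∃ q : ℚ, B.repr ⁅B i, B j⁆ k = (q : ℝ)) ∧
    (∀ j, φ (B j) = ∑ i, ((M : Matrix (Fin N) (Fin N) ℤ) i j : ℝ) • B i) ∧
    ∀ z : ℂ, Polynomial.aeval z (M : Matrix (Fin N) (Fin N) ℤ).charpoly = 0 → ‖z‖ ≠ 1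

/-- A real Lie algebra is Anosov if it admits an Anosov automorphism. -/
def IsAnosov (L : Type*) [LieRing L] [LieAlgebra ℝ L] : Prop :=
  ∃ φ : L ≃ₗ⁅ℝ⁆ L, IsAnosovAut φ

/-- Index set of the degree two part `{[zᵢ, zⱼ] : i > j}` of the Hall basis of `𝔣_{n,2}`. -/
abbrev HallPair (n : ℕ) : Type := {p : Fin n × Fin n // p.2 < p.1}

/-- `(p₁, p₂)` are the polynomials of the automorphism `f^A` of `𝔣_{n,2} = V₁ ⊕ V₂`: the
characteristic polynomials of the integer matrices which represent `f^A` on `V₁` and on `V₂` with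
respect to the Hall basis. -/
def IsPolynomialPair {n : ℕ} (A : Matrix (Fin n) (Fin n) ℤ) (p₁ p₂ : Polynomial ℤ) : Prop :=
  p₁ = A.charpoly ∧
  ∃ A₂ : Matrix (HallPair n) (HallPair n) ℤ,
    (∀ q : HallPair n,
      FreeNilpotent.matrixHom 2 A
          ⁅FreeNilpotent.gen n 2 q.1.1, FreeNilpotent.gen n 2 q.1.2⁆ =
        ∑ p : HallPair n, (A₂ p q : ℝ) •
          ⁅FreeNilpotent.gen n 2 p.1.1, FreeNilpotent.gen n 2 p.1.2⁆) ∧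
    p₂ = A₂.charpoly

/-- `(p₁, p₂)` are polynomials associated to the automorphism `φ` of the two-step nilpotent Lie
algebra `L`: `φ` is the quotient of an automorphism `f^A` of `𝔣_{n,2}` with `A ∈ GL_n(ℤ)`, by an
ideal (the kernel of `π`) inside `[𝔣_{n,2}, 𝔣_{n,2}]`, and `(p₁, p₂)` is the pair of polynomials
of `f^A`. -/
def IsAssociatedPair {L : Type*} [LieRing L] [LieAlgebra ℝ L] (φ : L ≃ₗ⁅ℝ⁆ L) (n : ℕ)
    (p₁ p₂ : Polynomial ℤ) : Prop :=
  ∃ (A : GL (Fin n) ℤ) (π : FreeNilpotent n 2 →ₗ⁅ℝ⁆ L),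
    Function.Surjective π ∧
    π.ker ≤ LieModule.lowerCentralSeries ℝ (FreeNilpotent n 2) (FreeNilpotent n 2) 1 ∧
    (∀ x, π (FreeNilpotent.matrixHom 2 (A : Matrix (Fin n) (Fin n) ℤ) x) = φ (π x)) ∧
    IsPolynomialPair (A : Matrix (Fin n) (Fin n) ℤ) p₁ p₂

/-- The Galois group over `ℚ` of the splitting field of an integer polynomial acts doubly
transitively on the roots. -/
def GaloisDoublyTransitive (p : Polynomial ℤ) : Prop :=
  ∀ a b c d : (p.map (Int.castRingHom ℚ)).SplittingField,
    Polynomial.aeval a p = 0 → Polynomial.aeval b p = 0 →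
    Polynomial.aeval c p = 0 → Polynomial.aeval d p = 0 → a ≠ b → c ≠ d →
    ∃ σ : (p.map (Int.castRingHom ℚ)).SplittingField ≃ₐ[ℚ]
        (p.map (Int.castRingHom ℚ)).SplittingField, σ a = c ∧ σ b = d

/-! ### The table -/

/-- The Klein four-group acting transitively on four letters. -/
def kleinFour : Subgroup (Equiv.Perm (Fin 4)) :=
  Subgroup.closure
    {Equiv.swap 0 1 * Equiv.swap 2 3, Equiv.swap 0 2 * Equiv.swap 1 3}

/-- The cyclic group generated by an `n`-cycle on `n` letters. -/
def cyclicPerm (n : ℕ) : Subgroup (Equiv.Perm (Fin n)) :=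
  Subgroup.zpowers (finRotate n)

open FreeNilpotent in
/-- The ideal of `𝔣_{5,2}` for the dihedral group of order ten with non-real eigenvalues: with
generators `z, x, y, x', y'` it is spanned by
`[z,x], [z,y], [x',y'], [x,x'] - [y,y'], [x,y'] + [y,x']`. -/
def dihedralIdeal : LieIdeal ℝ (FreeNilpotent 5 2) :=
  LieSubmodule.lieSpan ℝ (FreeNilpotent 5 2)
    {⁅gen 5 2 0, gen 5 2 1⁆, ⁅gen 5 2 0, gen 5 2 2⁆, ⁅gen 5 2 3, gen 5 2 4⁆,
      ⁅gen 5 2 1, gen 5 2 3⁆ - ⁅gen 5 2 2, gen 5 2 4⁆,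
      ⁅gen 5 2 1, gen 5 2 4⁆ + ⁅gen 5 2 2, gen 5 2 3⁆}

open FreeNilpotent in
/-- `AnosovTable n₁ n₂ I`: the Lie algebra `𝔣_{n₁,2} / I`, of type `(n₁, n₂)`, is a row of the table
of two-step Anosov Lie algebras with `n₁ ≤ 5`. -/
inductive AnosovTable : (n₁ n₂ : ℕ) → LieIdeal ℝ (FreeNilpotent n₁ 2) → Prop
  | free_three : AnosovTable 3 3 ⊥
  | free_four : AnosovTable 4 6 ⊥
  | klein : AnosovTable 4 4 (orbitIdeal kleinFour ⁅gen 4 2 1, gen 4 2 0⁆)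
  | cyclic_four : AnosovTable 4 2 (orbitIdeal (cyclicPerm 4) ⁅gen 4 2 1, gen 4 2 0⁆)
  | free_five : AnosovTable 5 10 ⊥
  | two_three_a : AnosovTable 5 9 (bracketIdeal 2 {0, 1} {0, 1})
  | two_three_b : AnosovTable 5 6 (bracketIdeal 2 {0, 1} {0, 1} ⊔ bracketIdeal 2 {2, 3, 4} {2, 3, 4})
  | two_three_c : AnosovTable 5 3 (bracketIdeal 2 {0, 1} {0, 1} ⊔ bracketIdeal 2 {0, 1} {2, 3, 4})
  | cyclic_five : AnosovTable 5 5 (orbitIdeal (cyclicPerm 5) ⁅gen 5 2 1, gen 5 2 0⁆)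
  | dihedral : AnosovTable 5 5 dihedralIdeal

end

/-!
Let `φ` be an Anosov automorphism of `L`. A complement of `[L, L]` and a basis of `[L, L]` that is
compatible with the rational structure turn `φ` into two matrices, `A` on `L / [L, L]` and `D` on
`[L, L]`, whose characteristic polynomials `p` and `q` have integral coefficients, unit constant
terms and no roots of modulus one (`exists_model_of_isAnosov`, `exists_model_of_isAssociatedPair`).
The bracket of eigenvectors of `A` for the eigenvalues `a`, `b` is zero or an eigenvector of `D` for
`a b`. If the roots of `p` are distinct, `L` is thus governed by the graph on these roots in which
`a` and `b` are joined if `q (a b) = 0`. Field automorphisms act on this graph, and so does complex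
conjugation.

Multiplicative relations between the roots are excluded by taking logarithms of absolute values:
these are non-zero and add up to zero over the roots of each factor of `p`. A relation
`a b = c d` between two disjoint edges and its images under the Galois group form a system of linear
equations that has no such solution. So distinct edges carry distinct eigenvalues of `D`, and
`dim [L, L]` is the number of edges (`Roots.dim_eq_sum_edge`).

If the Galois group is doubly transitive, the graph is complete, since it has an edge, and the
relation is excluded by averaging over the stabilizer of a root (`eq_zero_of_doublyTransitive`).
Counting dimensions, `L` is free.

For `n₁ ≤ 5` the polynomial `p` is irreducible or a product of two factors of degree at least two,
because a linear factor has the root `±1`. Symmetry leaves few graphs. In degree four opposite edges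
occur together (`inTable_of_opposite_edges`); here `p` may also be the square of a quadratic
polynomial, in which case the generalized eigenspaces commute (`inTable_four_of_sq`). In the
irreducible case of degree five the Galois group contains a rotation of the roots, so the graph is
complete or a pentagon (`inTable_of_isCyclic`); in the reducible case all roots of the quadratic
factor are joined to all roots of the cubic one or none are, and the latter are pairwise joined or
pairwise not joined (`inTable_of_isTwoThree`). It remains to descend to the real numbers. A
set of roots stable under complex conjugation spans a real subspace, which suffices except
for the pentagon: there conjugation is trivial or a reflection, and these two cases give the two
quotients of type `(5, 5)`. In each case explicit generators of `L` satisfy the relations of an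
ideal in the table, and the resulting surjection is injective by counting dimensions
(`nonempty_equiv_quotient`).
-/

namespace TwoStepAnosov

open Polynomial FreeNilpotent

/-! ### Homomorphisms from the free two-step nilpotent Lie algebra -/

section LieSide

variable {L : Type*} [LieRing L] [LieAlgebra ℝ L] {n m : ℕ}

theorem lie_mem_span_lie {ι : Type*} (u : ι → L) {x y : L}
    (hx : x ∈ Submodule.span ℝ (Set.range u)) (hy : y ∈ Submodule.span ℝ (Set.range u)) :
    ⁅x, y⁆ ∈ Submodule.span ℝ (Set.range fun p : ι × ι => ⁅u p.1, u p.2⁆) := by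
  induction hx using Submodule.span_induction with
  | zero => simp
  | add a b _ _ ha hb => rw [add_lie]; exact add_mem ha hb
  | smul r a _ ha => rw [smul_lie]; exact Submodule.smul_mem _ _ ha
  | mem a ha =>
    obtain ⟨i, rfl⟩ := ha
    induction hy using Submodule.span_induction with
    | zero => simp
    | add a b _ _ ha hb => rw [lie_add]; exact add_mem ha hb
    | smul r a _ ha => rw [lie_smul]; exact Submodule.smul_mem _ _ ha
    | mem b hb =>
      obtain ⟨j, rfl⟩ := hb
      exact Submodule.subset_span ⟨(i, j), rfl⟩

theorem lie_mem_lcs_one (x y : L) : ⁅x, y⁆ ∈ LieModule.lowerCentralSeries ℝ L L 1 := by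
  rw [LieModule.lowerCentralSeries_succ]
  exact LieSubmodule.lie_mem_lie (LieSubmodule.mem_top x) (by simp)

theorem lie_eq_zero_of_mem_lcs_one (h : LieModule.lowerCentralSeries ℝ L L 2 = ⊥) (x : L) {y : L}
    (hy : y ∈ LieModule.lowerCentralSeries ℝ L L 1) : ⁅x, y⁆ = 0 := by
  have : ⁅x, y⁆ ∈ LieModule.lowerCentralSeries ℝ L L 2 := by
    rw [LieModule.lowerCentralSeries_succ]
    exact LieSubmodule.lie_mem_lie (LieSubmodule.mem_top x) hy
  rwa [h, LieSubmodule.mem_bot] at this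

theorem lie_eq_zero_of_mem_lcs_one' (h : LieModule.lowerCentralSeries ℝ L L 2 = ⊥) {x : L} (y : L)
    (hx : x ∈ LieModule.lowerCentralSeries ℝ L L 1) : ⁅x, y⁆ = 0 := by
  rw [← lie_skew, lie_eq_zero_of_mem_lcs_one h y hx, neg_zero]

theorem lcs_one_eq_span : (LieModule.lowerCentralSeries ℝ L L 1).toSubmodule =
    Submodule.span ℝ (Set.range fun z : L × L => ⁅z.1, z.2⁆) := by
  rw [LieModule.lowerCentralSeries_succ, LieSubmodule.lieIdeal_oper_eq_linear_span']
  congr 1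
  ext z
  simp

/-- If `u` spans `L` modulo the central ideal `[L, L]`, then the brackets of the `u i` span
`[L, L]`. -/
theorem lcs_one_eq_span_of_span (h : LieModule.lowerCentralSeries ℝ L L 2 = ⊥) {ι : Type*}
    (u : ι → L)
    (hu : Submodule.span ℝ (Set.range u) ⊔
      (LieModule.lowerCentralSeries ℝ L L 1).toSubmodule = ⊤) :
    (LieModule.lowerCentralSeries ℝ L L 1).toSubmodule =
      Submodule.span ℝ (Set.range fun p : ι × ι => ⁅u p.1, u p.2⁆) := by
  apply le_antisymm
  · rw [lcs_one_eq_span, Submodule.span_le]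
    rintro _ ⟨⟨x, y⟩, rfl⟩
    obtain ⟨x₁, hx₁, x₂, hx₂, rfl⟩ := Submodule.mem_sup.1 (hu ▸ Submodule.mem_top : x ∈ _)
    obtain ⟨y₁, hy₁, y₂, hy₂, rfl⟩ := Submodule.mem_sup.1 (hu ▸ Submodule.mem_top : y ∈ _)
    have e : ⁅x₁ + x₂, y₁ + y₂⁆ = ⁅x₁, y₁⁆ := by
      rw [lie_add, add_lie, lie_eq_zero_of_mem_lcs_one h _ hy₂,
        lie_eq_zero_of_mem_lcs_one' h _ hx₂, add_zero, add_zero]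
    simp only [e, SetLike.mem_coe]
    exact lie_mem_span_lie u hx₁ hy₁
  · rw [Submodule.span_le]
    rintro _ ⟨p, rfl⟩
    exact lie_mem_lcs_one _ _

/-- The homomorphism from `𝔣_{n,2}` to a two-step nilpotent Lie algebra that sends the `j`-th
generator to `u j`. -/
noncomputable def lift (h : LieModule.lowerCentralSeries ℝ L L 2 = ⊥) (u : Fin n → L) :
    FreeNilpotent n 2 →ₗ⁅ℝ⁆ L :=
  { (Submodule.liftQ _ (FreeLieAlgebra.lift ℝ u : FreeLieAlgebra ℝ (Fin n) →ₗ[ℝ] L)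
      (fun x hx => by
        have h1 := LieIdeal.map_lowerCentralSeries_le 2 (f := FreeLieAlgebra.lift ℝ u)
        rw [h] at h1
        simpa using h1 (LieIdeal.mem_map hx)) : FreeNilpotent n 2 →ₗ[ℝ] L) with
    map_lie' := by
      intro x y
      obtain ⟨x, rfl⟩ := proj_surjective x
      obtain ⟨y, rfl⟩ := proj_surjective y
      rw [← LieHom.map_lie]
      exact LieHom.map_lie (FreeLieAlgebra.lift ℝ u) x y }

theorem lift_gen (h : LieModule.lowerCentralSeries ℝ L L 2 = ⊥) (u : Fin n → L) (j : Fin n) :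
    lift h u (gen n 2 j) = u j :=
  FreeLieAlgebra.lift_of_apply u j

/-- A Lie subalgebra of `𝔣_{n,2}` that contains the generators is everything. -/
theorem eq_top_of_gen_mem (U : LieSubalgebra ℝ (FreeNilpotent n 2)) (hU : ∀ i, gen n 2 i ∈ U) :
    U = ⊤ := by
  have key : U.incl.comp (FreeLieAlgebra.lift ℝ (fun i => (⟨gen n 2 i, hU i⟩ : U))) = proj n 2 := by
    apply FreeLieAlgebra.hom_ext
    intro i
    simp [FreeLieAlgebra.lift_of_apply, gen]
  rw [eq_top_iff]
  intro x _
  obtain ⟨x, rfl⟩ := proj_surjective x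
  rw [← key]
  exact Subtype.mem _

theorem span_gen_sup_span_lie_gen :
    Submodule.span ℝ (Set.range (gen n 2)) ⊔
      Submodule.span ℝ (Set.range fun p : Fin n × Fin n => ⁅gen n 2 p.1, gen n 2 p.2⁆) = ⊤ := by
  set P := Submodule.span ℝ (Set.range (gen n 2))
  set Q := Submodule.span ℝ (Set.range fun p : Fin n × Fin n => ⁅gen n 2 p.1, gen n 2 p.2⁆)
  have hQ : Q ≤ (LieModule.lowerCentralSeries ℝ (FreeNilpotent n 2)
      (FreeNilpotent n 2) 1).toSubmodule := by
    rw [Submodule.span_le]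
    rintro _ ⟨p, rfl⟩
    exact lie_mem_lcs_one _ _
  have hz : ∀ x ∈ P, ∀ y ∈ P, ⁅x, y⁆ ∈ Q := fun x hx y hy => lie_mem_span_lie _ hx hy
  let U : LieSubalgebra ℝ (FreeNilpotent n 2) :=
    { P ⊔ Q with
      lie_mem' := by
        intro x y hx hy
        obtain ⟨x₁, hx₁, x₂, hx₂, rfl⟩ := Submodule.mem_sup.1 hx
        obtain ⟨y₁, hy₁, y₂, hy₂, rfl⟩ := Submodule.mem_sup.1 hy
        rw [lie_add, lie_eq_zero_of_mem_lcs_one lcs_eq_bot _ (hQ hy₂), add_lie,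
          lie_eq_zero_of_mem_lcs_one' lcs_eq_bot _ (hQ hx₂), add_zero, add_zero]
        exact Submodule.mem_sup_right (hz _ hx₁ _ hy₁) }
  have := eq_top_of_gen_mem U (fun i =>
    Submodule.mem_sup_left (Submodule.subset_span ⟨i, rfl⟩))
  exact congrArg LieSubalgebra.toSubmodule this

/-- A two-step nilpotent Lie algebra `L` of type `(n, m)` is the quotient of `𝔣_{n,2}` by an ideal
`I` as soon as some `u` generating `L` satisfies the relations in `I`, and `m` brackets of
generators span `[𝔣, 𝔣]` modulo `I`: the induced surjection is then an isomorphism for reasons of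
dimension. -/
theorem nonempty_equiv_quotient (hL : IsTwoStepOfType L n m) (u : Fin n → L)
    (hu : Submodule.span ℝ (Set.range u) ⊔
      (LieModule.lowerCentralSeries ℝ L L 1).toSubmodule = ⊤)
    (I : LieIdeal ℝ (FreeNilpotent n 2)) (hI : ∀ x ∈ I, lift hL.lcs_two u x = 0)
    (T : Finset (Fin n × Fin n)) (hT : T.card ≤ m)
    (hTI : ∀ i j, j < i → ⁅gen n 2 i, gen n 2 j⁆ ∈ I.toSubmodule ⊔
      Submodule.span ℝ ((fun p : Fin n × Fin n => ⁅gen n 2 p.1, gen n 2 p.2⁆) '' T)) :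
    Nonempty (L ≃ₗ⁅ℝ⁆ (FreeNilpotent n 2 ⧸ I)) := by
  classical
  have := hL.finite
  let mk : FreeNilpotent n 2 →ₗ[ℝ] FreeNilpotent n 2 ⧸ I := LieSubmodule.Quotient.mk' I
  have mk_surj : Function.Surjective mk := LieSubmodule.Quotient.surjective_mk' I
  have mk_zero : ∀ x, mk x = 0 ↔ x ∈ I := fun x => LieSubmodule.Quotient.mk_eq_zero _
  let F : FreeNilpotent n 2 ⧸ I →ₗ⁅ℝ⁆ L :=
    { (Submodule.liftQ _ (lift hL.lcs_two u : FreeNilpotent n 2 →ₗ[ℝ] L) hI :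
        FreeNilpotent n 2 ⧸ I →ₗ[ℝ] L) with
      map_lie' := by
        intro x y
        obtain ⟨x, rfl⟩ := mk_surj x
        obtain ⟨y, rfl⟩ := mk_surj y
        exact LieHom.map_lie (lift hL.lcs_two u) x y }
  have hF : ∀ x, F (mk x) = lift hL.lcs_two u x := fun x => rfl
  have F_surj : Function.Surjective F := by
    have h1 : LinearMap.range (F : FreeNilpotent n 2 ⧸ I →ₗ[ℝ] L) = ⊤ := by
      rw [eq_top_iff, ← hu, lcs_one_eq_span_of_span hL.lcs_two u hu, sup_le_iff,
        Submodule.span_le, Submodule.span_le]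
      constructor
      · rintro _ ⟨i, rfl⟩
        exact ⟨mk (gen n 2 i), by simp [hF, lift_gen]⟩
      · rintro _ ⟨p, rfl⟩
        exact ⟨mk ⁅gen n 2 p.1, gen n 2 p.2⁆, by simp [hF, lift_gen, LieHom.map_lie]⟩
    intro x
    exact LinearMap.range_eq_top.1 h1 x
  let X : Finset (FreeNilpotent n 2 ⧸ I) :=
    Finset.univ.image (fun i => mk (gen n 2 i)) ∪
      T.image (fun p => mk ⁅gen n 2 p.1, gen n 2 p.2⁆)
  have hX : Submodule.span ℝ (X : Set (FreeNilpotent n 2 ⧸ I)) = ⊤ := by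
    rw [eq_top_iff, ← LinearMap.range_eq_top.2 mk_surj, LinearMap.range_eq_map,
      ← span_gen_sup_span_lie_gen, Submodule.map_sup, Submodule.map_span, Submodule.map_span,
      sup_le_iff, Submodule.span_le, Submodule.span_le]
    have hlt : ∀ i j, j < i → mk ⁅gen n 2 i, gen n 2 j⁆ ∈
        Submodule.span ℝ (X : Set (FreeNilpotent n 2 ⧸ I)) := by
      intro i j hij
      obtain ⟨a, ha, b, hb, hab⟩ := Submodule.mem_sup.1 (hTI i j hij)
      rw [← hab, map_add, (mk_zero a).2 ha, zero_add]
      have := Submodule.mem_map_of_mem (f := mk) hb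
      rw [Submodule.map_span] at this
      refine Submodule.span_mono ?_ this
      rintro _ ⟨_, ⟨p, hp, rfl⟩, rfl⟩
      simp only [X, Finset.coe_union, Finset.coe_image]
      exact Or.inr ⟨p, hp, rfl⟩
    constructor
    · rintro _ ⟨_, ⟨i, rfl⟩, rfl⟩
      apply Submodule.subset_span
      simp only [X, Finset.coe_union, Finset.coe_image]
      exact Or.inl ⟨i, by simp, rfl⟩
    · rintro _ ⟨_, ⟨⟨i, j⟩, rfl⟩, rfl⟩
      rcases lt_trichotomy j i with hij | rfl | hij
      · exact hlt i j hij
      · simp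
      · have := hlt j i hij
        have e : ⁅gen n 2 i, gen n 2 j⁆ = -⁅gen n 2 j, gen n 2 i⁆ := (lie_skew _ _).symm
        simp only [e, map_neg, SetLike.mem_coe]
        exact neg_mem this
  have : FiniteDimensional ℝ (FreeNilpotent n 2 ⧸ I) :=
    ⟨⟨X, hX⟩⟩
  have hcard : Module.finrank ℝ (FreeNilpotent n 2 ⧸ I) ≤ n + m := by
    have h1 := finrank_span_finset_le_card (R := ℝ) X
    rw [Set.finrank, hX, finrank_top] at h1
    refine h1.trans ((Finset.card_union_le _ _).trans ?_)
    have h2 : (Finset.univ.image (fun i => mk (gen n 2 i))).card ≤ n := by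
      simpa using Finset.card_image_le (s := (Finset.univ : Finset (Fin n)))
        (f := fun i => mk (gen n 2 i))
    have h3 := Finset.card_image_le (s := T) (f := fun p => mk ⁅gen n 2 p.1, gen n 2 p.2⁆)
    omega
  have hdim : Module.finrank ℝ L = n + m := by
    have := Submodule.finrank_quotient_add_finrank
      (LieModule.lowerCentralSeries ℝ L L 1).toSubmodule
    rw [← this]
    exact congrArg₂ _ hL.finrank_one hL.finrank_two
  have hge := LinearMap.finrank_le_finrank_of_surjective
    (f := (F : FreeNilpotent n 2 ⧸ I →ₗ[ℝ] L)) F_surj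
  have F_inj : Function.Injective F :=
    (LinearMap.injective_iff_surjective_of_finrank_eq_finrank
      (f := (F : FreeNilpotent n 2 ⧸ I →ₗ[ℝ] L)) (by omega)).2 F_surj
  exact ⟨(LieEquiv.ofBijective F ⟨F_inj, F_surj⟩).symm⟩

end LieSide

/-! ### Relations that identify the quotients in the table -/

section Rows

variable {L : Type*} [LieRing L] [LieAlgebra ℝ L] {n m : ℕ}

/-- The permutations that preserve a binary relation. -/
def relationStabilizer (R : Fin n → Fin n → Prop) : Subgroup (Equiv.Perm (Fin n)) where
  carrier := {σ | ∀ i j, R (σ i) (σ j) ↔ R i j}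
  one_mem' := fun _ _ => Iff.rfl
  mul_mem' := fun {σ τ} hσ hτ i j => (hσ (τ i) (τ j)).trans (hτ i j)
  inv_mem' := fun {σ} hσ i j => by simpa using (hσ (σ⁻¹ i) (σ⁻¹ j)).symm

theorem lift_eq_zero_of_mem_orbitIdeal (h : LieModule.lowerCentralSeries ℝ L L 2 = ⊥)
    (u : Fin n → L) (G : Subgroup (Equiv.Perm (Fin n))) (R : Fin n → Fin n → Prop)
    (hG : G ≤ relationStabilizer R) (hu : ∀ i j, R i j → ⁅u i, u j⁆ = 0) {a b : Fin n}
    (hab : R a b) (x : FreeNilpotent n 2) (hx : x ∈ orbitIdeal G ⁅gen n 2 a, gen n 2 b⁆) :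
    lift h u x = 0 := by
  have : orbitIdeal G ⁅gen n 2 a, gen n 2 b⁆ ≤ (lift h u).ker := by
    refine LieSubmodule.lieSpan_le.2 ?_
    rintro _ ⟨σ, hσ, rfl⟩
    have h1 : permHom 2 σ ⁅gen n 2 a, gen n 2 b⁆ = ⁅gen n 2 (σ a), gen n 2 (σ b)⁆ := by
      rw [LieHom.map_lie, permHom, hom_gen, hom_gen]
    rw [h1, SetLike.mem_coe, LieHom.mem_ker, LieHom.map_lie, lift_gen, lift_gen]
    exact hu _ _ ((hG hσ a b).2 hab)
  exact LieHom.mem_ker.1 (this hx)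

theorem lie_gen_mem_orbitIdeal (G : Subgroup (Equiv.Perm (Fin n))) {σ : Equiv.Perm (Fin n)}
    (hσ : σ ∈ G) {a b i j : Fin n} (hi : σ a = i) (hj : σ b = j) :
    ⁅gen n 2 i, gen n 2 j⁆ ∈ orbitIdeal G ⁅gen n 2 a, gen n 2 b⁆ := by
  refine LieSubmodule.subset_lieSpan ⟨σ, hσ, ?_⟩
  rw [LieHom.map_lie, permHom, hom_gen, hom_gen, hi, hj]

theorem lie_gen_mem_orbitIdeal' (G : Subgroup (Equiv.Perm (Fin n))) {σ : Equiv.Perm (Fin n)}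
    (hσ : σ ∈ G) {a b i j : Fin n} (hi : σ a = j) (hj : σ b = i) :
    ⁅gen n 2 i, gen n 2 j⁆ ∈ orbitIdeal G ⁅gen n 2 a, gen n 2 b⁆ := by
  have := neg_mem (lie_gen_mem_orbitIdeal G hσ hi hj)
  rwa [lie_skew] at this

theorem lift_eq_zero_of_mem_bracketIdeal (h : LieModule.lowerCentralSeries ℝ L L 2 = ⊥)
    (u : Fin n → L) (S T : Set (Fin n)) (hu : ∀ i ∈ S, ∀ j ∈ T, ⁅u i, u j⁆ = 0) :
    bracketIdeal 2 S T ≤ (lift h u).ker := by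
  refine LieSubmodule.lieSpan_le.2 ?_
  rintro _ ⟨i, hi, j, hj, rfl⟩
  rw [SetLike.mem_coe, LieHom.mem_ker, LieHom.map_lie, lift_gen, lift_gen]
  exact hu _ hi _ hj

theorem lie_gen_mem_bracketIdeal {S T : Set (Fin n)} {i j : Fin n} (hi : i ∈ S) (hj : j ∈ T) :
    ⁅gen n 2 i, gen n 2 j⁆ ∈ bracketIdeal 2 S T :=
  LieSubmodule.subset_lieSpan ⟨i, hi, j, hj, rfl⟩

theorem lie_gen_mem_bracketIdeal' {S T : Set (Fin n)} {i j : Fin n} (hi : i ∈ T) (hj : j ∈ S) :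
    ⁅gen n 2 i, gen n 2 j⁆ ∈ bracketIdeal 2 S T := by
  have := neg_mem (lie_gen_mem_bracketIdeal (n := n) hj hi)
  rwa [lie_skew] at this

/-- A tuple generating `L`: it spans `L` modulo `[L, L]`. -/
def Generates (u : Fin n → L) : Prop :=
  Submodule.span ℝ (Set.range u) ⊔ (LieModule.lowerCentralSeries ℝ L L 1).toSubmodule = ⊤

theorem nonempty_equiv_quotient_bot (hL : IsTwoStepOfType L n m) (u : Fin n → L)
    (hu : Generates u)
    (hm : (Finset.univ.filter fun p : Fin n × Fin n => p.2 < p.1).card ≤ m) :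
    Nonempty (L ≃ₗ⁅ℝ⁆ (FreeNilpotent n 2 ⧸ (⊥ : LieIdeal ℝ (FreeNilpotent n 2)))) := by
  refine nonempty_equiv_quotient hL u hu ⊥ ?_ _ hm ?_
  · intro x hx
    rw [(LieSubmodule.mem_bot x).1 hx, map_zero]
  · intro i j hij
    exact Submodule.mem_sup_right (Submodule.subset_span ⟨(i, j), by simpa using hij, rfl⟩)

theorem nonempty_equiv_freeNilpotent (hL : IsTwoStepOfType L n m) (u : Fin n → L)
    (hu : Generates u)
    (hm : (Finset.univ.filter fun p : Fin n × Fin n => p.2 < p.1).card ≤ m) :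
    Nonempty (L ≃ₗ⁅ℝ⁆ FreeNilpotent n 2) := by
  obtain ⟨e⟩ := nonempty_equiv_quotient_bot hL u hu hm
  let F : FreeNilpotent n 2 →ₗ⁅ℝ⁆ FreeNilpotent n 2 ⧸ (⊥ : LieIdeal ℝ (FreeNilpotent n 2)) :=
    { (LieSubmodule.Quotient.mk' (⊥ : LieIdeal ℝ (FreeNilpotent n 2)) :
        FreeNilpotent n 2 →ₗ[ℝ] _) with
      map_lie' := fun {x y} => LieSubmodule.Quotient.mk_bracket _ x y }
  have hF : Function.Bijective F := by
    constructor
    · rw [injective_iff_map_eq_zero]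
      intro x hx
      exact (LieSubmodule.mem_bot x).1 ((LieSubmodule.Quotient.mk_eq_zero _).1 hx)
    · exact LieSubmodule.Quotient.surjective_mk' _
  exact ⟨e.trans (LieEquiv.ofBijective F hF).symm⟩

theorem table_klein (hL : IsTwoStepOfType L 4 m) (hm : m = 4) (u : Fin 4 → L) (hu : Generates u)
    (h : ∀ i j : Fin 4, i.val / 2 = j.val / 2 → ⁅u i, u j⁆ = 0) :
    ∃ I : LieIdeal ℝ (FreeNilpotent 4 2), AnosovTable 4 m I ∧
        Nonempty (L ≃ₗ⁅ℝ⁆ (FreeNilpotent 4 2 ⧸ I)) := by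
  subst hm
  refine ⟨_, AnosovTable.klein, nonempty_equiv_quotient hL u hu _
    (lift_eq_zero_of_mem_orbitIdeal _ u _ (fun i j => i.val / 2 = j.val / 2) ?_ h (by decide))
    {(2, 0), (2, 1), (3, 0), (3, 1)} (by decide) ?_⟩
  · rw [kleinFour, Subgroup.closure_le]
    rintro σ (rfl | rfl) <;> intro i j <;> revert i j <;> decide
  · have h1 : Equiv.swap 0 2 * Equiv.swap 1 3 ∈ kleinFour :=
      Subgroup.subset_closure (by simp)
    intro i j hij
    have hc : (i = 1 ∧ j = 0) ∨ (i = 3 ∧ j = 2) ∨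
        (i, j) ∈ ({(2, 0), (2, 1), (3, 0), (3, 1)} : Finset (Fin 4 × Fin 4)) := by
      revert i j; decide
    rcases hc with ⟨rfl, rfl⟩ | ⟨rfl, rfl⟩ | hc
    · exact Submodule.mem_sup_left (lie_gen_mem_orbitIdeal _ (one_mem _) rfl rfl)
    · exact Submodule.mem_sup_left (lie_gen_mem_orbitIdeal _ h1 (by decide) (by decide))
    · exact Submodule.mem_sup_right (Submodule.subset_span ⟨(i, j), by exact_mod_cast hc, rfl⟩)

theorem table_cyclic_four (hL : IsTwoStepOfType L 4 m) (hm : m = 2) (u : Fin 4 → L)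
    (hu : Generates u) (h : ∀ i j : Fin 4, i.val % 2 ≠ j.val % 2 → ⁅u i, u j⁆ = 0) :
    ∃ I : LieIdeal ℝ (FreeNilpotent 4 2), AnosovTable 4 m I ∧
        Nonempty (L ≃ₗ⁅ℝ⁆ (FreeNilpotent 4 2 ⧸ I)) := by
  subst hm
  refine ⟨_, AnosovTable.cyclic_four, nonempty_equiv_quotient hL u hu _
    (lift_eq_zero_of_mem_orbitIdeal _ u _ (fun i j => i.val % 2 ≠ j.val % 2) ?_ h (by decide))
    {(2, 0), (3, 1)} (by decide) ?_⟩
  · rw [cyclicPerm, Subgroup.zpowers_le]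
    intro i j
    revert i j
    decide
  · have h1 : finRotate 4 ∈ cyclicPerm 4 := Subgroup.mem_zpowers _
    intro i j hij
    have hc : (i = 1 ∧ j = 0) ∨ (i = 2 ∧ j = 1) ∨ (i = 3 ∧ j = 2) ∨ (i = 3 ∧ j = 0) ∨
        (i, j) ∈ ({(2, 0), (3, 1)} : Finset (Fin 4 × Fin 4)) := by
      revert i j; decide
    rcases hc with ⟨rfl, rfl⟩ | ⟨rfl, rfl⟩ | ⟨rfl, rfl⟩ | ⟨rfl, rfl⟩ | hc
    · exact Submodule.mem_sup_left (lie_gen_mem_orbitIdeal _ (one_mem _) rfl rfl)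
    · exact Submodule.mem_sup_left (lie_gen_mem_orbitIdeal _ h1 (by decide) (by decide))
    · exact Submodule.mem_sup_left
        (lie_gen_mem_orbitIdeal _ (mul_mem h1 h1) (by decide) (by decide))
    · exact Submodule.mem_sup_left
        (lie_gen_mem_orbitIdeal' _ (mul_mem (mul_mem h1 h1) h1) (by decide) (by decide))
    · exact Submodule.mem_sup_right (Submodule.subset_span ⟨(i, j), by exact_mod_cast hc, rfl⟩)

theorem table_cyclic_five (hL : IsTwoStepOfType L 5 m) (hm : m = 5) (u : Fin 5 → L)
    (hu : Generates u) (h : ∀ i : Fin 5, ⁅u i, u (i + 1)⁆ = 0) :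
    ∃ I : LieIdeal ℝ (FreeNilpotent 5 2), AnosovTable 5 m I ∧
        Nonempty (L ≃ₗ⁅ℝ⁆ (FreeNilpotent 5 2 ⧸ I)) := by
  subst hm
  refine ⟨_, AnosovTable.cyclic_five, nonempty_equiv_quotient hL u hu _
    (lift_eq_zero_of_mem_orbitIdeal _ u _ (fun i j => j = i + 1 ∨ i = j + 1) ?_ ?_ (by decide))
    {(2, 0), (3, 1), (4, 2), (3, 0), (4, 1)} (by decide) ?_⟩
  · rw [cyclicPerm, Subgroup.zpowers_le]
    intro i j
    revert i j
    decide
  · rintro i j (rfl | rfl)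
    · exact h i
    · rw [← lie_skew, h j, neg_zero]
  · have h1 : finRotate 5 ∈ cyclicPerm 5 := Subgroup.mem_zpowers _
    intro i j hij
    have hc : (i = 1 ∧ j = 0) ∨ (i = 2 ∧ j = 1) ∨ (i = 3 ∧ j = 2) ∨ (i = 4 ∧ j = 3) ∨
        (i = 4 ∧ j = 0) ∨
        (i, j) ∈ ({(2, 0), (3, 1), (4, 2), (3, 0), (4, 1)} : Finset (Fin 5 × Fin 5)) := by
      revert i j; decide
    rcases hc with ⟨rfl, rfl⟩ | ⟨rfl, rfl⟩ | ⟨rfl, rfl⟩ | ⟨rfl, rfl⟩ | ⟨rfl, rfl⟩ | hc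
    · exact Submodule.mem_sup_left (lie_gen_mem_orbitIdeal _ (one_mem _) rfl rfl)
    · exact Submodule.mem_sup_left (lie_gen_mem_orbitIdeal _ h1 (by decide) (by decide))
    · exact Submodule.mem_sup_left
        (lie_gen_mem_orbitIdeal _ (mul_mem h1 h1) (by decide) (by decide))
    · exact Submodule.mem_sup_left
        (lie_gen_mem_orbitIdeal _ (mul_mem (mul_mem h1 h1) h1) (by decide) (by decide))
    · exact Submodule.mem_sup_left (lie_gen_mem_orbitIdeal' _
        (mul_mem (mul_mem (mul_mem h1 h1) h1) h1) (by decide) (by decide))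
    · exact Submodule.mem_sup_right (Submodule.subset_span ⟨(i, j), by exact_mod_cast hc, rfl⟩)

theorem table_two_three_a (hL : IsTwoStepOfType L 5 m) (hm : m = 9) (u : Fin 5 → L)
    (hu : Generates u) (h₁ : ∀ i j : Fin 5, i < 2 → j < 2 → ⁅u i, u j⁆ = 0) :
    ∃ I : LieIdeal ℝ (FreeNilpotent 5 2), AnosovTable 5 m I ∧
        Nonempty (L ≃ₗ⁅ℝ⁆ (FreeNilpotent 5 2 ⧸ I)) := by
  subst hm
  have m0 : ∀ i ∈ ({0, 1} : Set (Fin 5)), i < 2 := by rintro i (rfl | rfl) <;> decide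
  refine ⟨_, AnosovTable.two_three_a, nonempty_equiv_quotient hL u hu _
    (fun x hx => LieHom.mem_ker.1 (lift_eq_zero_of_mem_bracketIdeal hL.lcs_two u _ _
      (fun i hi j hj => h₁ i j (m0 i hi) (m0 j hj)) hx))
    (Finset.univ.filter fun p => p.2 < p.1 ∧ 2 ≤ p.1) (by decide) ?_⟩
  intro i j hij
  have hc : (i = 1 ∧ j = 0) ∨ 2 ≤ i := by revert i j; decide
  rcases hc with ⟨rfl, rfl⟩ | hc
  · exact Submodule.mem_sup_left (lie_gen_mem_bracketIdeal (by simp) (by simp))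
  · exact Submodule.mem_sup_right (Submodule.subset_span ⟨(i, j), by simpa using ⟨hij, hc⟩, rfl⟩)

theorem table_two_three_b (hL : IsTwoStepOfType L 5 m) (hm : m = 6) (u : Fin 5 → L)
    (hu : Generates u) (h₁ : ∀ i j : Fin 5, i < 2 → j < 2 → ⁅u i, u j⁆ = 0)
    (h₂ : ∀ i j : Fin 5, 2 ≤ i → 2 ≤ j → ⁅u i, u j⁆ = 0) :
    ∃ I : LieIdeal ℝ (FreeNilpotent 5 2), AnosovTable 5 m I ∧
        Nonempty (L ≃ₗ⁅ℝ⁆ (FreeNilpotent 5 2 ⧸ I)) := by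
  subst hm
  have m0 : ∀ i ∈ ({0, 1} : Set (Fin 5)), i < 2 := by rintro i (rfl | rfl) <;> decide
  have m1 : ∀ i ∈ ({2, 3, 4} : Set (Fin 5)), 2 ≤ i := by rintro i (rfl | rfl | rfl) <;> decide
  have m2 : ∀ i : Fin 5, 2 ≤ i → i ∈ ({2, 3, 4} : Set (Fin 5)) := by decide
  refine ⟨_, AnosovTable.two_three_b, nonempty_equiv_quotient hL u hu _
    (fun x hx => LieHom.mem_ker.1 (sup_le (lift_eq_zero_of_mem_bracketIdeal hL.lcs_two u _ _
      (fun i hi j hj => h₁ i j (m0 i hi) (m0 j hj))) (lift_eq_zero_of_mem_bracketIdeal hL.lcs_two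
        u _ _ (fun i hi j hj => h₂ i j (m1 i hi) (m1 j hj))) hx))
    (Finset.univ.filter fun p => 2 ≤ p.1 ∧ p.2 < 2) (by decide) ?_⟩
  intro i j hij
  have hc : (i = 1 ∧ j = 0) ∨ (2 ≤ i ∧ 2 ≤ j) ∨ (2 ≤ i ∧ j < 2) := by revert i j; decide
  rcases hc with ⟨rfl, rfl⟩ | ⟨hi, hj⟩ | hc
  · exact Submodule.mem_sup_left (LieSubmodule.mem_sup_left
      (lie_gen_mem_bracketIdeal (by simp) (by simp)))
  · exact Submodule.mem_sup_left (LieSubmodule.mem_sup_right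
      (lie_gen_mem_bracketIdeal (m2 i hi) (m2 j hj)))
  · exact Submodule.mem_sup_right (Submodule.subset_span ⟨(i, j), by simpa using hc, rfl⟩)

theorem table_two_three_c (hL : IsTwoStepOfType L 5 m) (hm : m = 3) (u : Fin 5 → L)
    (hu : Generates u) (h₁ : ∀ i j : Fin 5, i < 2 → ⁅u i, u j⁆ = 0) :
    ∃ I : LieIdeal ℝ (FreeNilpotent 5 2), AnosovTable 5 m I ∧
        Nonempty (L ≃ₗ⁅ℝ⁆ (FreeNilpotent 5 2 ⧸ I)) := by
  subst hm
  have m0 : ∀ i ∈ ({0, 1} : Set (Fin 5)), i < 2 := by rintro i (rfl | rfl) <;> decide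
  have m2 : ∀ i : Fin 5, 2 ≤ i → i ∈ ({2, 3, 4} : Set (Fin 5)) := by decide
  have m3 : ∀ i : Fin 5, i < 2 → i ∈ ({0, 1} : Set (Fin 5)) := by decide
  refine ⟨_, AnosovTable.two_three_c, nonempty_equiv_quotient hL u hu _
    (fun x hx => LieHom.mem_ker.1 (sup_le (lift_eq_zero_of_mem_bracketIdeal hL.lcs_two u _ _
      (fun i hi j hj => h₁ i j (m0 i hi))) (lift_eq_zero_of_mem_bracketIdeal hL.lcs_two
        u _ _ (fun i hi j hj => h₁ i j (m0 i hi))) hx))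
    (Finset.univ.filter fun p => p.2 < p.1 ∧ 2 ≤ p.2) (by decide) ?_⟩
  intro i j hij
  have hc : (i = 1 ∧ j = 0) ∨ (2 ≤ i ∧ j < 2) ∨ (j < i ∧ 2 ≤ j) := by revert i j; decide
  rcases hc with ⟨rfl, rfl⟩ | ⟨hi, hj⟩ | hc
  · exact Submodule.mem_sup_left (LieSubmodule.mem_sup_left
      (lie_gen_mem_bracketIdeal (by simp) (by simp)))
  · exact Submodule.mem_sup_left (LieSubmodule.mem_sup_right
      (lie_gen_mem_bracketIdeal' (m2 i hi) (m3 j hj)))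
  · exact Submodule.mem_sup_right (Submodule.subset_span ⟨(i, j), by simpa using hc, rfl⟩)

theorem table_dihedral (hL : IsTwoStepOfType L 5 m) (hm : m = 5) (u : Fin 5 → L)
    (hu : Generates u) (h₁ : ⁅u 0, u 1⁆ = 0) (h₂ : ⁅u 0, u 2⁆ = 0) (h₃ : ⁅u 3, u 4⁆ = 0)
    (h₄ : ⁅u 1, u 3⁆ - ⁅u 2, u 4⁆ = 0) (h₅ : ⁅u 1, u 4⁆ + ⁅u 2, u 3⁆ = 0) :
    ∃ I : LieIdeal ℝ (FreeNilpotent 5 2), AnosovTable 5 m I ∧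
        Nonempty (L ≃ₗ⁅ℝ⁆ (FreeNilpotent 5 2 ⧸ I)) := by
  subst hm
  have hI : dihedralIdeal ≤ (lift hL.lcs_two u).ker := by
    refine LieSubmodule.lieSpan_le.2 ?_
    rintro _ (rfl | rfl | rfl | rfl | rfl) <;>
      simp only [SetLike.mem_coe, LieHom.mem_ker, map_sub, map_add, LieHom.map_lie, lift_gen,
        h₁, h₂, h₃, h₄, h₅]
  have hmem : ∀ x ∈ ({⁅gen 5 2 0, gen 5 2 1⁆, ⁅gen 5 2 0, gen 5 2 2⁆, ⁅gen 5 2 3, gen 5 2 4⁆,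
      ⁅gen 5 2 1, gen 5 2 3⁆ - ⁅gen 5 2 2, gen 5 2 4⁆,
      ⁅gen 5 2 1, gen 5 2 4⁆ + ⁅gen 5 2 2, gen 5 2 3⁆} : Set (FreeNilpotent 5 2)),
      x ∈ dihedralIdeal.toSubmodule := fun x hx => LieSubmodule.subset_lieSpan hx
  have hsk : ∀ i j : Fin 5, ⁅gen 5 2 i, gen 5 2 j⁆ = -⁅gen 5 2 j, gen 5 2 i⁆ :=
    fun i j => (lie_skew _ _).symm
  refine ⟨_, AnosovTable.dihedral, nonempty_equiv_quotient hL u hu _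
    (fun x hx => LieHom.mem_ker.1 (hI hx))
    {(3, 0), (4, 0), (2, 1), (3, 1), (4, 1)} (by decide) ?_⟩
  intro i j hij
  set T : Finset (Fin 5 × Fin 5) := {(3, 0), (4, 0), (2, 1), (3, 1), (4, 1)} with hT
  have hTm : ∀ i j, (i, j) ∈ T → ⁅gen 5 2 i, gen 5 2 j⁆ ∈ dihedralIdeal.toSubmodule ⊔
      Submodule.span ℝ ((fun p : Fin 5 × Fin 5 => ⁅gen 5 2 p.1, gen 5 2 p.2⁆) '' T) :=
    fun i j h => Submodule.mem_sup_right (Submodule.subset_span ⟨(i, j), by exact_mod_cast h, rfl⟩)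
  have hc : (i = 1 ∧ j = 0) ∨ (i = 2 ∧ j = 0) ∨ (i = 4 ∧ j = 3) ∨ (i = 4 ∧ j = 2) ∨
      (i = 3 ∧ j = 2) ∨ (i, j) ∈ T := by
    revert i j; decide
  rcases hc with ⟨rfl, rfl⟩ | ⟨rfl, rfl⟩ | ⟨rfl, rfl⟩ | ⟨rfl, rfl⟩ | ⟨rfl, rfl⟩ | hc
  · rw [hsk]
    exact Submodule.mem_sup_left (neg_mem (hmem _ (by simp)))
  · rw [hsk]
    exact Submodule.mem_sup_left (neg_mem (hmem _ (by simp)))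
  · rw [hsk]
    exact Submodule.mem_sup_left (neg_mem (hmem _ (by simp)))
  · have e : ⁅gen 5 2 4, gen 5 2 2⁆ = (⁅gen 5 2 1, gen 5 2 3⁆ - ⁅gen 5 2 2, gen 5 2 4⁆) +
        ⁅gen 5 2 3, gen 5 2 1⁆ := by
      rw [hsk 3 1, hsk 4 2]; abel
    rw [e]
    exact add_mem (Submodule.mem_sup_left (hmem _ (by simp))) (hTm _ _ (by decide))
  · have e : ⁅gen 5 2 3, gen 5 2 2⁆ = -(⁅gen 5 2 1, gen 5 2 4⁆ + ⁅gen 5 2 2, gen 5 2 3⁆) -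
        ⁅gen 5 2 4, gen 5 2 1⁆ := by
      rw [hsk 4 1, hsk 3 2]; abel
    rw [e]
    exact sub_mem (neg_mem (Submodule.mem_sup_left (hmem _ (by simp)))) (hTm _ _ (by decide))
  · exact hTm _ _ hc

end Rows

/-! ### Linear algebra of an Anosov automorphism -/

/-- The linear algebra data of an Anosov automorphism `φ` of a two-step nilpotent Lie algebra `L`
of type `(n, m)`: the matrices `A` and `D` of `φ` on `L / [L, L]` and on `[L, L]`, the structure
constants `c` of the alternating bracket map `L / [L, L] × L / [L, L] → [L, L]`, and the integral
characteristic polynomials `p` of `A` and `q` of `D`. -/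
structure AnosovModel (n m : ℕ) where
  A : Matrix (Fin n) (Fin n) ℝ
  D : Matrix (Fin m) (Fin m) ℝ
  c : Fin n → Fin n → Fin m → ℝ
  p : ℤ[X]
  q : ℤ[X]
  charpoly_A : A.charpoly = p.map (Int.castRingHom ℝ)
  charpoly_D : D.charpoly = q.map (Int.castRingHom ℝ)
  skew : ∀ i j, c i j = -c j i
  equivariant : ∀ i j, D.mulVec (c i j) = ∑ k, ∑ l, (A k i * A l j) • c k l
  span_c : Submodule.span ℝ (Set.range fun x : Fin n × Fin n => c x.1 x.2) = ⊤
  pos : 0 < m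
  unit_p : IsUnit (p.coeff 0)
  unit_q : IsUnit (q.coeff 0)
  norm_p : ∀ z : ℂ, aeval z p = 0 → ‖z‖ ≠ 1
  norm_q : ∀ z : ℂ, aeval z q = 0 → ‖z‖ ≠ 1

/-- Real vectors as complex vectors. -/
noncomputable def ofRealVec (n : ℕ) : (Fin n → ℝ) →ₗ[ℝ] (Fin n → ℂ) where
  toFun v i := (v i : ℂ)
  map_add' v w := by ext i; simp
  map_smul' r v := by ext i; simp

@[simp] theorem ofRealVec_apply {n : ℕ} (v : Fin n → ℝ) (i : Fin n) :
    ofRealVec n v i = (v i : ℂ) := rfl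

section RealStructure

variable {n : ℕ}

theorem linearIndependent_ofRealVec {ι : Type*} [Fintype ι] {v : ι → Fin n → ℝ}
    (hv : LinearIndependent ℝ v) : LinearIndependent ℂ fun i => ofRealVec n (v i) := by
  rw [Fintype.linearIndependent_iff] at hv ⊢
  intro g hg i
  have hre := hv (fun i => (g i).re) (by
    ext k
    have := congrArg Complex.re (congrFun hg k)
    simpa [Finset.sum_apply] using this) i
  have him := hv (fun i => (g i).im) (by
    ext k
    have := congrArg Complex.im (congrFun hg k)
    simpa [Finset.sum_apply] using this) i
  exact Complex.ext hre him

theorem exists_spanning_family {V : Type*} [AddCommGroup V] [Module ℝ V] (E : Submodule ℝ V)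
    [FiniteDimensional ℝ E] {t : ℕ} (h : Module.finrank ℝ E ≤ t) :
    ∃ u : Fin t → V, (∀ i, u i ∈ E) ∧ Submodule.span ℝ (Set.range u) = E := by
  let b := Module.finBasis ℝ E
  have hmem : ∀ i : Fin t,
      (if h : i.val < Module.finrank ℝ E then (b ⟨i, h⟩ : V) else 0) ∈ E := by
    intro i
    split_ifs
    · exact Subtype.mem _
    · exact zero_mem _
  refine ⟨fun i => if h : i.val < Module.finrank ℝ E then (b ⟨i, h⟩ : V) else 0, hmem,
    le_antisymm (Submodule.span_le.2 ?_) ?_⟩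
  · rintro _ ⟨i, rfl⟩
    exact hmem i
  · have h1 : E = Submodule.span ℝ (Set.range fun i => (b i : V)) := by
      have := congrArg (Submodule.map E.subtype) b.span_eq
      rw [Submodule.map_span, Submodule.map_top, Submodule.range_subtype, ← Set.range_comp] at this
      exact this.symm
    conv_lhs => rw [h1]
    refine Submodule.span_mono ?_
    rintro _ ⟨i, rfl⟩
    exact ⟨⟨i, i.2.trans_le h⟩, by simp⟩

/-- The real vectors in a complex subspace. -/
noncomputable def realPart (U : Submodule ℂ (Fin n → ℂ)) : Submodule ℝ (Fin n → ℝ) :=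
  (U.restrictScalars ℝ).comap (ofRealVec n)

theorem finrank_realPart_le (U : Submodule ℂ (Fin n → ℂ)) :
    Module.finrank ℝ (realPart U) ≤ Module.finrank ℂ U := by
  let b := Module.finBasis ℝ (realPart U)
  have h1 : LinearIndependent ℝ fun i => (b i : Fin n → ℝ) :=
    b.linearIndependent.map' (realPart U).subtype (Submodule.ker_subtype _)
  have h2 : LinearIndependent ℂ fun i =>
      (⟨ofRealVec n (b i), (b i).2⟩ : U) :=
    LinearIndependent.of_comp U.subtype (linearIndependent_ofRealVec h1)
  simpa using h2.fintype_card_le_finrank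

theorem ofRealVec_re (z : Fin n → ℂ) :
    ofRealVec n (fun i => (z i).re) = (1 / 2 : ℂ) • (z + star z) := by
  ext i
  simp [Complex.re_eq_add_conj]
  ring

theorem ofRealVec_im (z : Fin n → ℂ) :
    ofRealVec n (fun i => (z i).im) = (1 / (2 * Complex.I) : ℂ) • (z - star z) := by
  ext i
  simp [Complex.im_eq_sub_conj]
  field_simp
  rw [Complex.I_sq]
  ring

theorem span_ofRealVec_eq_top {ι : Type*} {v : ι → Fin n → ℝ}
    (hv : Submodule.span ℝ (Set.range v) = ⊤) :
    Submodule.span ℂ (Set.range fun i => ofRealVec n (v i)) = ⊤ := by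
  have key : ∀ w : Fin n → ℝ,
      ofRealVec n w ∈ Submodule.span ℂ (Set.range fun i => ofRealVec n (v i)) := by
    intro w
    have hw : w ∈ Submodule.span ℝ (Set.range v) := hv ▸ Submodule.mem_top
    induction hw using Submodule.span_induction with
    | zero => simp
    | add a b _ _ ha hb => rw [map_add]; exact add_mem ha hb
    | smul r a _ ha =>
      rw [map_smul, ← Complex.coe_smul]
      exact Submodule.smul_mem _ _ ha
    | mem a ha =>
      obtain ⟨i, rfl⟩ := ha
      exact Submodule.subset_span ⟨i, rfl⟩
  rw [eq_top_iff]
  intro w _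
  have : w = ofRealVec n (fun i => (w i).re) + Complex.I • ofRealVec n (fun i => (w i).im) := by
    ext i
    simp [mul_comm Complex.I, Complex.re_add_im]
  rw [this]
  exact add_mem (key _) (Submodule.smul_mem _ _ (key _))

/-- Complementary complex subspaces stable under conjugation have real bases. -/
theorem exists_real_blocks (U U' : Submodule ℂ (Fin n → ℂ)) (hU : ∀ z ∈ U, star z ∈ U)
    (hU' : ∀ z ∈ U', star z ∈ U') (htop : U ⊔ U' = ⊤) {t t' : ℕ}
    (ht : Module.finrank ℂ U ≤ t) (ht' : Module.finrank ℂ U' ≤ t') :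
    ∃ (u : Fin t → Fin n → ℝ) (u' : Fin t' → Fin n → ℝ),
      (∀ i, ofRealVec n (u i) ∈ U) ∧ (∀ i, ofRealVec n (u' i) ∈ U') ∧
      Submodule.span ℝ (Set.range u) ⊔ Submodule.span ℝ (Set.range u') = ⊤ := by
  obtain ⟨u, hu, hus⟩ := exists_spanning_family (realPart U) ((finrank_realPart_le U).trans ht)
  obtain ⟨u', hu', hus'⟩ :=
    exists_spanning_family (realPart U') ((finrank_realPart_le U').trans ht')
  refine ⟨u, u', hu, hu', ?_⟩
  rw [hus, hus', eq_top_iff]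
  intro v _
  obtain ⟨x, hx, y, hy, hxy⟩ := Submodule.mem_sup.1 (htop ▸ Submodule.mem_top : ofRealVec n v ∈ _)
  refine Submodule.mem_sup.2 ⟨fun i => (x i).re, ?_, fun i => (y i).re, ?_, ?_⟩
  · change ofRealVec n _ ∈ U
    rw [ofRealVec_re]
    exact U.smul_mem _ (add_mem hx (hU x hx))
  · change ofRealVec n _ ∈ U'
    rw [ofRealVec_re]
    exact U'.smul_mem _ (add_mem hy (hU' y hy))
  · ext i
    have := congrArg Complex.re (congrFun hxy i)
    simpa using this

end RealStructure

namespace AnosovModel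

variable {n m : ℕ} (M : AnosovModel n m)

theorem p_monic : M.p.Monic := by
  have := Matrix.charpoly_monic M.A
  rw [M.charpoly_A] at this
  exact (Function.Injective.monic_map_iff (Int.castRingHom ℝ).injective_int).2 this

theorem q_monic : M.q.Monic := by
  have := Matrix.charpoly_monic M.D
  rw [M.charpoly_D] at this
  exact (Function.Injective.monic_map_iff (Int.castRingHom ℝ).injective_int).2 this

theorem natDegree_p : M.p.natDegree = n := by
  have := Matrix.charpoly_natDegree_eq_dim M.A
  rwa [M.charpoly_A, natDegree_map_eq_of_injective (Int.castRingHom ℝ).injective_int,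
    Fintype.card_fin] at this

theorem natDegree_q : M.q.natDegree = m := by
  have := Matrix.charpoly_natDegree_eq_dim M.D
  rwa [M.charpoly_D, natDegree_map_eq_of_injective (Int.castRingHom ℝ).injective_int,
    Fintype.card_fin] at this

/-- The complexification of the bracket map. -/
noncomputable def bil : (Fin n → ℂ) →ₗ[ℂ] (Fin n → ℂ) →ₗ[ℂ] (Fin m → ℂ) :=
  LinearMap.mk₂ ℂ (fun z w k => ∑ i, ∑ j, z i * w j * (M.c i j k : ℂ))
    (fun z z' w => by ext k; simp [add_mul, Finset.sum_add_distrib])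
    (fun r z w => by ext k; simp [Finset.mul_sum, mul_assoc])
    (fun z w w' => by ext k; simp [add_mul, mul_add, Finset.sum_add_distrib])
    (fun r z w => by
      ext k
      simp only [Pi.smul_apply, smul_eq_mul, Finset.mul_sum]
      refine Finset.sum_congr rfl fun i _ => Finset.sum_congr rfl fun j _ => ?_
      ring)

theorem bil_apply (z w : Fin n → ℂ) (k : Fin m) :
    M.bil z w k = ∑ i, ∑ j, z i * w j * (M.c i j k : ℂ) := rfl

theorem bil_skew (z w : Fin n → ℂ) : M.bil z w = -M.bil w z := by
  ext k
  rw [Pi.neg_apply, bil_apply, bil_apply, Finset.sum_comm, ← Finset.sum_neg_distrib]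
  refine Finset.sum_congr rfl fun i _ => ?_
  rw [← Finset.sum_neg_distrib]
  refine Finset.sum_congr rfl fun j _ => ?_
  rw [M.skew j i, Pi.neg_apply, Complex.ofReal_neg]
  ring

theorem bil_self (z : Fin n → ℂ) : M.bil z z = 0 := by
  have h := M.bil_skew z z
  ext k
  have := congrFun h k
  simp only [Pi.neg_apply] at this
  simpa using self_eq_neg.1 this

/-- The complexification of `A`. -/
noncomputable def AC : Matrix (Fin n) (Fin n) ℂ := M.A.map Complex.ofRealHom

/-- The complexification of `D`. -/
noncomputable def DC : Matrix (Fin m) (Fin m) ℂ := M.D.map Complex.ofRealHom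

theorem charpoly_AC : M.AC.charpoly = M.p.map (Int.castRingHom ℂ) := by
  rw [AC, Matrix.charpoly_map, M.charpoly_A, Polynomial.map_map]
  congr 1

theorem charpoly_DC : M.DC.charpoly = M.q.map (Int.castRingHom ℂ) := by
  rw [DC, Matrix.charpoly_map, M.charpoly_D, Polynomial.map_map]
  congr 1

theorem AC_mulVec_star (z : Fin n → ℂ) : M.AC.mulVec (star z) = star (M.AC.mulVec z) := by
  ext k
  simp [Matrix.mulVec, dotProduct, AC]

theorem bil_mulVec (z w : Fin n → ℂ) :
    M.bil (M.AC.mulVec z) (M.AC.mulVec w) = M.DC.mulVec (M.bil z w) := by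
  have h : M.bil.compl₁₂ M.AC.mulVecLin M.AC.mulVecLin = M.bil.compr₂ M.DC.mulVecLin := by
    refine (Pi.basisFun ℂ (Fin n)).ext fun i => (Pi.basisFun ℂ (Fin n)).ext fun j => ?_
    have hs : M.bil (Pi.single i 1) (Pi.single j 1) = ofRealVec m (M.c i j) := by
      ext k
      simp [bil_apply, Pi.single_apply]
    ext k
    have := congrFun (M.equivariant i j) k
    simp only [Matrix.mulVec, dotProduct, Finset.sum_apply, Pi.smul_apply, smul_eq_mul] at this
    simp only [LinearMap.compl₁₂_apply, LinearMap.compr₂_apply, Pi.basisFun_apply, hs,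
      Matrix.mulVecLin_apply, Matrix.mulVec_single_one, bil_apply]
    simp only [Matrix.mulVec, dotProduct, AC, DC, Matrix.col_apply, Matrix.map_apply,
      Complex.ofRealHom_eq_coe, ofRealVec_apply]
    exact_mod_cast this.symm
  exact congrFun (congrArg DFunLike.coe (congrFun (congrArg DFunLike.coe h) z)) w

/-- An eigenvalue of `D` is a root of `q`. -/
theorem aeval_q_eq_zero {v : Fin m → ℂ} (hv : v ≠ 0) {l : ℂ} (h : M.DC.mulVec v = l • v) :
    aeval l M.q = 0 := by
  have h1 : (Matrix.scalar (Fin m) l - M.DC).det = 0 := by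
    refine Matrix.exists_mulVec_eq_zero_iff.1 ⟨v, hv, ?_⟩
    rw [Matrix.sub_mulVec, h]
    ext i
    simp
  rw [← Matrix.eval_charpoly, charpoly_DC, eval_map] at h1
  simpa [aeval_def] using h1

theorem exists_eigenvector {a : ℂ} (ha : aeval a M.p = 0) :
    ∃ z : Fin n → ℂ, z ≠ 0 ∧ M.AC.mulVec z = a • z := by
  have h1 : (Matrix.scalar (Fin n) a - M.AC).det = 0 := by
    rw [← Matrix.eval_charpoly, charpoly_AC, eval_map]
    simpa [aeval_def] using ha
  obtain ⟨v, hv, h⟩ := Matrix.exists_mulVec_eq_zero_iff.2 h1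
  refine ⟨v, hv, ?_⟩
  rw [Matrix.sub_mulVec, sub_eq_zero] at h
  rw [← h]
  ext i
  simp [Matrix.mulVec_diagonal]

theorem aeval_q_of_bil_ne_zero {z w : Fin n → ℂ} {a b : ℂ} (hz : M.AC.mulVec z = a • z)
    (hw : M.AC.mulVec w = b • w) (h : M.bil z w ≠ 0) : aeval (a * b) M.q = 0 := by
  refine M.aeval_q_eq_zero h ?_
  rw [← bil_mulVec, hz, hw, map_smul, map_smul, LinearMap.smul_apply, smul_smul, mul_comm b a]

theorem span_bil {ι : Type*} (z : ι → Fin n → ℂ) (hz : Submodule.span ℂ (Set.range z) = ⊤) :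
    Submodule.span ℂ (Set.range fun x : ι × ι => M.bil (z x.1) (z x.2)) = ⊤ := by
  have key : ∀ x y, M.bil x y ∈
      Submodule.span ℂ (Set.range fun x : ι × ι => M.bil (z x.1) (z x.2)) := by
    intro x y
    have h1 := Submodule.apply_mem_map₂ M.bil (hz ▸ Submodule.mem_top : x ∈ _)
      (hz ▸ Submodule.mem_top : y ∈ _)
    rw [Submodule.map₂_span_span] at h1
    refine Submodule.span_mono ?_ h1
    rintro _ ⟨_, ⟨i, rfl⟩, _, ⟨j, rfl⟩, rfl⟩
    exact ⟨(i, j), rfl⟩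
  rw [eq_top_iff, ← span_ofRealVec_eq_top M.span_c, Submodule.span_le]
  rintro _ ⟨⟨i, j⟩, rfl⟩
  have : ofRealVec m (M.c i j) = M.bil (Pi.single i 1) (Pi.single j 1) := by
    ext k
    simp [bil_apply, Pi.single_apply]
  simp only [this]
  exact key _ _

theorem bil_eq_zero_of_mem_span {s t : Set (Fin n → ℂ)} (h : ∀ z ∈ s, ∀ w ∈ t, M.bil z w = 0)
    {x y : Fin n → ℂ} (hx : x ∈ Submodule.span ℂ s) (hy : y ∈ Submodule.span ℂ t) :
    M.bil x y = 0 := by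
  have h1 := Submodule.apply_mem_map₂ M.bil hx hy
  rw [Submodule.map₂_span_span] at h1
  have h2 : Submodule.span ℂ (Set.image2 (fun m n => M.bil m n) s t) = ⊥ := by
    rw [Submodule.span_eq_bot]
    rintro _ ⟨z, hz, w, hw, rfl⟩
    exact h z hz w hw
  rw [h2] at h1
  exact h1

end AnosovModel

/-! ### The graph on the eigenvalues -/

/-- If the constant term of an integral monic polynomial is a unit, then the logarithms of the
absolute values of its roots add up to zero. -/
theorem sum_log_norm_roots_eq_zero {ι : Type*} {f : ℤ[X]} (hf : f.Monic)
    (h0 : IsUnit (f.coeff 0)) (a : ι → ℂ) (ha : Function.Injective a) (B : Finset ι)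
    (hroot : ∀ i ∈ B, aeval (a i) f = 0) (hcard : B.card = f.natDegree) :
    ∑ i ∈ B, Real.log ‖a i‖ = 0 := by
  classical
  have hmap : (f.map (Int.castRingHom ℂ)).Monic := hf.map _
  have hle : B.val.map a ≤ (f.map (Int.castRingHom ℂ)).roots := by
    rw [Multiset.le_iff_subset (Multiset.Nodup.map ha B.nodup)]
    intro x hx
    obtain ⟨i, hi, rfl⟩ := Multiset.mem_map.1 hx
    rw [mem_roots hmap.ne_zero, IsRoot, eval_map]
    simpa [aeval_def] using hroot i hi
  have heq : B.val.map a = (f.map (Int.castRingHom ℂ)).roots := by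
    refine Multiset.eq_of_le_of_card_le hle ?_
    rw [Multiset.card_map, ← Finset.card_def, hcard, ← hf.natDegree_map (Int.castRingHom ℂ)]
    exact card_roots' _
  have hprod : ∏ i ∈ B, ‖a i‖ = 1 := by
    have h1 := (IsAlgClosed.splits (f.map (Int.castRingHom ℂ))).coeff_zero_eq_prod_roots_of_monic
      hmap
    rw [← heq, coeff_map] at h1
    have h2 := congrArg norm h1
    have h3 : ‖((Int.castRingHom ℂ) (f.coeff 0))‖ = 1 := by
      rcases Int.isUnit_iff.1 h0 with h | h <;> simp [h]
    rw [h3, norm_mul, norm_pow, norm_neg, norm_one, one_pow, one_mul] at h2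
    rw [h2, ← Finset.prod, norm_prod]
  have hne : ∀ i ∈ B, ‖a i‖ ≠ 0 := by
    intro i hi h
    rw [Finset.prod_eq_zero hi h] at hprod
    exact zero_ne_one hprod
  rw [← Real.log_prod hne, hprod, Real.log_one]

theorem aeval_apply_eq_zero {F F' : Type*} [Field F] [Field F'] (σ : F →+* F') {a : F} {f : ℤ[X]}
    (h : aeval a f = 0) : aeval (σ a) f = 0 := by
  have h1 := congrArg σ h
  rw [aeval_def, hom_eval₂, map_zero] at h1
  rw [aeval_def, ← h1]
  congr 1
  exact Subsingleton.elim _ _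

/-- `natDegree g` distinct roots of `g` are all the roots of `g`. -/
theorem exists_mem_eq_of_aeval_eq_zero {ι F : Type*} [Field F] {g : ℤ[X]} (hg : g.Monic)
    {a : ι → F} (ha : Function.Injective a) {B : Finset ι} (hB : ∀ i ∈ B, aeval (a i) g = 0)
    (hcard : B.card = g.natDegree) {b : F} (hb : aeval b g = 0) : ∃ i ∈ B, a i = b := by
  classical
  by_contra! h
  have hmap : (g.map (algebraMap ℤ F)).Monic := hg.map _
  have hsub : insert b (B.image a) ⊆ (g.map (algebraMap ℤ F)).roots.toFinset := by
    intro x hx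
    rw [Multiset.mem_toFinset, mem_roots hmap.ne_zero, IsRoot, eval_map, ← aeval_def]
    rcases Finset.mem_insert.1 hx with rfl | hx
    · exact hb
    · obtain ⟨i, hi, rfl⟩ := Finset.mem_image.1 hx
      exact hB i hi
  have h1 := (Finset.card_le_card hsub).trans ((Multiset.toFinset_card_le _).trans (card_roots' _))
  rw [Finset.card_insert_of_notMem (by simpa using h), Finset.card_image_of_injective _ ha,
    hg.natDegree_map, hcard] at h1
  omega

namespace AnosovModel

variable {n m : ℕ} (M : AnosovModel n m)

/-- A labelling of the roots of `p`, supposed to be distinct, in a field embedded in `ℂ`. -/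
structure Roots (K : Type*) [Field K] where
  emb : K →+* ℂ
  root : Fin n → K
  injective : Function.Injective root
  aeval_root : ∀ i, aeval (root i) M.p = 0

namespace Roots

variable {M} {K : Type*} [Field K] (R : M.Roots K)

/-- The roots of `p` as complex numbers. -/
def eig (i : Fin n) : ℂ := R.emb (R.root i)

/-- The logarithms of the absolute values of the roots of `p`. -/
noncomputable def lg (i : Fin n) : ℝ := Real.log ‖R.eig i‖

/-- The graph of pairs of eigenvalues of `A` whose product is an eigenvalue of `D`. -/
def Adj (i j : Fin n) : Prop := aeval (R.eig i * R.eig j) M.q = 0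

/-- The permutations of the roots that are induced by field automorphisms. -/
def IsSymm (g : Fin n → Fin n) : Prop := ∃ σ : K ≃+* K, ∀ i, σ (R.root i) = R.root (g i)

theorem aeval_eig (i : Fin n) : aeval (R.eig i) M.p = 0 :=
  aeval_apply_eq_zero R.emb (R.aeval_root i)

theorem eig_injective : Function.Injective R.eig := R.emb.injective.comp R.injective

theorem eig_ne_zero (i : Fin n) : R.eig i ≠ 0 := by
  intro h
  have h1 := R.aeval_eig i
  rw [h, aeval_def, eval₂_at_zero] at h1
  have h2 := M.unit_p.ne_zero
  simp [h2] at h1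

theorem lg_ne_zero (i : Fin n) : R.lg i ≠ 0 := by
  have h1 : 0 < ‖R.eig i‖ := norm_pos_iff.2 (R.eig_ne_zero i)
  exact Real.log_ne_zero_of_pos_of_ne_one h1 (M.norm_p _ (R.aeval_eig i))

theorem lg_add (i j : Fin n) : R.lg i + R.lg j = Real.log ‖R.eig i * R.eig j‖ := by
  rw [norm_mul, Real.log_mul (norm_ne_zero_iff.2 (R.eig_ne_zero i))
    (norm_ne_zero_iff.2 (R.eig_ne_zero j)), lg, lg]

theorem lg_add_ne_zero {i j : Fin n} (h : R.Adj i j) : R.lg i + R.lg j ≠ 0 := by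
  rw [lg_add]
  have h1 : 0 < ‖R.eig i * R.eig j‖ :=
    norm_pos_iff.2 (mul_ne_zero (R.eig_ne_zero i) (R.eig_ne_zero j))
  exact Real.log_ne_zero_of_pos_of_ne_one h1 (M.norm_q _ h)

theorem adj_symm {i j : Fin n} (h : R.Adj i j) : R.Adj j i := by
  rw [Adj, mul_comm]; exact h

theorem adj_comm {i j : Fin n} : R.Adj i j ↔ R.Adj j i := ⟨R.adj_symm, R.adj_symm⟩

theorem sum_lg : ∑ i, R.lg i = 0 :=
  sum_log_norm_roots_eq_zero M.p_monic M.unit_p _ R.eig_injective _ (fun i _ => R.aeval_eig i)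
    (by simp [M.natDegree_p])

theorem sum_lg_factor {f : ℤ[X]} (hf : f.Monic) (h0 : IsUnit (f.coeff 0)) (B : Finset (Fin n))
    (hB : ∀ i ∈ B, aeval (R.root i) f = 0) (hcard : B.card = f.natDegree) :
    ∑ i ∈ B, R.lg i = 0 := by
  exact sum_log_norm_roots_eq_zero hf h0 _ R.eig_injective _
    (fun i hi => aeval_apply_eq_zero R.emb (hB i hi)) hcard

theorem exists_isSymm (σ : K ≃+* K) : ∃ g, R.IsSymm g ∧ ∀ i, σ (R.root i) = R.root (g i) := by
  have h : ∀ i, ∃ j ∈ Finset.univ, R.root j = σ (R.root i) := fun i =>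
    exists_mem_eq_of_aeval_eq_zero M.p_monic R.injective (fun i _ => R.aeval_root i)
      (by simp [M.natDegree_p]) (aeval_apply_eq_zero σ.toRingHom (R.aeval_root i))
  choose g _ hg using h
  exact ⟨g, ⟨σ, fun i => (hg i).symm⟩, fun i => (hg i).symm⟩

theorem isSymm_injective {g : Fin n → Fin n} (hg : R.IsSymm g) : Function.Injective g := by
  obtain ⟨σ, hσ⟩ := hg
  intro i j hij
  apply R.injective
  apply σ.injective
  rw [hσ, hσ, hij]

theorem adj_iff {i j : Fin n} : R.Adj i j ↔ aeval (R.root i * R.root j) M.q = 0 := by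
  rw [Adj, eig, eig, ← map_mul, ← map_eq_zero R.emb, aeval_def, aeval_def, hom_eval₂]
  have : R.emb.comp (algebraMap ℤ K) = algebraMap ℤ ℂ := Subsingleton.elim _ _
  rw [this]

theorem isSymm_adj {g : Fin n → Fin n} (hg : R.IsSymm g) {i j : Fin n} :
    R.Adj (g i) (g j) ↔ R.Adj i j := by
  obtain ⟨σ, hσ⟩ := hg
  rw [adj_iff, adj_iff, ← hσ, ← hσ, ← map_mul]
  have : aeval (σ (R.root i * R.root j)) M.q = σ (aeval (R.root i * R.root j) M.q) := by
    rw [aeval_def, aeval_def, ← RingEquiv.coe_toRingHom, hom_eval₂]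
    congr 1
    exact Subsingleton.elim _ _
  rw [this, map_eq_zero]

theorem isSymm_lg {g : Fin n → Fin n} (hg : R.IsSymm g) {i j k l : Fin n}
    (h : R.eig i * R.eig j = R.eig k * R.eig l) :
    R.lg (g i) + R.lg (g j) = R.lg (g k) + R.lg (g l) := by
  obtain ⟨σ, hσ⟩ := hg
  have h1 : R.root i * R.root j = R.root k * R.root l := by
    apply R.emb.injective
    simpa [eig] using h
  have h2 := congrArg σ h1
  rw [map_mul, map_mul, hσ, hσ, hσ, hσ] at h2
  rw [lg_add, lg_add]
  simp only [eig, ← map_mul, h2]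

/-- The permutation of the roots given by complex conjugation. -/
theorem exists_conj : ∃ τ : Fin n → Fin n, ∀ i, R.eig (τ i) = star (R.eig i) := by
  have h : ∀ i, ∃ j ∈ Finset.univ, R.eig j = star (R.eig i) := fun i =>
    exists_mem_eq_of_aeval_eq_zero M.p_monic R.eig_injective (fun i _ => R.aeval_eig i)
      (by simp [M.natDegree_p]) (aeval_apply_eq_zero (starRingEnd ℂ) (R.aeval_eig i))
  choose τ _ hτ using h
  exact ⟨τ, hτ⟩

theorem conj_conj {τ : Fin n → Fin n} (hτ : ∀ i, R.eig (τ i) = star (R.eig i)) (i : Fin n) :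
    τ (τ i) = i := by
  apply R.eig_injective
  rw [hτ, hτ, star_star]

theorem lg_conj {τ : Fin n → Fin n} (hτ : ∀ i, R.eig (τ i) = star (R.eig i)) (i : Fin n) :
    R.lg (τ i) = R.lg i := by
  rw [lg, hτ, norm_star, lg]

theorem adj_conj {τ : Fin n → Fin n} (hτ : ∀ i, R.eig (τ i) = star (R.eig i))
    {i j : Fin n} (h : R.Adj i j) : R.Adj (τ i) (τ j) := by
  rw [Adj, hτ, hτ, ← star_mul']
  exact aeval_apply_eq_zero (starRingEnd ℂ) h

/-- A basis of eigenvectors of the complexification of `A`. -/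
structure Eigenbasis where
  vec : Fin n → Fin n → ℂ
  ne_zero : ∀ i, vec i ≠ 0
  mulVec : ∀ i, M.AC.mulVec (vec i) = R.eig i • vec i

theorem exists_eigenbasis : Nonempty R.Eigenbasis := by
  choose z hz hz' using fun i => M.exists_eigenvector (R.aeval_eig i)
  exact ⟨⟨z, hz, hz'⟩⟩

namespace Eigenbasis

variable {R} (z : R.Eigenbasis)

theorem linearIndependent : LinearIndependent ℂ z.vec := by
  refine Module.End.eigenvectors_linearIndependent' M.AC.mulVecLin R.eig R.eig_injective z.vec ?_
  intro i
  rw [Module.End.hasEigenvector_iff, Module.End.mem_eigenspace_iff]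
  exact ⟨z.mulVec i, z.ne_zero i⟩

theorem span_eq_top : Submodule.span ℂ (Set.range z.vec) = ⊤ :=
  z.linearIndependent.span_eq_top_of_card_eq_finrank' (by simp)

theorem mem_span_singleton {w : Fin n → ℂ} {i : Fin n}
    (hw : M.AC.mulVec w = R.eig i • w) : w ∈ Submodule.span ℂ {z.vec i} := by
  let b := Module.Basis.mk z.linearIndependent z.span_eq_top.ge
  have hb : ∀ j, b j = z.vec j := fun j => by simp [b]
  have hsum := b.sum_repr w
  have h0 : ∀ j, j ≠ i → b.repr w j = 0 := by
    intro j hj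
    have h1 : ∑ j, (b.repr w j * (R.eig j - R.eig i)) • b j = 0 := by
      have h2 : M.AC.mulVecLin w = ∑ j, (b.repr w j * R.eig j) • b j := by
        conv_lhs => rw [← hsum]
        rw [map_sum]
        refine Finset.sum_congr rfl fun j _ => ?_
        rw [map_smul, Matrix.mulVecLin_apply, hb, z.mulVec, smul_smul]
      have h3 : M.AC.mulVecLin w = ∑ j, (b.repr w j * R.eig i) • b j := by
        rw [Matrix.mulVecLin_apply, hw]
        conv_lhs => rw [← hsum]
        rw [Finset.smul_sum]
        refine Finset.sum_congr rfl fun j _ => ?_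
        rw [smul_smul, mul_comm]
      simp only [mul_sub, sub_smul, Finset.sum_sub_distrib]
      rw [← h2, ← h3, sub_self]
    have h4 := Fintype.linearIndependent_iff.1 b.linearIndependent _ h1 j
    rcases mul_eq_zero.1 h4 with h | h
    · exact h
    · exact absurd (R.eig_injective (sub_eq_zero.1 h)) hj
  rw [Submodule.mem_span_singleton]
  refine ⟨b.repr w i, ?_⟩
  rw [← hb]
  conv_rhs => rw [← hsum]
  rw [Finset.sum_eq_single i]
  · intro j _ hj
    rw [h0 j hj, zero_smul]
  · simp

theorem adj_of_bil_ne_zero {i j : Fin n} (h : M.bil (z.vec i) (z.vec j) ≠ 0) : R.Adj i j :=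
  M.aeval_q_of_bil_ne_zero (z.mulVec i) (z.mulVec j) h

theorem star_mem_span {i j : Fin n} (h : R.eig j = star (R.eig i)) :
    star (z.vec i) ∈ Submodule.span ℂ {z.vec j} := by
  apply z.mem_span_singleton
  rw [M.AC_mulVec_star, z.mulVec, star_smul, h]

end Eigenbasis

/-- If distinct edges of the graph carry distinct eigenvalues, `dim [L, L]` is the number of
edges. -/
theorem card_edges (T : Finset (Fin n × Fin n)) (hlt : ∀ x ∈ T, x.2 < x.1)
    (hT : ∀ i j, j < i → ((i, j) ∈ T ↔ R.Adj i j))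
    (hinj : ∀ i j k l, i ≠ j → k ≠ l → i ≠ k → i ≠ l → j ≠ k → j ≠ l → R.Adj i j →
      R.eig i * R.eig j ≠ R.eig k * R.eig l) : m = T.card := by
  classical
  apply le_antisymm
  · obtain ⟨z⟩ := R.exists_eigenbasis
    have h1 := M.span_bil z.vec z.span_eq_top
    have h2 : Submodule.span ℂ
        ((T.image fun x => M.bil (z.vec x.1) (z.vec x.2) : Finset _) : Set (Fin m → ℂ)) = ⊤ := by
      rw [eq_top_iff, ← h1, Submodule.span_le]
      rintro _ ⟨⟨i, j⟩, rfl⟩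
      have key : ∀ i j, j < i → M.bil (z.vec i) (z.vec j) ∈ Submodule.span ℂ
          ((T.image fun x => M.bil (z.vec x.1) (z.vec x.2) : Finset _) : Set (Fin m → ℂ)) := by
        intro i j hij
        by_cases h0 : M.bil (z.vec i) (z.vec j) = 0
        · rw [h0]; exact zero_mem _
        · apply Submodule.subset_span
          rw [Finset.coe_image]
          exact ⟨(i, j), (hT i j hij).2 (z.adj_of_bil_ne_zero h0), rfl⟩
      rcases lt_trichotomy j i with h | h | h
      · exact key i j h
      · simp only [h, M.bil_self]
        exact zero_mem _
      · simp only [SetLike.mem_coe]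
        rw [M.bil_skew]
        exact neg_mem (key j i h)
    have h3 := finrank_span_finset_le_card (R := ℂ)
      (T.image fun x => M.bil (z.vec x.1) (z.vec x.2))
    rw [Set.finrank, h2, finrank_top, Module.finrank_fin_fun] at h3
    exact h3.trans Finset.card_image_le
  · have hinj' : Set.InjOn (fun x : Fin n × Fin n => R.eig x.1 * R.eig x.2) T := by
      rintro ⟨i, j⟩ hij ⟨k, l⟩ hkl h
      have h1 : j < i := hlt _ hij
      have h2 : l < k := hlt _ hkl
      have h3 := (hT i j h1).1 hij
      simp only at h
      by_cases hik : i = k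
      · subst hik
        rw [R.eig_injective (mul_left_cancel₀ (R.eig_ne_zero i) h)]
      by_cases hjl : j = l
      · subst hjl
        exact absurd (R.eig_injective (mul_right_cancel₀ (R.eig_ne_zero j) h)) hik
      by_cases hil : i = l
      · subst hil
        rw [mul_comm (R.eig k)] at h
        have := R.eig_injective (mul_left_cancel₀ (R.eig_ne_zero i) h)
        subst this
        exact absurd (h1.trans h2) (lt_irrefl _)
      by_cases hjk : j = k
      · subst hjk
        rw [mul_comm] at h
        exact absurd (R.eig_injective (mul_left_cancel₀ (R.eig_ne_zero j) h)) hil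
      exact absurd h (hinj i j k l h1.ne' h2.ne' hik hil hjk hjl h3)
    rw [← Finset.card_image_of_injOn hinj']
    have hsub : T.image (fun x : Fin n × Fin n => R.eig x.1 * R.eig x.2) ⊆
        (M.q.map (Int.castRingHom ℂ)).roots.toFinset := by
      intro y hy
      obtain ⟨⟨i, j⟩, hx, rfl⟩ := Finset.mem_image.1 hy
      rw [Multiset.mem_toFinset, mem_roots (M.q_monic.map _).ne_zero, IsRoot, eval_map]
      have h := (hT i j (hlt _ hx)).1 hx
      rw [Adj, aeval_def] at h
      simpa using h
    calc _ ≤ _ := Finset.card_le_card hsub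
      _ ≤ _ := Multiset.toFinset_card_le _
      _ ≤ _ := card_roots' _
      _ = m := by rw [M.q_monic.natDegree_map, M.natDegree_q]

/-- The graph has an edge, since `[L, L] ≠ 0`. -/
theorem exists_adj : ∃ i j, i ≠ j ∧ R.Adj i j := by
  by_contra! h
  obtain ⟨z⟩ := R.exists_eigenbasis
  have h1 := M.span_bil z.vec z.span_eq_top
  have h2 : Submodule.span ℂ
      (Set.range fun x : Fin n × Fin n => M.bil (z.vec x.1) (z.vec x.2)) = ⊥ := by
    rw [Submodule.span_eq_bot]
    rintro _ ⟨⟨i, j⟩, rfl⟩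
    by_cases hij : i = j
    · subst hij; exact M.bil_self _
    · by_contra h0
      exact h i j hij (z.adj_of_bil_ne_zero h0)
  have h3 := congrArg (fun U : Submodule ℂ (Fin m → ℂ) => Module.finrank ℂ U) (h1.symm.trans h2)
  simp only [finrank_top, finrank_bot, Module.finrank_fin_fun] at h3
  exact M.pos.ne' h3

/-- A set of roots stable under complex conjugation and its complement give complementary real
subspaces. -/
theorem exists_blocks (z : R.Eigenbasis) {τ : Fin n → Fin n}
    (hτ : ∀ i, R.eig (τ i) = star (R.eig i)) (B : Finset (Fin n))
    (hB : ∀ i, i ∈ B → τ i ∈ B) {t t' : ℕ} (ht : B.card = t) (ht' : Bᶜ.card = t') :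
    ∃ (u : Fin t → Fin n → ℝ) (u' : Fin t' → Fin n → ℝ),
      (∀ i, ofRealVec n (u i) ∈ Submodule.span ℂ (z.vec '' B)) ∧
      (∀ i, ofRealVec n (u' i) ∈ Submodule.span ℂ (z.vec '' (Bᶜ : Finset (Fin n)))) ∧
      Submodule.span ℝ (Set.range u) ⊔ Submodule.span ℝ (Set.range u') = ⊤ := by
  classical
  have hB' : ∀ i, i ∈ Bᶜ → τ i ∈ Bᶜ := by
    intro i hi
    rw [Finset.mem_compl] at hi ⊢
    intro h
    exact hi (R.conj_conj hτ i ▸ hB _ h)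
  have hstar : ∀ C : Finset (Fin n), (∀ i, i ∈ C → τ i ∈ C) →
      ∀ w ∈ Submodule.span ℂ (z.vec '' C), star w ∈ Submodule.span ℂ (z.vec '' C) := by
    intro C hC w hw
    induction hw using Submodule.span_induction with
    | zero => simp
    | add a b _ _ ha hb => rw [star_add]; exact add_mem ha hb
    | smul r a _ ha => rw [star_smul]; exact Submodule.smul_mem _ _ ha
    | mem a ha =>
      obtain ⟨i, hi, rfl⟩ := ha
      refine Submodule.span_mono ?_ (z.star_mem_span (hτ i))
      rintro _ rfl
      exact ⟨τ i, hC i hi, rfl⟩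
  have hrank : ∀ C : Finset (Fin n),
      Module.finrank ℂ (Submodule.span ℂ (z.vec '' C)) ≤ C.card := by
    intro C
    rw [← Finset.coe_image]
    exact (finrank_span_finset_le_card _).trans Finset.card_image_le
  refine exists_real_blocks _ _ (hstar B hB) (hstar _ hB') ?_ ((hrank _).trans ht.le)
    ((hrank _).trans ht'.le)
  rw [← Submodule.span_union, ← Set.image_union, Finset.coe_compl, Set.union_compl_self,
    Set.image_univ, z.span_eq_top]

theorem bil_eq_zero_of_mem_blocks (z : R.Eigenbasis) (B C : Finset (Fin n))
    (h : ∀ i ∈ B, ∀ j ∈ C, i ≠ j → ¬R.Adj i j) {x y : Fin n → ℂ}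
    (hx : x ∈ Submodule.span ℂ (z.vec '' B)) (hy : y ∈ Submodule.span ℂ (z.vec '' C)) :
    M.bil x y = 0 := by
  refine M.bil_eq_zero_of_mem_span ?_ hx hy
  rintro _ ⟨i, hi, rfl⟩ _ ⟨j, hj, rfl⟩
  by_cases hij : i = j
  · subst hij; exact M.bil_self _
  · by_contra h0
    exact h i hi j hj hij (z.adj_of_bil_ne_zero h0)

end Roots

end AnosovModel

/-! ### Integral characteristic polynomials on `L / [L, L]` and `[L, L]` -/

section Realization

variable {L : Type*} [LieRing L] [LieAlgebra ℝ L] {n m : ℕ}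

/-- The Lie algebra `L` realizes the linear algebra data `M`: coordinates `E` on a complement of
`[L, L]` and `T` on `[L, L]` in which the bracket is given by the structure constants of `M`. -/
structure Realization (M : AnosovModel n m) (L : Type*) [LieRing L] [LieAlgebra ℝ L] where
  E : (Fin n → ℝ) →ₗ[ℝ] L
  T : (Fin m → ℝ) →ₗ[ℝ] L
  sup_eq_top : LinearMap.range E ⊔ (LieModule.lowerCentralSeries ℝ L L 1).toSubmodule = ⊤
  lie_single : ∀ i j, ⁅E (Pi.single i 1), E (Pi.single j 1)⁆ = T (M.c i j)

namespace Realization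

variable {M : AnosovModel n m} (S : Realization M L)

theorem lie_eq (v w : Fin n → ℝ) :
    ⁅S.E v, S.E w⁆ = S.T fun k => (M.bil (ofRealVec n v) (ofRealVec n w) k).re := by
  have h1 : ∀ v : Fin n → ℝ, S.E v = ∑ i, v i • S.E (Pi.single i 1) := by
    intro v
    conv_lhs => rw [pi_eq_sum_univ' v]
    simp only [map_sum, map_smul]
  rw [h1 v, h1 w, sum_lie]
  simp only [lie_sum, smul_lie, lie_smul, S.lie_single]
  have h2 : (fun k => (M.bil (ofRealVec n v) (ofRealVec n w) k).re) =
      ∑ i, ∑ j, v i • w j • M.c i j := by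
    ext k
    simp only [AnosovModel.bil_apply, ofRealVec_apply, Finset.sum_apply, Pi.smul_apply,
      smul_eq_mul]
    have : (∑ i, ∑ j, (v i : ℂ) * (w j : ℂ) * (M.c i j k : ℂ)) =
        ((∑ i, ∑ j, v i * (w j * M.c i j k) : ℝ) : ℂ) := by
      push_cast
      simp only [mul_assoc]
    rw [this, Complex.ofReal_re]
  rw [h2]
  simp only [map_sum, map_smul]
  exact Finset.sum_congr rfl fun i _ => Finset.sum_congr rfl fun j _ => smul_comm _ _ _

theorem lie_eq_zero {v w : Fin n → ℝ} (h : M.bil (ofRealVec n v) (ofRealVec n w) = 0) :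
    ⁅S.E v, S.E w⁆ = 0 := by
  rw [lie_eq, h]
  exact map_zero S.T

theorem generates {ι : Type*} (u : ι → Fin n → ℝ) (hu : Submodule.span ℝ (Set.range u) = ⊤) :
    Submodule.span ℝ (Set.range fun i => S.E (u i)) ⊔
      (LieModule.lowerCentralSeries ℝ L L 1).toSubmodule = ⊤ := by
  have : Submodule.span ℝ (Set.range fun i => S.E (u i)) = LinearMap.range S.E := by
    rw [LinearMap.range_eq_map, ← hu, Submodule.map_span, ← Set.range_comp]
    rfl
  rw [this, S.sup_eq_top]

end Realization

theorem exists_int_factor {P Q : ℝ[X]} {w p : ℤ[X]} (h : P * Q = w.map (Int.castRingHom ℝ))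
    (hp : p.Monic) (hP : P = p.map (Int.castRingHom ℝ)) :
    ∃ q : ℤ[X], Q = q.map (Int.castRingHom ℝ) ∧ p * q = w := by
  subst hP
  obtain ⟨q, rfl⟩ := (map_dvd_map (Int.castRingHom ℝ) (Int.castRingHom ℝ).injective_int hp).1
    (Dvd.intro _ h)
  refine ⟨q, ?_, rfl⟩
  rw [Polynomial.map_mul] at h
  exact mul_left_cancel₀ (hp.map _).ne_zero h

theorem exists_int_of_rat_factor {Q : ℚ[X]} {w : ℤ[X]} (hw : w.Monic) (hQ : Q.Monic)
    (h : Q.map (algebraMap ℚ ℝ) ∣ w.map (Int.castRingHom ℝ)) :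
    ∃ q : ℤ[X], q.Monic ∧ Q = q.map (Int.castRingHom ℚ) := by
  have h1 : Q ∣ w.map (Int.castRingHom ℚ) := by
    rw [← map_dvd_map (algebraMap ℚ ℝ) (algebraMap ℚ ℝ).injective hQ, Polynomial.map_map]
    have e : (algebraMap ℚ ℝ).comp (Int.castRingHom ℚ) = Int.castRingHom ℝ :=
      Subsingleton.elim _ _
    rwa [e]
  obtain ⟨q, hq⟩ := IsIntegrallyClosed.eq_map_mul_C_of_dvd ℚ hw (g := Q) h1
  rw [hQ.leadingCoeff, C_1, mul_one] at hq
  refine ⟨q, ?_, hq.symm⟩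
  rw [← hq] at hQ
  exact (Function.Injective.monic_map_iff (algebraMap ℤ ℚ).injective_int).2 hQ

/-- The block triangular shape of an automorphism in a basis adapted to `[L, L]`. -/
theorem exists_blocks [FiniteDimensional ℝ L] (hL : IsTwoStepOfType L n m)
    (φ : L ≃ₗ⁅ℝ⁆ L) (e : Fin n → L) (f : Fin m → L)
    (he : Submodule.span ℝ (Set.range e) ⊔
      (LieModule.lowerCentralSeries ℝ L L 1).toSubmodule = ⊤)
    (hf : Submodule.span ℝ (Set.range f) =
      (LieModule.lowerCentralSeries ℝ L L 1).toSubmodule) :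
    ∃ (b : Module.Basis (Fin n ⊕ Fin m) ℝ L) (A : Matrix (Fin n) (Fin n) ℝ)
      (D : Matrix (Fin m) (Fin m) ℝ), (∀ i, b (Sum.inl i) = e i) ∧ (∀ i, b (Sum.inr i) = f i) ∧
      (∀ i j, A i j = b.repr (φ (e j)) (Sum.inl i)) ∧
      (∀ i j, D i j = b.repr (φ (f j)) (Sum.inr i)) ∧
      (∀ x ∈ (LieModule.lowerCentralSeries ℝ L L 1), ∀ i, b.repr x (Sum.inl i) = 0) ∧
      (φ : L →ₗ[ℝ] L).charpoly = A.charpoly * D.charpoly := by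
  have hdim : Module.finrank ℝ L = n + m := by
    have := Submodule.finrank_quotient_add_finrank
      (LieModule.lowerCentralSeries ℝ L L 1).toSubmodule
    rw [← this]
    exact congrArg₂ _ hL.finrank_one hL.finrank_two
  let b : Module.Basis (Fin n ⊕ Fin m) ℝ L :=
    basisOfTopLeSpanOfCardEqFinrank (Sum.elim e f)
      (by rw [Set.Sum.elim_range, Submodule.span_union, hf, he]) (by simp [hdim])
  have hbl : ∀ i, b (Sum.inl i) = e i := fun i => by simp [b]
  have hbr : ∀ i, b (Sum.inr i) = f i := fun i => by simp [b]
  have h0 : ∀ x ∈ (LieModule.lowerCentralSeries ℝ L L 1), ∀ i, b.repr x (Sum.inl i) = 0 := by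
    intro x hx i
    have hx' : x ∈ Submodule.span ℝ (Set.range f) := by rw [hf]; exact hx
    induction hx' using Submodule.span_induction with
    | zero => simp
    | add a c ha' hc' ha hc =>
      rw [hf] at ha' hc'
      rw [map_add, Finsupp.add_apply, ha ha', hc hc', add_zero]
    | smul r a ha' ha =>
      rw [hf] at ha'
      rw [map_smul, Finsupp.smul_apply, ha ha', smul_zero]
    | mem a ha =>
      obtain ⟨j, rfl⟩ := ha
      rw [← hbr, b.repr_self]
      simp
  have hφ : ∀ x ∈ (LieModule.lowerCentralSeries ℝ L L 1),
      φ x ∈ (LieModule.lowerCentralSeries ℝ L L 1) := by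
    intro x hx
    exact LieIdeal.map_lowerCentralSeries_le 1 (f := (φ : L →ₗ⁅ℝ⁆ L)) (LieIdeal.mem_map hx)
  refine ⟨b, Matrix.of fun i j => b.repr (φ (e j)) (Sum.inl i),
    Matrix.of fun i j => b.repr (φ (f j)) (Sum.inr i), hbl, hbr, fun _ _ => rfl, fun _ _ => rfl,
    h0, ?_⟩
  rw [← LinearMap.charpoly_toMatrix (φ : L →ₗ[ℝ] L) b,
    ← Matrix.charpoly_fromBlocks_zero₁₂ _ (Matrix.of fun i j => b.repr (φ (e j)) (Sum.inr i))]
  congr 1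
  ext (i | i) (j | j)
  · simp [LinearMap.toMatrix_apply, hbl]
  · simp only [LinearMap.toMatrix_apply, hbr, Matrix.fromBlocks_apply₁₂, Matrix.zero_apply]
    refine h0 _ (hφ _ ?_) i
    have : f j ∈ Submodule.span ℝ (Set.range f) := Submodule.subset_span ⟨j, rfl⟩
    rw [hf] at this
    exact this
  · simp [LinearMap.toMatrix_apply, hbl]
  · simp [LinearMap.toMatrix_apply, hbr]

/-- The data of an Anosov automorphism in a basis adapted to `[L, L]`. -/
theorem exists_model_of_charpoly (hL : IsTwoStepOfType L n m) (φ : L ≃ₗ⁅ℝ⁆ L)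
    (e : Fin n → L) (f : Fin m → L)
    (hf : Submodule.span ℝ (Set.range f) =
      (LieModule.lowerCentralSeries ℝ L L 1).toSubmodule)
    (b : Module.Basis (Fin n ⊕ Fin m) ℝ L) (A : Matrix (Fin n) (Fin n) ℝ)
    (D : Matrix (Fin m) (Fin m) ℝ) (hbl : ∀ i, b (Sum.inl i) = e i)
    (hbr : ∀ i, b (Sum.inr i) = f i)
    (hA : ∀ i j, A i j = b.repr (φ (e j)) (Sum.inl i))
    (hD : ∀ i j, D i j = b.repr (φ (f j)) (Sum.inr i))
    (h0 : ∀ x ∈ (LieModule.lowerCentralSeries ℝ L L 1), ∀ i, b.repr x (Sum.inl i) = 0)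
    {p q : ℤ[X]} (hp : A.charpoly = p.map (Int.castRingHom ℝ))
    (hq : D.charpoly = q.map (Int.castRingHom ℝ)) (hu : IsUnit ((p * q).coeff 0))
    (hn : ∀ z : ℂ, aeval z (p * q) = 0 → ‖z‖ ≠ 1) :
    ∃ M : AnosovModel n m, M.p = p ∧ Nonempty (Realization M L) := by
  let c : Fin n → Fin n → Fin m → ℝ := fun i j k => b.repr ⁅e i, e j⁆ (Sum.inr k)
  have expand : ∀ x ∈ (LieModule.lowerCentralSeries ℝ L L 1),
      x = ∑ k, b.repr x (Sum.inr k) • f k := by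
    intro x hx
    conv_lhs => rw [← b.sum_repr x]
    rw [Fintype.sum_sum_type]
    simp [h0 x hx, hbr]
  have hc : ∀ i j, ⁅e i, e j⁆ = ∑ k, c i j k • f k := fun i j =>
    expand _ (lie_mem_lcs_one _ _)
  have hφ : ∀ x ∈ (LieModule.lowerCentralSeries ℝ L L 1),
      φ x ∈ (LieModule.lowerCentralSeries ℝ L L 1) := by
    intro x hx
    exact LieIdeal.map_lowerCentralSeries_le 1 (f := (φ : L →ₗ⁅ℝ⁆ L)) (LieIdeal.mem_map hx)
  have hfmem : ∀ j, f j ∈ LieModule.lowerCentralSeries ℝ L L 1 := by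
    intro j
    have : f j ∈ Submodule.span ℝ (Set.range f) := Submodule.subset_span ⟨j, rfl⟩
    rw [hf] at this
    exact this
  have hφe : ∀ j, ∃ y ∈ LieModule.lowerCentralSeries ℝ L L 1,
      φ (e j) = ∑ i, A i j • e i + y := by
    intro j
    refine ⟨∑ k, b.repr (φ (e j)) (Sum.inr k) • f k, ?_, ?_⟩
    · exact sum_mem fun k _ =>
        Submodule.smul_mem (LieModule.lowerCentralSeries ℝ L L 1).toSubmodule _ (hfmem k)
    · conv_lhs => rw [← b.sum_repr (φ (e j))]
      rw [Fintype.sum_sum_type]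
      simp [hbl, hbr, hA]
  have hrepr : ∀ (g : Fin m → ℝ) k, b.repr (∑ k, g k • f k) (Sum.inr k) = g k := by
    intro g k
    simp [← hbr, Finsupp.single_apply]
  have hspan : Submodule.span ℝ (Set.range e) ⊔
      (LieModule.lowerCentralSeries ℝ L L 1).toSubmodule = ⊤ := by
    rw [← hf, ← Submodule.span_union, ← Set.Sum.elim_range, ← b.span_eq]
    congr 2
    ext (i | i)
    · simp [hbl]
    · simp [hbr]
  have hpq0 : (p * q).coeff 0 = p.coeff 0 * q.coeff 0 := mul_coeff_zero p q
  let M : AnosovModel n m :=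
    { A := A, D := D, c := c, p := p, q := q, charpoly_A := hp, charpoly_D := hq
      skew := by
        intro i j
        ext k
        simp only [c, Pi.neg_apply]
        rw [← lie_skew, map_neg, Finsupp.neg_apply]
      equivariant := by
        intro i j
        ext k
        have h1 : φ ⁅e i, e j⁆ = ∑ r, (D.mulVec (c i j)) r • f r := by
          rw [hc, map_sum]
          have : ∀ s, φ (c i j s • f s) = ∑ r, (D r s * c i j s) • f r := by
            intro s
            rw [map_smul, expand _ (hφ _ (hfmem s)), Finset.smul_sum]
            refine Finset.sum_congr rfl fun r _ => ?_
            rw [smul_smul, hD, mul_comm]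
          simp only [this]
          rw [Finset.sum_comm]
          refine Finset.sum_congr rfl fun r _ => ?_
          rw [← Finset.sum_smul]
          rfl
        have h2 : φ ⁅e i, e j⁆ = ∑ r, (∑ k, ∑ l, (A k i * A l j) • c k l) r • f r := by
          obtain ⟨y, hy, hy'⟩ := hφe i
          obtain ⟨y', hy₁, hy₂⟩ := hφe j
          rw [LieEquiv.map_lie, hy', hy₂, lie_add, lie_eq_zero_of_mem_lcs_one hL.lcs_two _ hy₁,
            add_lie, lie_eq_zero_of_mem_lcs_one' hL.lcs_two _ hy, add_zero, add_zero,
            sum_lie]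
          have hF : ∀ g : Fin m → ℝ, ∑ r, g r • f r = Fintype.linearCombination ℝ f g :=
            fun g => rfl
          simp only [lie_sum, smul_lie, lie_smul, hc, hF, map_sum, map_smul, smul_smul]
          exact Finset.sum_congr rfl fun _ _ => Finset.sum_congr rfl fun _ _ => by rw [mul_comm]
        have h3 := congrArg (fun x => b.repr x (Sum.inr k)) (h1.symm.trans h2)
        simpa only [hrepr] using h3
      span_c := by
        rw [eq_top_iff]
        intro g _
        have h1 : ∑ k, g k • f k ∈ (LieModule.lowerCentralSeries ℝ L L 1).toSubmodule :=
          sum_mem fun k _ =>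
            Submodule.smul_mem (LieModule.lowerCentralSeries ℝ L L 1).toSubmodule _ (hfmem k)
        rw [lcs_one_eq_span_of_span hL.lcs_two e hspan] at h1
        let P : L →ₗ[ℝ] (Fin m → ℝ) :=
          { toFun := fun x k => b.repr x (Sum.inr k)
            map_add' := fun x y => by ext k; simp
            map_smul' := fun r x => by ext k; simp }
        have h2 := Submodule.mem_map_of_mem (f := P) h1
        rw [Submodule.map_span, ← Set.range_comp] at h2
        have h3 : P (∑ k, g k • f k) = g := by
          ext k
          exact hrepr g k
        rw [h3] at h2
        exact h2
      pos := by
        rcases Nat.eq_zero_or_pos m with rfl | h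
        · rw [Set.range_eq_empty, Submodule.span_empty] at hf
          exact absurd ((LieSubmodule.toSubmodule_eq_bot _).1 hf.symm) hL.lcs_one
        · exact h
      unit_p := isUnit_of_mul_isUnit_left (hpq0 ▸ hu)
      unit_q := isUnit_of_mul_isUnit_right (hpq0 ▸ hu)
      norm_p := fun z hz => hn z (by rw [map_mul, hz, zero_mul])
      norm_q := fun z hz => hn z (by rw [map_mul, hz, mul_zero]) }
  refine ⟨M, rfl, ⟨⟨Fintype.linearCombination ℝ e, Fintype.linearCombination ℝ f, ?_, ?_⟩⟩⟩
  · rw [Fintype.range_linearCombination, hspan]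
  · intro i j
    rw [Fintype.linearCombination_apply_single, Fintype.linearCombination_apply_single, one_smul,
      one_smul, hc, Fintype.linearCombination_apply]

/-- The characteristic polynomial of an Anosov automorphism. -/
theorem charpoly_eq_of_matrix [FiniteDimensional ℝ L] {φ : L ≃ₗ⁅ℝ⁆ L} {N : ℕ}
    {B : Module.Basis (Fin N) ℝ L} {U : GL (Fin N) ℤ}
    (hU : ∀ j, φ (B j) = ∑ i, ((U : Matrix (Fin N) (Fin N) ℤ) i j : ℝ) • B i) :
    (φ : L →ₗ[ℝ] L).charpoly =
        (U : Matrix (Fin N) (Fin N) ℤ).charpoly.map (Int.castRingHom ℝ) ∧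
      IsUnit ((U : Matrix (Fin N) (Fin N) ℤ).charpoly.coeff 0) := by
  constructor
  · rw [← LinearMap.charpoly_toMatrix _ B, ← Matrix.charpoly_map]
    congr 1
    ext i j
    rw [LinearMap.toMatrix_apply]
    have := hU j
    simp only [Matrix.map_apply, eq_intCast]
    change B.repr (φ (B j)) i = _
    rw [this]
    simp [Finsupp.single_apply]
  · have h1 : IsUnit (U : Matrix (Fin N) (Fin N) ℤ).det :=
      (Matrix.isUnit_iff_isUnit_det _).1 U.isUnit
    rw [Matrix.det_eq_sign_charpoly_coeff] at h1
    exact isUnit_of_mul_isUnit_right h1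

/-- A model whose polynomial `p₁` is the one of the given integer matrix, for an automorphism
that lifts to `𝔣_{n,2}`. -/
theorem exists_model_of_isAssociatedPair (hL : IsTwoStepOfType L n m) {φ : L ≃ₗ⁅ℝ⁆ L}
    (hφ : IsAnosovAut φ) {p₁ p₂ : ℤ[X]} (h : IsAssociatedPair φ n p₁ p₂) :
    ∃ M : AnosovModel n m, M.p = p₁ ∧ Nonempty (Realization M L) := by
  have := hL.finite
  obtain ⟨N, B, U, -, hU, hnorm⟩ := hφ
  obtain ⟨G, π, hπ, -, hcomm, rfl, -⟩ := h
  obtain ⟨hw, hunit⟩ := charpoly_eq_of_matrix hU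
  let e : Fin n → L := fun i => π (gen n 2 i)
  have he : Submodule.span ℝ (Set.range e) ⊔
      (LieModule.lowerCentralSeries ℝ L L 1).toSubmodule = ⊤ := by
    rw [eq_top_iff]
    have h1 : LinearMap.range (π : FreeNilpotent n 2 →ₗ[ℝ] L) = ⊤ := LinearMap.range_eq_top.2 hπ
    rw [← h1, LinearMap.range_eq_map, ← span_gen_sup_span_lie_gen, Submodule.map_sup,
      Submodule.map_span, Submodule.map_span]
    refine sup_le_sup ?_ (Submodule.span_le.2 ?_)
    · rw [← Set.range_comp]
      exact le_rfl
    · rintro _ ⟨_, ⟨x, rfl⟩, rfl⟩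
      have : (π : FreeNilpotent n 2 →ₗ[ℝ] L) ⁅gen n 2 x.1, gen n 2 x.2⁆ =
        ⁅π (gen n 2 x.1), π (gen n 2 x.2)⁆ := LieHom.map_lie π _ _
      simp only [this]
      exact lie_mem_lcs_one _ _
  obtain ⟨f, hf⟩ : ∃ f : Fin m → L, Submodule.span ℝ (Set.range f) =
      (LieModule.lowerCentralSeries ℝ L L 1).toSubmodule := by
    have h1 : Module.finrank ℝ (LieModule.lowerCentralSeries ℝ L L 1).toSubmodule ≤ m :=
      hL.finrank_two.le
    obtain ⟨f, -, hf⟩ := exists_spanning_family _ h1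
    exact ⟨f, hf⟩
  obtain ⟨b, A, D, hbl, hbr, hA, hD, h0, hchar⟩ := exists_blocks hL φ e f he hf
  have hAG : A = (G : Matrix (Fin n) (Fin n) ℤ).map (Int.castRingHom ℝ) := by
    ext i j
    have h1 : φ (e j) = ∑ k, ((G : Matrix (Fin n) (Fin n) ℤ) k j : ℝ) • e k := by
      rw [← hcomm, matrixHom, hom_gen, map_sum]
      simp only [map_smul, e]
    rw [hA, h1, map_sum, Finsupp.finsetSum_apply]
    simp only [map_smul, ← hbl, b.repr_self, Finsupp.smul_apply]
    simp [Finsupp.single_apply]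
  have hp : A.charpoly =
      (G : Matrix (Fin n) (Fin n) ℤ).charpoly.map (Int.castRingHom ℝ) := by
    rw [hAG, Matrix.charpoly_map]
  obtain ⟨q, hq, hpq⟩ := exists_int_factor (hchar.symm.trans hw) (Matrix.charpoly_monic _) hp
  exact exists_model_of_charpoly hL φ e f hf b A D hbl hbr hA hD h0 hp hq (hpq ▸ hunit)
    (hpq ▸ hnorm)

/-- Rationally independent rational vectors are linearly independent over the reals. -/
theorem linearIndependent_ratCast {d N : ℕ} {g : Fin d → Fin N → ℚ} (hg : LinearIndependent ℚ g) :
    LinearIndependent ℝ fun j k => (g j k : ℝ) := by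
  obtain ⟨r, hr⟩ := LinearMap.exists_leftInverse_of_injective (Fintype.linearCombination ℚ g)
    (LinearMap.ker_eq_bot.2 hg.fintypeLinearCombination_injective)
  have hr' : ∀ i j, r (g j) i = if i = j then 1 else 0 := by
    intro i j
    have := congrFun (LinearMap.congr_fun hr (Pi.single j 1)) i
    simpa [Fintype.linearCombination_apply_single, Pi.single_apply] using this
  have hexp : ∀ i (v : Fin N → ℚ), r v i = ∑ k, v k * r (Pi.single k 1) i := by
    intro i v
    conv_lhs => rw [pi_eq_sum_univ' v, map_sum, Finset.sum_apply]
    simp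
  rw [Fintype.linearIndependent_iff]
  intro x hx i
  have h1 : ∑ k, (∑ j, x j * (g j k : ℝ)) * (r (Pi.single k 1) i : ℝ) = x i := by
    simp only [Finset.sum_mul]
    rw [Finset.sum_comm]
    have h2 : ∀ j, ∑ k, x j * (g j k : ℝ) * (r (Pi.single k 1) i : ℝ) =
        x j * if i = j then 1 else 0 := by
      intro j
      have h3 := (hexp i (g j)).symm.trans (hr' i j)
      have h4 : ∑ k, (g j k : ℝ) * (r (Pi.single k 1) i : ℝ) = if i = j then 1 else 0 := by
        have := congrArg (fun t : ℚ => (t : ℝ)) h3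
        push_cast at this
        rw [this]
        split_ifs <;> simp
      rw [← h4, Finset.mul_sum]
      exact Finset.sum_congr rfl fun k _ => by ring
    simp [h2]
  rw [← h1]
  refine Finset.sum_eq_zero fun k _ => ?_
  have := congrFun hx k
  simp only [Finset.sum_apply, Pi.smul_apply, smul_eq_mul, Pi.zero_apply] at this
  rw [this, zero_mul]

/-- The rational structure gives `[L, L]` a basis in which an Anosov automorphism has a rational
matrix. -/
theorem exists_rational_frame {φ : L ≃ₗ⁅ℝ⁆ L} {N : ℕ} {B : Module.Basis (Fin N) ℝ L}
    {U : Matrix (Fin N) (Fin N) ℤ} (hB : ∀ i j k, ∃ q : ℚ, B.repr ⁅B i, B j⁆ k = (q : ℝ))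
    (hU : ∀ j, φ (B j) = ∑ i, (U i j : ℝ) • B i) :
    ∃ (d : ℕ) (f : Fin d → L) (D : Matrix (Fin d) (Fin d) ℚ), LinearIndependent ℝ f ∧
      Submodule.span ℝ (Set.range f) = (LieModule.lowerCentralSeries ℝ L L 1).toSubmodule ∧
      ∀ j, φ (f j) = ∑ i, (D i j : ℝ) • f i := by
  choose c hc using hB
  let ψ : (Fin N → ℚ) → L := fun v => ∑ k, (v k : ℝ) • B k
  have ψ_add : ∀ v w, ψ (v + w) = ψ v + ψ w := by
    intro v w
    simp [ψ, add_smul, Finset.sum_add_distrib]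
  have ψ_smul : ∀ (r : ℚ) v, ψ (r • v) = (r : ℝ) • ψ v := by
    intro r v
    simp [ψ, smul_smul, Finset.smul_sum]
  have ψ_zero : ψ 0 = 0 := by simp [ψ]
  have ψ_sum : ∀ {ι : Type} (s : Finset ι) (v : ι → Fin N → ℚ),
      ψ (∑ i ∈ s, v i) = ∑ i ∈ s, ψ (v i) := by
    intro ι s v
    exact map_sum (⟨⟨ψ, ψ_zero⟩, ψ_add⟩ : (Fin N → ℚ) →+ L) v s
  have ψ_repr : ∀ v k, B.repr (ψ v) k = (v k : ℝ) := by
    intro v k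
    simp [ψ, Finsupp.single_apply]
  have ψ_inj : Function.Injective ψ := by
    intro v w h
    ext k
    have := congrArg (fun x => B.repr x k) h
    simp only [ψ_repr] at this
    exact_mod_cast this
  have hlie : ∀ i j, ⁅B i, B j⁆ = ψ (c i j) := by
    intro i j
    apply B.repr.injective
    ext k
    rw [hc, ψ_repr]
  let UQ : Matrix (Fin N) (Fin N) ℚ := U.map (Int.castRingHom ℚ)
  have hψU : ∀ v, φ (ψ v) = ψ (UQ.mulVec v) := by
    intro v
    simp only [ψ, map_sum, map_smul, hU, Finset.smul_sum, smul_smul]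
    rw [Finset.sum_comm]
    refine Finset.sum_congr rfl fun i _ => ?_
    rw [← Finset.sum_smul]
    congr 1
    simp [UQ, Matrix.mulVec, dotProduct, mul_comm]
  let W : Submodule ℚ (Fin N → ℚ) :=
    Submodule.span ℚ (Set.range fun x : Fin N × Fin N => c x.1 x.2)
  have hW : ∀ v ∈ W, UQ.mulVec v ∈ W := by
    intro v hv
    induction hv using Submodule.span_induction with
    | zero => simp
    | add a b _ _ ha hb => rw [Matrix.mulVec_add]; exact add_mem ha hb
    | smul r a _ ha => rw [Matrix.mulVec_smul]; exact Submodule.smul_mem _ _ ha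
    | mem a ha =>
      obtain ⟨⟨i, j⟩, rfl⟩ := ha
      have h1 : UQ.mulVec (c i j) = ∑ k, ∑ l, ((U k i : ℚ) * (U l j : ℚ)) • c k l := by
        apply ψ_inj
        rw [← hψU, ← hlie, LieEquiv.map_lie, hU, hU, sum_lie, ψ_sum]
        refine Finset.sum_congr rfl fun k _ => ?_
        rw [lie_sum, ψ_sum]
        refine Finset.sum_congr rfl fun l _ => ?_
        rw [smul_lie, lie_smul, hlie, smul_smul, ψ_smul]
        push_cast
        rfl
      simp only [h1]
      exact sum_mem fun k _ => sum_mem fun l _ =>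
        Submodule.smul_mem _ _ (Submodule.subset_span ⟨(k, l), rfl⟩)
  let g := Module.finBasis ℚ W
  have hind : LinearIndependent ℚ fun i => (g i : Fin N → ℚ) :=
    g.linearIndependent.map' W.subtype (Submodule.ker_subtype _)
  have hsub : ∀ v (hv : v ∈ W), v = ∑ i, g.repr ⟨v, hv⟩ i • (g i : Fin N → ℚ) := by
    intro v hv
    have := congrArg Subtype.val (g.sum_repr ⟨v, hv⟩)
    rw [AddSubmonoidClass.coe_finsetSum] at this
    exact this.symm
  refine ⟨_, fun i => ψ (g i), Matrix.of fun i j => g.repr ⟨UQ.mulVec (g j), hW _ (g j).2⟩ i,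
    ?_, ?_, ?_⟩
  · have h1 := linearIndependent_ratCast hind
    refine LinearIndependent.of_comp (B.equivFun : L →ₗ[ℝ] (Fin N → ℝ)) ?_
    convert h1 using 1
    ext i k
    simp [ψ_repr]
  · apply le_antisymm
    · rw [Submodule.span_le]
      rintro _ ⟨i, rfl⟩
      have : ∀ v ∈ W, ψ v ∈ (LieModule.lowerCentralSeries ℝ L L 1).toSubmodule := by
        intro v hv
        induction hv using Submodule.span_induction with
        | zero => rw [ψ_zero]; exact zero_mem _
        | add a b _ _ ha hb => rw [ψ_add]; exact add_mem ha hb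
        | smul r a _ ha => rw [ψ_smul]; exact Submodule.smul_mem _ _ ha
        | mem a ha =>
          obtain ⟨⟨i, j⟩, rfl⟩ := ha
          simp only [← hlie]
          exact lie_mem_lcs_one _ _
      exact this _ (g i).2
    · rw [lcs_one_eq_span, Submodule.span_le]
      rintro _ ⟨⟨x, y⟩, rfl⟩
      have h1 := lie_mem_span_lie B (B.span_eq ▸ Submodule.mem_top : x ∈ _)
        (B.span_eq ▸ Submodule.mem_top : y ∈ _)
      refine Submodule.span_le.2 ?_ h1
      rintro _ ⟨⟨i, j⟩, rfl⟩
      have h2 := hsub (c i j) (Submodule.subset_span ⟨(i, j), rfl⟩)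
      simp only [hlie, SetLike.mem_coe]
      rw [h2, ψ_sum]
      refine sum_mem fun k _ => ?_
      rw [ψ_smul]
      exact Submodule.smul_mem _ _ (Submodule.subset_span ⟨k, rfl⟩)
  · intro j
    rw [hψU]
    have h2 := hsub _ (hW _ (g j).2)
    conv_lhs => rw [h2, ψ_sum]
    refine Finset.sum_congr rfl fun k _ => ?_
    rw [ψ_smul]
    rfl

theorem exists_model_of_isAnosov (hL : IsTwoStepOfType L n m) (hA : IsAnosov L) :
    ∃ M : AnosovModel n m, Nonempty (Realization M L) := by
  have := hL.finite
  obtain ⟨φ, N, B, U, hB, hU, hnorm⟩ := hA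
  obtain ⟨hw, hunit⟩ := charpoly_eq_of_matrix hU
  obtain ⟨d, f, D₀, hind, hf, hD₀⟩ := exists_rational_frame hB hU
  have hd : d = m := by
    have h1 := finrank_span_eq_card hind
    rw [hf, Fintype.card_fin] at h1
    exact h1.symm.trans hL.finrank_two
  subst hd
  obtain ⟨e, he⟩ : ∃ e : Fin n → L, Submodule.span ℝ (Set.range e) ⊔
      (LieModule.lowerCentralSeries ℝ L L 1).toSubmodule = ⊤ := by
    obtain ⟨C, hC⟩ := Submodule.exists_isCompl (LieModule.lowerCentralSeries ℝ L L 1).toSubmodule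
    have h1 : Module.finrank ℝ C ≤ n := by
      have h2 := Submodule.finrank_add_eq_of_isCompl hC
      have h3 := Submodule.finrank_quotient_add_finrank
        (LieModule.lowerCentralSeries ℝ L L 1).toSubmodule
      have h4 : Module.finrank ℝ (L ⧸ (LieModule.lowerCentralSeries ℝ L L 1).toSubmodule) = n :=
        hL.finrank_one
      omega
    obtain ⟨e, -, he⟩ := exists_spanning_family C h1
    exact ⟨e, by rw [he, sup_comm, hC.sup_eq_top]⟩
  obtain ⟨b, A, D, hbl, hbr, hA, hD, h0, hchar⟩ := exists_blocks hL φ e f he hf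
  have hDD : D = D₀.map (algebraMap ℚ ℝ) := by
    ext i j
    rw [hD, hD₀, map_sum, Finsupp.finsetSum_apply]
    simp only [map_smul, ← hbr, b.repr_self, Finsupp.smul_apply]
    simp [Finsupp.single_apply]
  have hDc : D.charpoly = D₀.charpoly.map (algebraMap ℚ ℝ) := by
    rw [hDD, Matrix.charpoly_map]
  obtain ⟨q, hqm, hq⟩ := exists_int_of_rat_factor
    (Matrix.charpoly_monic (U : Matrix (Fin N) (Fin N) ℤ)) (Matrix.charpoly_monic D₀)
    (by rw [← hDc, ← hw, hchar]; exact Dvd.intro_left _ rfl)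
  have hDq : D.charpoly = q.map (Int.castRingHom ℝ) := by
    have e : (algebraMap ℚ ℝ).comp (Int.castRingHom ℚ) = Int.castRingHom ℝ :=
      Subsingleton.elim _ _
    rw [hDc, hq, Polynomial.map_map, e]
  rw [hw, mul_comm] at hchar
  obtain ⟨p, hp, hpq⟩ := exists_int_factor hchar.symm hqm hDq
  rw [mul_comm] at hpq
  obtain ⟨M, -, hM⟩ := exists_model_of_charpoly hL φ e f hf b A D hbl hbr hA hD h0 hp hDq
    (hpq ▸ hunit) (hpq ▸ hnorm)
  exact ⟨M, hM⟩

end Realization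

/-! ### Doubly transitive Galois groups -/

/-- Averaging over the stabilizer of a point: a function with zero sum that satisfies all the
translates of a relation `x a + x b = x c + x d` under a doubly transitive group vanishes
at `a`. -/
theorem eq_zero_of_doublyTransitive {n : ℕ} {x : Fin n → ℝ} (hx : ∑ i, x i = 0)
    (H : Subgroup (Equiv.Perm (Fin n))) {a b c d : Fin n} (hH : ∀ h ∈ H, h a = a)
    (htrans : ∀ i j, i ≠ a → j ≠ a → ∃ h ∈ H, h i = j) (hb : b ≠ a) (hc : c ≠ a) (hd : d ≠ a)
    (hrel : ∀ h ∈ H, x (h a) + x (h b) = x (h c) + x (h d)) : x a = 0 := by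
  classical
  let F : Fin n → ℝ := fun j => ∑ h : H, x (h.1 j)
  have hF : ∀ j, j ≠ a → F j = F b := by
    intro j hj
    obtain ⟨h, hh, rfl⟩ := htrans b j hb hj
    exact Fintype.sum_equiv (Equiv.mulRight (⟨h, hh⟩ : H)) _ _ fun g => rfl
  have hFa : F a = Fintype.card H * x a := by
    have : ∀ h : H, x (h.1 a) = x a := fun h => by rw [hH _ h.2]
    simp only [F, this, Finset.sum_const, Finset.card_univ, nsmul_eq_mul]
  have hsum : ∑ j, F j = 0 := by
    simp only [F]
    rw [Finset.sum_comm]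
    refine Finset.sum_eq_zero fun h _ => ?_
    rw [Equiv.sum_comp h.1 x, hx]
  have hr : F a + F b = F c + F d := by
    simp only [F, ← Finset.sum_add_distrib]
    exact Finset.sum_congr rfl fun h _ => hrel h.1 h.2
  rw [hF c hc, hF d hd] at hr
  rw [← Finset.add_sum_erase _ _ (Finset.mem_univ a),
    Finset.sum_congr rfl fun j hj => hF j (Finset.ne_of_mem_erase hj), Finset.sum_const,
    nsmul_eq_mul] at hsum
  have hFb : F b = F a := by linarith
  have hcard : (0 : ℝ) < Fintype.card H := by exact_mod_cast Fintype.card_pos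
  have h0 : ((1 : ℝ) + (Finset.univ.erase a).card) * (Fintype.card H * x a) = 0 := by
    rw [← hFa]
    rw [hFb] at hsum
    linarith
  have h1 : (1 : ℝ) + (Finset.univ.erase a).card ≠ 0 := by positivity
  rcases mul_eq_zero.1 h0 with h | h
  · exact absurd h h1
  · exact (mul_eq_zero.1 h).resolve_left hcard.ne'

/-- The roots of an irreducible polynomial in a field in which it splits. -/
theorem exists_roots {K : Type*} [Field K] [Algebra ℚ K] {f : ℤ[X]} (hf : f.Monic)
    (hirr : Irreducible (f.map (Int.castRingHom ℚ)))
    (hsplit : ((f.map (Int.castRingHom ℚ)).map (algebraMap ℚ K)).Splits) {d : ℕ}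
    (hd : f.natDegree = d) :
    ∃ α : Fin d → K, Function.Injective α ∧ ∀ i, aeval (α i) f = 0 := by
  have h1 := card_rootSet_eq_natDegree (K := K) hirr.separable hsplit
  rw [hf.natDegree_map, hd] at h1
  let e := (Fintype.equivFinOfCardEq h1).symm
  refine ⟨fun i => e i, fun i j h => e.injective (Subtype.ext h), fun i => ?_⟩
  have h2 := (mem_rootSet.1 (e i).2).2
  rw [aeval_def, eval₂_map] at h2
  rw [aeval_def, ← h2]
  congr 1
  exact Subsingleton.elim _ _

namespace AnosovModel.Roots

variable {n m : ℕ} {M : AnosovModel n m} {K : Type*} [Field K] (R : M.Roots K)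

/-- The group of permutations of the roots induced by field automorphisms. -/
def symmGroup : Subgroup (Equiv.Perm (Fin n)) where
  carrier := {g | R.IsSymm g}
  one_mem' := ⟨RingEquiv.refl K, fun _ => rfl⟩
  mul_mem' := by
    rintro g h ⟨σ, hσ⟩ ⟨σ', hσ'⟩
    exact ⟨σ'.trans σ, fun i => by simp [hσ, hσ']⟩
  inv_mem' := by
    rintro g ⟨σ, hσ⟩
    refine ⟨σ.symm, fun i => ?_⟩
    rw [RingEquiv.symm_apply_eq, hσ]
    simp

theorem exists_mem_symmGroup (σ : K ≃+* K) :
    ∃ g ∈ R.symmGroup, ∀ i, σ (R.root i) = R.root (g i) := by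
  obtain ⟨g, hg, hg'⟩ := R.exists_isSymm σ
  have hb : Function.Bijective g := Finite.injective_iff_bijective.1 (R.isSymm_injective hg)
  exact ⟨Equiv.ofBijective g hb, hg, hg'⟩

end AnosovModel.Roots

section DoublyTransitive

variable {L : Type*} [LieRing L] [LieAlgebra ℝ L] {n m : ℕ}

theorem nonempty_equiv_of_card_le (hL : IsTwoStepOfType L n m) {M : AnosovModel n m}
    (S : Realization M L)
    (hm : (Finset.univ.filter fun p : Fin n × Fin n => p.2 < p.1).card ≤ m) :
    Nonempty (L ≃ₗ⁅ℝ⁆ FreeNilpotent n 2) :=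
  nonempty_equiv_freeNilpotent hL _
    (S.generates (Pi.basisFun ℝ (Fin n)) (Pi.basisFun ℝ (Fin n)).span_eq) hm

theorem nonempty_equiv_of_doublyTransitive (hL : IsTwoStepOfType L n m) {M : AnosovModel n m}
    (S : Realization M L) (hirr : Irreducible (M.p.map (Int.castRingHom ℚ)))
    (hdt : GaloisDoublyTransitive M.p) : Nonempty (L ≃ₗ⁅ℝ⁆ FreeNilpotent n 2) := by
  let K := (M.p.map (Int.castRingHom ℚ)).SplittingField
  obtain ⟨α, hα, hα'⟩ := exists_roots (K := K) M.p_monic hirr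
    (SplittingField.splits (M.p.map (Int.castRingHom ℚ))) M.natDegree_p
  let R : M.Roots K :=
    { emb := (IsAlgClosed.lift : K →ₐ[ℚ] ℂ), root := α, injective := hα, aeval_root := hα' }
  have htrans : ∀ i j k l, i ≠ j → k ≠ l → ∃ g ∈ R.symmGroup, g i = k ∧ g j = l := by
    intro i j k l hij hkl
    obtain ⟨σ, h1, h2⟩ := hdt (α i) (α j) (α k) (α l) (hα' i) (hα' j) (hα' k) (hα' l)
      (hα.ne hij) (hα.ne hkl)
    obtain ⟨g, hg, hg'⟩ := R.exists_mem_symmGroup σ.toRingEquiv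
    exact ⟨g, hg, hα ((hg' i).symm.trans h1), hα ((hg' j).symm.trans h2)⟩
  obtain ⟨i₀, j₀, hij₀, hadj₀⟩ := R.exists_adj
  have hadj : ∀ i j, i ≠ j → R.Adj i j := by
    intro i j hij
    obtain ⟨g, hg, rfl, rfl⟩ := htrans i₀ j₀ i j hij₀ hij
    exact (R.isSymm_adj hg).2 hadj₀
  have hcard := R.card_edges (Finset.univ.filter fun p : Fin n × Fin n => p.2 < p.1)
    (fun x hx => by simpa using hx)
    (fun i j hij => by simpa [hij] using hadj i j hij.ne') (by
      intro i j k l hij hkl hik hil hjk hjl _ h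
      let H : Subgroup (Equiv.Perm (Fin n)) :=
        { carrier := {g | g ∈ R.symmGroup ∧ g i = i}
          one_mem' := ⟨one_mem _, rfl⟩
          mul_mem' := fun {g h} hg hh => ⟨mul_mem hg.1 hh.1, by
            rw [Equiv.Perm.mul_apply, hh.2, hg.2]⟩
          inv_mem' := fun {g} hg => ⟨inv_mem hg.1, by
            rw [Equiv.Perm.inv_eq_iff_eq, hg.2]⟩ }
      refine R.lg_ne_zero i (eq_zero_of_doublyTransitive R.sum_lg H (fun h hh => hh.2) ?_ hij.symm
        hik.symm hil.symm (fun g hg => R.isSymm_lg hg.1 h))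
      intro r s hr hs
      obtain ⟨g, hg, h1, h2⟩ := htrans i r i s hr.symm hs.symm
      exact ⟨g, ⟨hg, h1⟩, h2⟩)
  exact nonempty_equiv_of_card_le hL S hcard.ge

end DoublyTransitive

/-! ### Factors of `p` and symmetries of the graph -/

theorem aeval_map_rat {K : Type*} [Field K] [Algebra ℚ K] (a : K) (f : ℤ[X]) :
    aeval a (f.map (Int.castRingHom ℚ)) = aeval a f := by
  rw [aeval_def, eval₂_map, aeval_def]
  congr 1
  exact Subsingleton.elim _ _

theorem exists_ringEquiv_of_roots {K : Type*} [Field K] [Algebra ℚ K] [Normal ℚ K] {f : ℤ[X]}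
    (hf : f.Monic) (hirr : Irreducible (f.map (Int.castRingHom ℚ))) {a b : K}
    (ha : aeval a f = 0) (hb : aeval b f = 0) : ∃ σ : K ≃+* K, σ a = b := by
  have hmin : f.map (Int.castRingHom ℚ) = minpoly ℚ b :=
    minpoly.eq_of_irreducible_of_monic hirr (by rw [aeval_map_rat, hb]) (hf.map _)
  obtain ⟨σ, hσ⟩ := minpoly.exists_algEquiv_of_root (K := ℚ) (x := a) (y := b)
    ((Normal.isIntegral inferInstance b).isAlgebraic) (by rw [← hmin, aeval_map_rat, ha])
  exact ⟨σ.toRingEquiv, hσ⟩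

namespace AnosovModel

variable {n m : ℕ} (M : AnosovModel n m)

theorem isUnit_coeff_zero_of_dvd {f : ℤ[X]} (h : f ∣ M.p) :
    IsUnit (f.coeff 0) := by
  obtain ⟨g, hg⟩ := h
  have := M.unit_p
  rw [hg, mul_coeff_zero] at this
  exact isUnit_of_mul_isUnit_left this

/-- A monic factor of degree one would have the root `±1`. -/
theorem natDegree_ne_one_of_dvd {f : ℤ[X]} (hf : f.Monic) (hdvd : f ∣ M.p) :
    f.natDegree ≠ 1 := by
  intro h1
  have h0 := M.isUnit_coeff_zero_of_dvd hdvd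
  have hroot : aeval (-(f.coeff 0 : ℂ)) M.p = 0 := by
    obtain ⟨g, hg⟩ := hdvd
    have h2 := hf.eq_X_add_C h1
    rw [hg, map_mul]
    conv_lhs => rw [h2]
    simp
  refine M.norm_p _ hroot ?_
  rcases Int.isUnit_iff.1 h0 with h | h <;> simp [h]

theorem irreducible_of_dvd {f : ℤ[X]} (hf : f.Monic) (hdvd : f ∣ M.p) (h2 : 2 ≤ f.natDegree)
    (h3 : f.natDegree ≤ 3) : Irreducible (f.map (Int.castRingHom ℚ)) := by
  refine (hf.irreducible_iff_irreducible_map_fraction_map (K := ℚ)).1 ?_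
  rw [hf.irreducible_iff_natDegree']
  refine ⟨fun h => by simp [h] at h2, ?_⟩
  intro a b _ hb hab hmem
  rw [Finset.mem_Ioc] at hmem
  refine M.natDegree_ne_one_of_dvd hb ((Dvd.intro_left _ hab).trans hdvd) ?_
  omega

/-- `p` has no factors of degree one, so in low degree it is irreducible or has a quadratic
factor. -/
theorem irreducible_or_exists_factor (hn : 2 ≤ n) (hn5 : n ≤ 5) :
    Irreducible (M.p.map (Int.castRingHom ℚ)) ∨
      ∃ f g : ℤ[X], f.Monic ∧ g.Monic ∧ f * g = M.p ∧ g.natDegree = 2 := by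
  by_cases h : Irreducible M.p
  · exact Or.inl ((M.p_monic.irreducible_iff_irreducible_map_fraction_map (K := ℚ)).1 h)
  right
  rw [M.p_monic.irreducible_iff_natDegree', M.natDegree_p] at h
  have h1 : M.p ≠ 1 := by
    intro h
    have := M.natDegree_p
    rw [h, natDegree_one] at this
    omega
  push Not at h
  obtain ⟨f, g, hf, hg, hfg, hmem⟩ := h h1
  rw [Finset.mem_Ioc] at hmem
  have := M.natDegree_ne_one_of_dvd hg (Dvd.intro_left _ hfg)
  exact ⟨f, g, hf, hg, hfg, by omega⟩

theorem exists_roots_of_irreducible (K : Type*) [Field K] [Algebra ℚ K] [IsAlgClosure ℚ K]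
    (h : Irreducible (M.p.map (Int.castRingHom ℚ))) :
    ∃ R : M.Roots K, ∀ i j, ∃ g ∈ R.symmGroup, g i = j := by
  have : IsAlgClosed K := IsAlgClosure.isAlgClosed ℚ
  have : Normal ℚ K := IsAlgClosure.normal ℚ K
  have : Algebra.IsAlgebraic ℚ K := IsAlgClosure.isAlgebraic
  obtain ⟨α, hα, hα'⟩ := exists_roots (K := K) M.p_monic h
    (IsAlgClosed.splits (k := K) _) M.natDegree_p
  let R : M.Roots K :=
    { emb := (IsAlgClosed.lift : K →ₐ[ℚ] ℂ), root := α, injective := hα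
      aeval_root := hα' }
  refine ⟨R, fun i j => ?_⟩
  obtain ⟨σ, hσ⟩ := exists_ringEquiv_of_roots M.p_monic h (hα' i) (hα' j)
  obtain ⟨g, hg, hg'⟩ := R.exists_mem_symmGroup σ
  exact ⟨g, hg, hα ((hg' i).symm.trans hσ)⟩

/-- If `p` is a product of two distinct irreducible factors, the roots may be numbered such that
those of the second factor come first. -/
theorem exists_roots_of_mul (K : Type*) [Field K] [Algebra ℚ K] [IsAlgClosure ℚ K] {k l : ℕ}
    (M : AnosovModel (k + l) m) {f g : ℤ[X]} (hf : f.Monic) (hg : g.Monic) (hirrf : Irreducible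
    (f.map (Int.castRingHom ℚ)))
    (hirrg : Irreducible (g.map (Int.castRingHom ℚ))) (hne : f ≠ g) (hfg : f * g = M.p)
    (hk : g.natDegree = k) (hl : f.natDegree = l) :
    ∃ R : M.Roots K, (∀ i, aeval (R.root (Fin.castAdd l i)) g = 0) ∧
      ∀ i, aeval (R.root (Fin.natAdd k i)) f = 0 := by
  have : IsAlgClosed K := IsAlgClosure.isAlgClosed ℚ
  have : Normal ℚ K := IsAlgClosure.normal ℚ K
  have : Algebra.IsAlgebraic ℚ K := IsAlgClosure.isAlgebraic
  obtain ⟨α, hα, hα'⟩ := exists_roots (K := K) hg hirrg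
    (IsAlgClosed.splits (k := K) _) hk
  obtain ⟨β, hβ, hβ'⟩ := exists_roots (K := K) hf hirrf
    (IsAlgClosed.splits (k := K) _) hl
  have hdisj : ∀ i j, α i ≠ β j := by
    intro i j hij
    have h1 := minpoly.eq_of_irreducible_of_monic (x := α i) hirrg
      (by rw [aeval_map_rat, hα']) (hg.map _)
    have h2 := minpoly.eq_of_irreducible_of_monic (x := α i) hirrf
      (by rw [aeval_map_rat, hij, hβ']) (hf.map _)
    exact hne (map_injective _ (Int.castRingHom ℚ).injective_int (h2.trans h1.symm))
  refine ⟨{ emb := (IsAlgClosed.lift : K →ₐ[ℚ] ℂ), root := Fin.append α β,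
            injective := Fin.append_injective_iff.2 ⟨hα, hβ, hdisj⟩, aeval_root := ?_ }, ?_, ?_⟩
  · intro i
    refine Fin.addCases (fun i => ?_) (fun i => ?_) i
    · rw [Fin.append_left, ← hfg, map_mul, hα', mul_zero]
    · rw [Fin.append_right, ← hfg, map_mul, hβ', zero_mul]
  · intro i
    simp [hα']
  · intro i
    simp [hβ']

namespace Roots

variable {M} {K : Type*} [Field K] (R : M.Roots K)

/-- The same roots in another order. -/
def relabel (s : Equiv.Perm (Fin n)) : M.Roots K where
  emb := R.emb
  root := R.root ∘ s
  injective := R.injective.comp s.injective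
  aeval_root := fun i => R.aeval_root (s i)

/-- Disjoint edges carry distinct eigenvalues. -/
def SimpleEdges : Prop :=
  ∀ i j k l, i ≠ j → k ≠ l → i ≠ k → i ≠ l → j ≠ k → j ≠ l → R.Adj i j →
      R.eig i * R.eig j ≠ R.eig k * R.eig l

open Classical in
/-- The adjacency matrix of the graph `Adj`. -/
noncomputable def edge (i j : Fin n) : ℕ := if R.Adj i j then 1 else 0

theorem edge_le (i j : Fin n) : R.edge i j ≤ 1 := by
  unfold edge; split_ifs <;> omega

theorem edge_eq_one_iff {i j : Fin n} : R.edge i j = 1 ↔ R.Adj i j := by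
  unfold edge; split_ifs with h <;> simp [h]

theorem edge_eq_zero_iff {i j : Fin n} : R.edge i j = 0 ↔ ¬R.Adj i j := by
  unfold edge; split_ifs with h <;> simp [h]

theorem edge_comm (i j : Fin n) : R.edge i j = R.edge j i := by
  unfold edge; rw [R.adj_comm]

/-- Symmetries preserve the number of edges from a vertex to an invariant set. -/
theorem sum_edge_eq {g : Equiv.Perm (Fin n)} (hg : g ∈ R.symmGroup) (C : Finset (Fin n))
    (hC : ∀ j, g j ∈ C ↔ j ∈ C) (i : Fin n) :
    ∑ j ∈ C.erase (g i), R.edge (g i) j = ∑ j ∈ C.erase i, R.edge i j := by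
  symm
  refine Finset.sum_equiv g (fun j => ?_) (fun j _ => ?_)
  · simp [hC]
  · have := R.isSymm_adj hg (i := i) (j := j)
    unfold edge
    rw [this]

/-- Symmetries permute the roots of a factor of `p`. -/
theorem mem_iff_of_factor {f : ℤ[X]} (hf : f.Monic) {B : Finset (Fin n)}
    (hB : ∀ i ∈ B, aeval (R.root i) f = 0) (hcard : B.card = f.natDegree)
    {g : Equiv.Perm (Fin n)} (hg : g ∈ R.symmGroup) (j : Fin n) : g j ∈ B ↔ j ∈ B := by
  have key : ∀ h ∈ R.symmGroup, ∀ j, j ∈ B → h j ∈ B := by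
    rintro h ⟨σ, hσ⟩ j hj
    have h1 : aeval (R.root (h j)) f = 0 :=
      hσ j ▸ aeval_apply_eq_zero σ.toRingHom (hB j hj)
    obtain ⟨i, hi, hi'⟩ := exists_mem_eq_of_aeval_eq_zero hf R.injective hB hcard h1
    rwa [← R.injective hi']
  refine ⟨fun h => ?_, key g hg j⟩
  simpa using key g⁻¹ (inv_mem hg) _ h

theorem conj_mem_of_factor {f : ℤ[X]} (hf : f.Monic) {B : Finset (Fin n)}
    (hB : ∀ i ∈ B, aeval (R.root i) f = 0) (hcard : B.card = f.natDegree) {τ : Fin n → Fin n}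
    (hτ : ∀ i, R.eig (τ i) = star (R.eig i)) (j : Fin n) (hj : j ∈ B) : τ j ∈ B := by
  have hB' : ∀ i ∈ B, aeval (R.eig i) f = 0 := fun i hi => aeval_apply_eq_zero R.emb (hB i hi)
  have h1 : aeval (R.eig (τ j)) f = 0 :=
    hτ j ▸ aeval_apply_eq_zero (starRingEnd ℂ) (hB' j hj)
  obtain ⟨i, hi, hi'⟩ := exists_mem_eq_of_aeval_eq_zero hf R.eig_injective hB' hcard h1
  rwa [← R.eig_injective hi']

theorem exists_symm_of_factor [Algebra ℚ K] [Normal ℚ K] {f : ℤ[X]} (hf : f.Monic)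
    (hirr : Irreducible (f.map (Int.castRingHom ℚ))) {i j : Fin n}
    (hi : aeval (R.root i) f = 0) (hj : aeval (R.root j) f = 0) :
    ∃ g ∈ R.symmGroup, g i = j := by
  obtain ⟨σ, hσ⟩ := exists_ringEquiv_of_roots hf hirr hi hj
  obtain ⟨g, hg, hg'⟩ := R.exists_mem_symmGroup σ
  exact ⟨g, hg, R.injective ((hg' i).symm.trans hσ)⟩

end Roots

end AnosovModel

/-! ### Three and four generators: graphs -/

namespace AnosovModel.Roots

variable {n m : ℕ} {M : AnosovModel n m} {K : Type*} [Field K] (R : M.Roots K)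

/-- `dim [L, L]` as the number of edges. -/
theorem dim_eq_sum_edge (h : R.SimpleEdges) :
    m = ∑ x ∈ Finset.univ.filter (fun x : Fin n × Fin n => x.2 < x.1), R.edge x.1 x.2 := by
  classical
  refine (R.card_edges (Finset.univ.filter fun x : Fin n × Fin n => x.2 < x.1 ∧ R.Adj x.1 x.2)
    (fun x hx => by simp at hx; exact hx.1) (fun i j hij => by simp [hij]) h).trans ?_
  rw [← Finset.filter_filter, Finset.card_filter]
  refine Finset.sum_congr rfl fun x _ => ?_
  unfold edge
  congr

theorem sum_edge_eq_of_apply {g : Equiv.Perm (Fin n)} (hg : g ∈ R.symmGroup) {i j : Fin n}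
    (hij : g i = j) :
    ∑ k ∈ Finset.univ.erase j, R.edge j k = ∑ k ∈ Finset.univ.erase i, R.edge i k := by
  subst hij
  exact R.sum_edge_eq hg Finset.univ (by simp) i

end AnosovModel.Roots

/-- `L` occurs in the table. -/
def InTable (L : Type*) [LieRing L] [LieAlgebra ℝ L] (n m : ℕ) : Prop :=
  ∃ I : LieIdeal ℝ (FreeNilpotent n 2), AnosovTable n m I ∧
    Nonempty (L ≃ₗ⁅ℝ⁆ (FreeNilpotent n 2 ⧸ I))

variable {L : Type*} [LieRing L] [LieAlgebra ℝ L] {m : ℕ}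

theorem inTable_of_free {n : ℕ} (hL : IsTwoStepOfType L n m) {M : AnosovModel n m}
    (S : Realization M L)
    (hm : (Finset.univ.filter fun p : Fin n × Fin n => p.2 < p.1).card ≤ m)
    (h : AnosovTable n m ⊥) : InTable L n m :=
  ⟨⊥, h, nonempty_equiv_quotient_bot hL _
    (S.generates (Pi.basisFun ℝ (Fin n)) (Pi.basisFun ℝ (Fin n)).span_eq) hm⟩

section Three

theorem inTable_three (hL : IsTwoStepOfType L 3 m) {M : AnosovModel 3 m} (S : Realization M L)
    (K : Type*) [Field K] [Algebra ℚ K] [IsAlgClosure ℚ K] : InTable L 3 m := by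
  have hirr : Irreducible (M.p.map (Int.castRingHom ℚ)) := by
    rcases M.irreducible_or_exists_factor (by norm_num) (by norm_num) with h | h
    · exact h
    · obtain ⟨f, g, hf, hg, hfg, h2⟩ := h
      have h3 := M.natDegree_p
      rw [← hfg, hf.natDegree_mul hg, h2] at h3
      exact absurd (by omega) (M.natDegree_ne_one_of_dvd hf (Dvd.intro _ hfg))
  obtain ⟨R, hR⟩ := M.exists_roots_of_irreducible K hirr
  have hs : R.SimpleEdges := by
    intro i j k l hij hkl hik hil hjk hjl
    omega
  have hdim := R.dim_eq_sum_edge hs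
  obtain ⟨g, hg, hg'⟩ := hR 0 1
  obtain ⟨h, hh, hh'⟩ := hR 0 2
  have h1 := R.sum_edge_eq_of_apply hg hg'
  have h2 := R.sum_edge_eq_of_apply hh hh'
  rw [show (Finset.univ.filter fun x : Fin 3 × Fin 3 => x.2 < x.1) = {(1, 0), (2, 0), (2, 1)} by
    decide] at hdim
  rw [show Finset.univ.erase (0 : Fin 3) = {1, 2} by decide,
    show Finset.univ.erase (1 : Fin 3) = {0, 2} by decide] at h1
  rw [show Finset.univ.erase (0 : Fin 3) = {1, 2} by decide,
    show Finset.univ.erase (2 : Fin 3) = {0, 1} by decide] at h2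
  simp [R.edge_comm 1 0, R.edge_comm 2 0, R.edge_comm 2 1] at hdim h1 h2
  have hpos := M.pos
  have e1 := R.edge_le 0 1
  have e2 := R.edge_le 0 2
  have e3 := R.edge_le 1 2
  obtain rfl : m = 3 := by omega
  exact inTable_of_free hL S (by decide) AnosovTable.free_three

end Three

section Four

theorem sum_fin_four_eq_of_ne (x : Fin 4 → ℝ) {i j k l : Fin 4} (hij : i ≠ j) (hkl : k ≠ l)
    (hik : i ≠ k) (hil : i ≠ l) (hjk : j ≠ k) (hjl : j ≠ l) :
    ∑ t, x t = x i + x j + x k + x l := by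
  have hc : ({i, j, k, l} : Finset (Fin 4)).card = 4 := by
    rw [Finset.card_insert_of_notMem (by simp [hij, hik, hil]),
      Finset.card_insert_of_notMem (by simp [hjk, hjl]), Finset.card_pair hkl]
  rw [← Finset.eq_univ_of_card _ (hc.trans (by simp)),
    Finset.sum_insert (by simp [hij, hik, hil]), Finset.sum_insert (by simp [hjk, hjl]),
    Finset.sum_pair hkl]
  ring

variable {M : AnosovModel 4 m} {K : Type*} [Field K] (R : M.Roots K)

theorem simpleEdges_four : R.SimpleEdges := by
  intro i j k l hij hkl hik hil hjk hjl hadj h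
  have h1 := R.sum_lg
  rw [sum_fin_four_eq_of_ne R.lg hij hkl hik hil hjk hjl] at h1
  have h2 : R.lg i + R.lg j = R.lg k + R.lg l := by rw [R.lg_add, R.lg_add, h]
  exact R.lg_add_ne_zero hadj (by linarith)

theorem span_eq_top_of_blocks_four {u u' : Fin 2 → Fin 4 → ℝ}
    (h : Submodule.span ℝ (Set.range u) ⊔ Submodule.span ℝ (Set.range u') = ⊤)
    (v : Fin 4 → Fin 4 → ℝ)
    (hv : ∀ i, ∃ j, v j = u i) (hv' : ∀ i, ∃ j, v j = u' i) :
    Submodule.span ℝ (Set.range v) = ⊤ := by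
  rw [eq_top_iff, ← h, sup_le_iff, Submodule.span_le, Submodule.span_le]
  constructor
  · rintro _ ⟨i, rfl⟩
    obtain ⟨j, hj⟩ := hv i
    exact Submodule.subset_span ⟨j, hj⟩
  · rintro _ ⟨i, rfl⟩
    obtain ⟨j, hj⟩ := hv' i
    exact Submodule.subset_span ⟨j, hj⟩

/-- Two commuting planes give `𝔥₃ ⊕ 𝔥₃`. -/
theorem inTable_of_commuting_planes (hL : IsTwoStepOfType L 4 m) (S : Realization M L)
    (hm : m = 2) (u u' : Fin 2 → Fin 4 → ℝ)
    (h : Submodule.span ℝ (Set.range u) ⊔ Submodule.span ℝ (Set.range u') = ⊤)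
    (hbil : ∀ i j, M.bil (ofRealVec 4 (u i)) (ofRealVec 4 (u' j)) = 0) : InTable L 4 m := by
  have h1 : ∀ i j, ⁅S.E (u i), S.E (u' j)⁆ = 0 := fun i j => S.lie_eq_zero (hbil i j)
  have h2 : ∀ i j, ⁅S.E (u' j), S.E (u i)⁆ = 0 := fun i j => by
    rw [← lie_skew, h1, neg_zero]
  refine table_cyclic_four hL hm _ (S.generates ![u 0, u' 0, u 1, u' 1]
    (span_eq_top_of_blocks_four h _ ?_ ?_)) ?_
  · intro i; fin_cases i
    exacts [⟨0, rfl⟩, ⟨2, rfl⟩]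
  · intro i; fin_cases i
    exacts [⟨1, rfl⟩, ⟨3, rfl⟩]
  · intro i j hij
    fin_cases i <;> fin_cases j <;> first | exact h1 _ _ | exact h2 _ _ | exact absurd rfl hij

theorem inTable_of_matching (hL : IsTwoStepOfType L 4 m) (S : Realization M L) (hm : m = 2)
    (h01 : R.Adj 0 1) (h02 : ¬R.Adj 0 2) (h03 : ¬R.Adj 0 3)
    (h12 : ¬R.Adj 1 2) (h13 : ¬R.Adj 1 3) : InTable L 4 m := by
  obtain ⟨τ, hτ⟩ := R.exists_conj
  obtain ⟨z⟩ := R.exists_eigenbasis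
  have hc : ∀ a : Fin 4, a = 0 ∨ a = 1 ∨ a = 2 ∨ a = 3 := by decide
  have key : ∀ a b, a ≠ b → R.Adj a b → (a < 2 ∧ b < 2) ∨ R.lg a + R.lg b = R.lg 2 + R.lg 3 := by
    intro a b hab hadj
    rcases hc a with rfl | rfl | rfl | rfl <;> rcases hc b with rfl | rfl | rfl | rfl <;>
      first
      | exact absurd rfl hab
      | exact Or.inl (by decide)
      | exact Or.inr rfl
      | exact Or.inr (add_comm _ _)
      | exact absurd hadj (by assumption)
      | exact absurd (R.adj_symm hadj) (by assumption)
  have hτne : τ 0 ≠ τ 1 := by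
    intro h
    have := congrArg τ h
    rw [R.conj_conj hτ, R.conj_conj hτ] at this
    exact absurd this (by decide)
  have hτB : τ 0 < 2 ∧ τ 1 < 2 := by
    rcases key _ _ hτne (R.adj_conj hτ h01) with h | h
    · exact h
    · rw [R.lg_conj hτ, R.lg_conj hτ] at h
      have h1 := R.sum_lg
      rw [Fin.sum_univ_four] at h1
      exact absurd (by linarith) (R.lg_add_ne_zero h01)
  have hmem : ∀ i : Fin 4, i ∈ ({0, 1} : Finset (Fin 4)) ↔ i < 2 := by decide
  obtain ⟨u, u', hu, hu', hspan⟩ := R.exists_blocks z hτ {0, 1} (t := 2) (t' := 2)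
    (by
      intro i hi
      rw [hmem]
      rcases Finset.mem_insert.1 hi with rfl | hi
      · exact hτB.1
      · rw [Finset.mem_singleton.1 hi]
        exact hτB.2) (by decide) (by decide)
  refine inTable_of_commuting_planes hL S hm u u' hspan fun i j =>
    R.bil_eq_zero_of_mem_blocks z _ _ ?_ (hu i) (hu' j)
  have hcompl : ({0, 1} : Finset (Fin 4))ᶜ = {2, 3} := by decide
  rw [hcompl]
  intro i hi j hj _
  simp only [Finset.mem_insert, Finset.mem_singleton] at hi hj
  rcases hi with rfl | rfl <;> rcases hj with rfl | rfl <;> assumption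

theorem inTable_of_cycle_four (hL : IsTwoStepOfType L 4 m) (S : Realization M L) (hm : m = 4)
    (h01 : ¬R.Adj 0 1) (h23 : ¬R.Adj 2 3) (h02 : R.Adj 0 2) (h03 : R.Adj 0 3)
    (h12 : R.Adj 1 2) (h13 : R.Adj 1 3) : InTable L 4 m := by
  obtain ⟨τ, hτ⟩ := R.exists_conj
  obtain ⟨z⟩ := R.exists_eigenbasis
  have hc : ∀ a : Fin 4, a = 0 ∨ a = 1 ∨ a = 2 ∨ a = 3 := by decide
  have key : ∀ a b, a ≠ b → ¬R.Adj a b →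
      (a < 2 ∧ b < 2) ∨ (a = 2 ∧ b = 3) ∨ (a = 3 ∧ b = 2) := by
    intro a b hab hadj
    rcases hc a with rfl | rfl | rfl | rfl <;> rcases hc b with rfl | rfl | rfl | rfl <;>
      first
      | exact absurd rfl hab
      | decide
      | exact absurd (by assumption) hadj
      | exact absurd (R.adj_symm (by assumption)) hadj
  have hτne : τ 0 ≠ τ 1 := by
    intro h
    have := congrArg τ h
    rw [R.conj_conj hτ, R.conj_conj hτ] at this
    exact absurd this (by decide)
  have hτadj : ¬R.Adj (τ 0) (τ 1) := by
    intro h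
    have := R.adj_conj hτ h
    rw [R.conj_conj hτ, R.conj_conj hτ] at this
    exact h01 this
  have h1 := R.sum_lg
  rw [Fin.sum_univ_four] at h1
  have e0 := R.lg_conj hτ 0
  have e1 := R.lg_conj hτ 1
  have hτB : τ 0 < 2 ∧ τ 1 < 2 := by
    rcases key _ _ hτne hτadj with h | ⟨h, h'⟩ | ⟨h, h'⟩
    · exact h
    · rw [h] at e0
      rw [h'] at e1
      exact absurd (by linarith) (R.lg_add_ne_zero h12)
    · rw [h] at e0
      rw [h'] at e1
      exact absurd (by linarith) (R.lg_add_ne_zero h13)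
  have hmem : ∀ i : Fin 4, i ∈ ({0, 1} : Finset (Fin 4)) ↔ i < 2 := by decide
  obtain ⟨u, u', hu, hu', hspan⟩ := R.exists_blocks z hτ {0, 1} (t := 2) (t' := 2)
    (by
      intro i hi
      rw [hmem]
      rcases Finset.mem_insert.1 hi with rfl | hi
      · exact hτB.1
      · rw [Finset.mem_singleton.1 hi]
        exact hτB.2) (by decide) (by decide)
  have hcompl : ({0, 1} : Finset (Fin 4))ᶜ = {2, 3} := by decide
  have b1 : ∀ i j, ⁅S.E (u i), S.E (u j)⁆ = 0 := fun i j => S.lie_eq_zero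
    (R.bil_eq_zero_of_mem_blocks z _ _ (by
      intro i hi j hj hij
      simp only [Finset.mem_insert, Finset.mem_singleton] at hi hj
      rcases hi with rfl | rfl <;> rcases hj with rfl | rfl <;>
        first | exact absurd rfl hij | assumption | exact fun h => h01 (R.adj_symm h))
      (hu i) (hu j))
  have b2 : ∀ i j, ⁅S.E (u' i), S.E (u' j)⁆ = 0 := fun i j => S.lie_eq_zero
    (R.bil_eq_zero_of_mem_blocks z _ _ (by
      rw [hcompl]
      intro i hi j hj hij
      simp only [Finset.mem_insert, Finset.mem_singleton] at hi hj
      rcases hi with rfl | rfl <;> rcases hj with rfl | rfl <;>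
        first | exact absurd rfl hij | assumption | exact fun h => h23 (R.adj_symm h))
      (hu' i) (hu' j))
  refine table_klein hL hm _ (S.generates ![u 0, u 1, u' 0, u' 1]
    (span_eq_top_of_blocks_four hspan _ ?_ ?_)) ?_
  · intro i; fin_cases i
    exacts [⟨0, rfl⟩, ⟨1, rfl⟩]
  · intro i; fin_cases i
    exacts [⟨2, rfl⟩, ⟨3, rfl⟩]
  · intro i j hij
    fin_cases i <;> fin_cases j <;>
      first | exact b1 _ _ | exact b2 _ _ | exact absurd hij (by decide)

/-- A graph on four vertices in which opposite edges occur together is complete, a four-cycle or a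
perfect matching. -/
theorem inTable_of_opposite_edges (hL : IsTwoStepOfType L 4 m) (S : Realization M L)
    (h1 : R.Adj 0 1 ↔ R.Adj 2 3) (h2 : R.Adj 0 2 ↔ R.Adj 1 3) (h3 : R.Adj 0 3 ↔ R.Adj 1 2) :
    InTable L 4 m := by
  have hdim := R.dim_eq_sum_edge (simpleEdges_four R)
  rw [show (Finset.univ.filter fun x : Fin 4 × Fin 4 => x.2 < x.1) =
    {(1, 0), (2, 0), (3, 0), (2, 1), (3, 1), (3, 2)} by decide] at hdim
  simp [R.edge_comm 1 0, R.edge_comm 2 0, R.edge_comm 3 0, R.edge_comm 2 1, R.edge_comm 3 1,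
    R.edge_comm 3 2] at hdim
  simp only [AnosovModel.Roots.edge] at hdim
  have hsw : ∀ {i j}, R.Adj i j → R.Adj j i := fun h => R.adj_symm h
  by_cases a1 : R.Adj 0 1 <;> by_cases a2 : R.Adj 0 2 <;> by_cases a3 : R.Adj 0 3 <;>
    simp only [a1, a2, a3, if_true, if_false] at hdim <;>
    simp only [a1, a2, a3, true_iff, false_iff] at h1 h2 h3 <;>
    simp only [h1, h2, h3, if_true, if_false] at hdim
  · obtain rfl : m = 6 := by omega
    exact inTable_of_free hL S (by decide) AnosovTable.free_four
  · exact inTable_of_cycle_four (R.relabel (Equiv.swap 1 3)) hL S (by omega) a3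
      (fun h => h3 (hsw h)) a2 a1 (hsw h1) (hsw h2)
  · exact inTable_of_cycle_four (R.relabel (Equiv.swap 1 2)) hL S (by omega) a2 h2 a1 a3
      (hsw h3) h1
  · exact inTable_of_matching R hL S (by omega) a1 a2 a3 h3 h2
  · exact inTable_of_cycle_four R hL S (by omega) a1 h1 a2 a3 h3 h2
  · exact inTable_of_matching (R.relabel (Equiv.swap 1 2)) hL S (by omega) a2 a1 a3
      (fun h => h3 (hsw h)) h1
  · exact inTable_of_matching (R.relabel (Equiv.swap 1 3)) hL S (by omega) a3 a2 a1
      (fun h => h1 (hsw h)) (fun h => h2 (hsw h))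
  · have := M.pos
    omega

end Four

/-! ### Four generators: factorizations of `p` -/

namespace AnosovModel

/-- `D` has no eigenvalues of modulus one, so `[L, L]` is not a line. -/
theorem dim_ne_one {n : ℕ} (M : AnosovModel n m) : m ≠ 1 := by
  intro h
  have h1 : M.q.natDegree = 1 := M.natDegree_q.trans h
  have h2 := M.q_monic.eq_X_add_C h1
  have hroot : aeval (-(M.q.coeff 0 : ℂ)) M.q = 0 := by
    conv_lhs => rw [h2]
    simp
  refine M.norm_q _ hroot ?_
  rcases Int.isUnit_iff.1 M.unit_q with h | h <;> simp [h]

theorem bil_eq_zero_of_mulVec {n : ℕ} (M : AnosovModel n m) {a b : ℂ} {x x₀ y y₀ : Fin n → ℂ}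
    (hab : aeval (a * b) M.q ≠ 0) (hx : M.AC.mulVec x = a • x + x₀)
    (hy : M.AC.mulVec y = b • y + y₀) (h₁ : M.bil x₀ y = 0) (h₂ : M.bil x y₀ = 0)
    (h₃ : M.bil x₀ y₀ = 0) : M.bil x y = 0 := by
  by_contra h0
  refine hab (M.aeval_q_eq_zero h0 ?_)
  rw [← bil_mulVec, hx, hy]
  simp only [map_add, map_smul, LinearMap.add_apply, LinearMap.smul_apply, h₁, h₂, h₃, smul_zero,
    add_zero, smul_smul]
  rw [mul_comm]

/-- Generalized eigenspaces of rank two for eigenvalues `a`, `b` commute if `a b` is not an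
eigenvalue of `D`. -/
theorem bil_eq_zero_of_genEigenspace {n : ℕ} (M : AnosovModel n m) {a b : ℂ}
    (hab : aeval (a * b) M.q ≠ 0) {x y : Fin n → ℂ}
    (hx : x ∈ Module.End.genEigenspace M.AC.mulVecLin a 2)
    (hy : y ∈ Module.End.genEigenspace M.AC.mulVecLin b 2) : M.bil x y = 0 := by
  have key : ∀ {c : ℂ} {w : Fin n → ℂ}, w ∈ Module.End.genEigenspace M.AC.mulVecLin c 2 →
      ∃ w₀, M.AC.mulVec w = c • w + w₀ ∧ M.AC.mulVec w₀ = c • w₀ + 0 := by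
    intro c w hw
    have h1 := (Module.End.mem_genEigenspace_nat (k := 2)).1 hw
    rw [LinearMap.mem_ker, pow_two, Module.End.mul_apply] at h1
    refine ⟨M.AC.mulVec w - c • w, by abel, ?_⟩
    simp only [LinearMap.sub_apply, Matrix.mulVecLin_apply, LinearMap.smul_apply,
      Module.End.one_apply] at h1
    rw [add_zero]
    exact sub_eq_zero.1 h1
  obtain ⟨x₀, hx₁, hx₂⟩ := key hx
  obtain ⟨y₀, hy₁, hy₂⟩ := key hy
  have h00 : M.bil x₀ y₀ = 0 :=
    M.bil_eq_zero_of_mulVec hab hx₂ hy₂ (by simp) (by simp) (by simp)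
  have h01 : M.bil x₀ y = 0 := M.bil_eq_zero_of_mulVec hab hx₂ hy₁ (by simp) h00 (by simp)
  have h10 : M.bil x y₀ = 0 := M.bil_eq_zero_of_mulVec hab hx₁ hy₂ h00 (by simp) (by simp)
  exact M.bil_eq_zero_of_mulVec hab hx₁ hy₁ h01 h10 h00

end AnosovModel

/-- If `p` is the square of a quadratic polynomial, the roots of the latter are real and their
product `±1` is not an eigenvalue of `D`. -/
theorem AnosovModel.exists_roots_of_sq {n : ℕ} (M : AnosovModel n m) {g : ℤ[X]} (hg : g.Monic)
    (hirr : Irreducible (g.map (Int.castRingHom ℚ))) (h2 : g.natDegree = 2) (hp : g * g = M.p) :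
    ∃ α : Fin 2 → ℂ, α 0 ≠ α 1 ∧ (∀ i, aeval (α i) g = 0) ∧ (∀ i, star (α i) = α i) ∧
      aeval (α 0 * α 1) M.q ≠ 0 := by
  obtain ⟨α, hα, hα'⟩ := exists_roots (K := ℂ) hg hirr (IsAlgClosed.splits _) h2
  have hroot : ∀ i, aeval (α i) M.p = 0 := by
    intro i
    rw [← hp, map_mul, hα', mul_zero]
  have hpos : ∀ i, 0 < ‖α i‖ := by
    intro i
    rw [norm_pos_iff]
    intro h
    have h1 := hroot i
    rw [h, aeval_def, eval₂_at_zero] at h1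
    have := M.unit_p.ne_zero
    simp [this] at h1
  have hlog : ∀ i, Real.log ‖α i‖ ≠ 0 := fun i =>
    Real.log_ne_zero_of_pos_of_ne_one (hpos i) (M.norm_p _ (hroot i))
  have hsum := sum_log_norm_roots_eq_zero hg (M.isUnit_coeff_zero_of_dvd (Dvd.intro _ hp)) α hα
    Finset.univ (fun i _ => hα' i) (by simp [h2])
  rw [Fin.sum_univ_two] at hsum
  have hab : aeval (α 0 * α 1) M.q ≠ 0 := by
    intro h
    refine M.norm_q _ h ?_
    rw [norm_mul]
    refine Real.eq_one_of_pos_of_log_eq_zero (mul_pos (hpos 0) (hpos 1)) ?_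
    rw [Real.log_mul (hpos 0).ne' (hpos 1).ne', hsum]
  have hstar : ∀ i, star (α i) = α i := by
    intro i
    have h1 : aeval (star (α i)) g = 0 := aeval_apply_eq_zero (starRingEnd ℂ) (hα' i)
    obtain ⟨j, -, hj⟩ := exists_mem_eq_of_aeval_eq_zero hg hα (B := Finset.univ)
      (fun i _ => hα' i) (by simp [h2]) h1
    by_cases hij : j = i
    · rw [← hj, hij]
    · have hn : ‖α j‖ = ‖α i‖ := by rw [hj, norm_star]
      have h3 : Real.log ‖α i‖ + Real.log ‖α j‖ = 0 := by
        fin_cases i <;> fin_cases j <;> simp_all [add_comm]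
      rw [hn] at h3
      exact absurd (by linarith) (hlog i)
  exact ⟨α, hα.ne (by decide), hα', hstar, hab⟩

theorem map_eq_mul_of_roots {g : ℤ[X]} (hg : g.Monic) (h2 : g.natDegree = 2) {a b : ℂ}
    (hab : a ≠ b) (ha : aeval a g = 0) (hb : aeval b g = 0) :
    g.map (Int.castRingHom ℂ) = (X - C a) * (X - C b) := by
  have hd : ∀ c : ℂ, aeval c g = 0 → X - C c ∣ g.map (Int.castRingHom ℂ) := by
    intro c hc
    rw [dvd_iff_isRoot, IsRoot, eval_map]
    rw [aeval_def] at hc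
    simpa using hc
  refine eq_of_monic_of_dvd_of_natDegree_le ((monic_X_sub_C _).mul (monic_X_sub_C _))
    (hg.map _) (IsCoprime.mul_dvd (isCoprime_X_sub_C_of_isUnit_sub
      (sub_ne_zero.2 hab).isUnit) (hd _ ha) (hd _ hb)) ?_
  rw [hg.natDegree_map, h2, (monic_X_sub_C _).natDegree_mul (monic_X_sub_C _)]
  simp

section GenEigenspace

variable {V : Type*} [AddCommGroup V] [Module ℂ V] {F : Module.End ℂ V} {a b : ℂ}

theorem genEigenspace_two_eq_ker :
    Module.End.genEigenspace F a 2 = LinearMap.ker (aeval F ((X - C a) ^ 2)) := by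
  ext x
  rw [show (2 : ℕ∞) = ((2 : ℕ) : ℕ∞) from rfl, Module.End.mem_genEigenspace_nat]
  simp [Algebra.algebraMap_eq_smul_one]

theorem genEigenspace_sup_eq_top [Module.Finite ℂ V] (hab : a ≠ b)
    (h : F.charpoly = (X - C a) ^ 2 * (X - C b) ^ 2) :
    Module.End.genEigenspace F a 2 ⊔ Module.End.genEigenspace F b 2 = ⊤ := by
  rw [genEigenspace_two_eq_ker, genEigenspace_two_eq_ker,
    sup_ker_aeval_eq_ker_aeval_mul_of_coprime, ← h, LinearMap.aeval_self_charpoly,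
    LinearMap.ker_zero]
  exact (isCoprime_X_sub_C_of_isUnit_sub (sub_ne_zero.2 hab).isUnit).pow

theorem finrank_genEigenspace_le_two [Module.Finite ℂ V] (hab : a ≠ b)
    (h : F.charpoly = (X - C a) ^ 2 * (X - C b) ^ 2) :
    Module.finrank ℂ (Module.End.genEigenspace F a 2) ≤ 2 := by
  refine (LinearMap.finrank_genEigenspace_le _ _ _).trans ?_
  rw [h, rootMultiplicity_mul (mul_ne_zero (pow_ne_zero _ (X_sub_C_ne_zero _))
    (pow_ne_zero _ (X_sub_C_ne_zero _))), rootMultiplicity_X_sub_C_pow,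
    rootMultiplicity_eq_zero]
  simp [IsRoot, sub_eq_zero, hab]

end GenEigenspace

theorem AnosovModel.star_mem_genEigenspace {n : ℕ} (M : AnosovModel n m) {a : ℂ}
    (ha : star a = a) {w : Fin n → ℂ} (hw : w ∈ Module.End.genEigenspace M.AC.mulVecLin a 2) :
    star w ∈ Module.End.genEigenspace M.AC.mulVecLin a 2 := by
  rw [show (2 : ℕ∞) = ((2 : ℕ) : ℕ∞) from rfl, Module.End.mem_genEigenspace_nat,
    LinearMap.mem_ker, pow_two, Module.End.mul_apply] at hw ⊢
  have h1 : ∀ v : Fin n → ℂ, (M.AC.mulVecLin - a • (1 : Module.End ℂ (Fin n → ℂ))) (star v) =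
      star ((M.AC.mulVecLin - a • (1 : Module.End ℂ (Fin n → ℂ))) v) := by
    intro v
    simp only [LinearMap.sub_apply, Matrix.mulVecLin_apply, LinearMap.smul_apply,
      Module.End.one_apply, M.AC_mulVec_star, star_sub, star_smul, ha]
  rw [h1, h1, hw, star_zero]

theorem mem_span_pair_of_skew {V : Type*} [AddCommGroup V] [Module ℂ V] (f : Fin 4 → Fin 4 → V)
    (hskew : ∀ i j, f i j = -f j i) (hself : ∀ i, f i i = 0) (h02 : f 0 2 = 0) (h03 : f 0 3 = 0)
    (h12 : f 1 2 = 0) (h13 : f 1 3 = 0) (i j : Fin 4) :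
    f i j ∈ Submodule.span ℂ {f 0 1, f 2 3} := by
  have key : ∀ i j, i < j → f i j ∈ Submodule.span ℂ {f 0 1, f 2 3} := by
    intro i j hij
    have hc : ∀ i j : Fin 4, i < j → (i = 0 ∧ j = 1) ∨ (i = 2 ∧ j = 3) ∨ (i = 0 ∧ j = 2) ∨
      (i = 0 ∧ j = 3) ∨ (i = 1 ∧ j = 2) ∨ (i = 1 ∧ j = 3) := by decide
    rcases hc i j hij with ⟨rfl, rfl⟩ | ⟨rfl, rfl⟩ | ⟨rfl, rfl⟩ | ⟨rfl, rfl⟩ | ⟨rfl, rfl⟩ |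
      ⟨rfl, rfl⟩
    · exact Submodule.subset_span (Set.mem_insert _ _)
    · exact Submodule.subset_span (Set.mem_insert_of_mem _ rfl)
    · rw [h02]; exact zero_mem _
    · rw [h03]; exact zero_mem _
    · rw [h12]; exact zero_mem _
    · rw [h13]; exact zero_mem _
  rcases lt_trichotomy i j with h | h | h
  · exact key i j h
  · rw [h, hself]; exact zero_mem _
  · exact hskew i j ▸ neg_mem (key j i h)

/-- If `L` is the sum of two commuting planes, then `dim [L, L] ≤ 2`. -/
theorem dim_le_two_of_commuting_planes (M : AnosovModel 4 m) {u u' : Fin 2 → Fin 4 → ℝ}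
    (hspan : Submodule.span ℝ (Set.range u) ⊔ Submodule.span ℝ (Set.range u') = ⊤)
    (hbil : ∀ i j, M.bil (ofRealVec 4 (u i)) (ofRealVec 4 (u' j)) = 0) : m ≤ 2 := by
  classical
  have h3 : Submodule.span ℝ (Set.range ![u 0, u 1, u' 0, u' 1]) = ⊤ := by
    refine span_eq_top_of_blocks_four hspan _ ?_ ?_
    · intro i; fin_cases i
      exacts [⟨0, rfl⟩, ⟨1, rfl⟩]
    · intro i; fin_cases i
      exacts [⟨2, rfl⟩, ⟨3, rfl⟩]
  have h4 := M.span_bil _ (span_ofRealVec_eq_top h3)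
  have h5 := mem_span_pair_of_skew (fun i j => M.bil (ofRealVec 4 (![u 0, u 1, u' 0, u' 1] i))
    (ofRealVec 4 (![u 0, u 1, u' 0, u' 1] j))) (fun _ _ => M.bil_skew _ _)
    (fun _ => M.bil_self _) (hbil 0 0) (hbil 0 1) (hbil 1 0) (hbil 1 1)
  have h6 := finrank_span_finset_le_card (R := ℂ)
    {M.bil (ofRealVec 4 (u 0)) (ofRealVec 4 (u 1)), M.bil (ofRealVec 4 (u' 0)) (ofRealVec 4 (u' 1))}
  have h7 : Submodule.span ℂ {M.bil (ofRealVec 4 (u 0)) (ofRealVec 4 (u 1)),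
      M.bil (ofRealVec 4 (u' 0)) (ofRealVec 4 (u' 1))} = ⊤ := by
    rw [eq_top_iff, ← h4, Submodule.span_le]
    rintro _ ⟨⟨i, j⟩, rfl⟩
    exact h5 i j
  rw [Finset.coe_pair, Set.finrank, h7, finrank_top, Module.finrank_fin_fun] at h6
  exact h6.trans Finset.card_le_two

/-- If `p` is the square of a quadratic polynomial, the two generalized eigenspaces commute. -/
theorem inTable_four_of_sq (hL : IsTwoStepOfType L 4 m) {M : AnosovModel 4 m}
    (S : Realization M L) {g : ℤ[X]} (hg : g.Monic)
    (hirr : Irreducible (g.map (Int.castRingHom ℚ))) (h2 : g.natDegree = 2) (hp : g * g = M.p) :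
    InTable L 4 m := by
  obtain ⟨α, hne, hα, hstar, hab⟩ := M.exists_roots_of_sq hg hirr h2 hp
  have hchar : M.AC.mulVecLin.charpoly = (X - C (α 0)) ^ 2 * (X - C (α 1)) ^ 2 := by
    have : M.AC.mulVecLin.charpoly = M.AC.charpoly := by
      rw [← Matrix.toLin'_apply', Matrix.charpoly_toLin']
    rw [this, M.charpoly_AC, ← hp, Polynomial.map_mul, map_eq_mul_of_roots hg h2 hne (hα 0) (hα 1)]
    ring
  obtain ⟨u, u', hu, hu', hspan⟩ := exists_real_blocks _ _
    (fun _ => M.star_mem_genEigenspace (hstar 0)) (fun _ => M.star_mem_genEigenspace (hstar 1))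
    (genEigenspace_sup_eq_top hne hchar) (finrank_genEigenspace_le_two hne hchar)
    (finrank_genEigenspace_le_two hne.symm (hchar.trans (mul_comm _ _)))
  have hbil : ∀ i j, M.bil (ofRealVec 4 (u i)) (ofRealVec 4 (u' j)) = 0 := fun i j =>
    M.bil_eq_zero_of_genEigenspace hab (hu i) (hu' j)
  have hm := dim_le_two_of_commuting_planes M hspan hbil
  have h1 := M.dim_ne_one
  have h0 := M.pos
  exact inTable_of_commuting_planes hL S (by omega) u u' hspan hbil

theorem adj_iff_of_edge_eq {n : ℕ} {M : AnosovModel n m} {K : Type*} [Field K] (R : M.Roots K)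
    {i j k l : Fin n} (h : R.edge i j = R.edge k l) : R.Adj i j ↔ R.Adj k l := by
  rw [← R.edge_eq_one_iff, ← R.edge_eq_one_iff, h]

/-- In a transitive graph on four vertices all degrees agree, and for a product of two quadratic
factors the graph is bipartite with equal degrees on each side. Either way opposite edges occur
together. -/
theorem inTable_four (hL : IsTwoStepOfType L 4 m) {M : AnosovModel 4 m} (S : Realization M L)
    (K : Type*) [Field K] [Algebra ℚ K] [IsAlgClosure ℚ K] : InTable L 4 m := by
  have : Normal ℚ K := IsAlgClosure.normal ℚ K
  rcases M.irreducible_or_exists_factor (by norm_num) (by norm_num) with h | h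
  · obtain ⟨R, hR⟩ := M.exists_roots_of_irreducible K h
    obtain ⟨g₁, hg₁, hg₁'⟩ := hR 0 1
    obtain ⟨g₂, hg₂, hg₂'⟩ := hR 0 2
    obtain ⟨g₃, hg₃, hg₃'⟩ := hR 0 3
    have h1 := R.sum_edge_eq_of_apply hg₁ hg₁'
    have h2 := R.sum_edge_eq_of_apply hg₂ hg₂'
    have h3 := R.sum_edge_eq_of_apply hg₃ hg₃'
    rw [show Finset.univ.erase (0 : Fin 4) = {1, 2, 3} by decide] at h1 h2 h3
    rw [show Finset.univ.erase (1 : Fin 4) = {0, 2, 3} by decide] at h1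
    rw [show Finset.univ.erase (2 : Fin 4) = {0, 1, 3} by decide] at h2
    rw [show Finset.univ.erase (3 : Fin 4) = {0, 1, 2} by decide] at h3
    simp [R.edge_comm 1 0, R.edge_comm 2 0, R.edge_comm 2 1, R.edge_comm 3 0, R.edge_comm 3 1,
      R.edge_comm 3 2] at h1 h2 h3
    exact inTable_of_opposite_edges R hL S (adj_iff_of_edge_eq R (by omega))
      (adj_iff_of_edge_eq R (by omega)) (adj_iff_of_edge_eq R (by omega))
  · obtain ⟨f, g, hf, hg, hfg, hg2⟩ := h
    have hf2 : f.natDegree = 2 := by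
      have := M.natDegree_p
      rw [← hfg, hf.natDegree_mul hg, hg2] at this
      omega
    have hfd : f ∣ M.p := Dvd.intro _ hfg
    have hgd : g ∣ M.p := Dvd.intro_left _ hfg
    have hirrf := M.irreducible_of_dvd hf hfd hf2.ge (by omega)
    have hirrg := M.irreducible_of_dvd hg hgd hg2.ge (by omega)
    by_cases hne : f = g
    · subst hne
      exact inTable_four_of_sq hL S hg hirrg hg2 hfg
    obtain ⟨R, hRg, hRf⟩ := AnosovModel.exists_roots_of_mul K (k := 2) (l := 2) M hf hg hirrf
      hirrg hne hfg hg2 hf2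
    have hB : ∀ i ∈ ({0, 1} : Finset (Fin 4)), aeval (R.root i) g = 0 := by
      intro i hi
      rcases Finset.mem_insert.1 hi with rfl | hi
      · exact hRg 0
      · rw [Finset.mem_singleton.1 hi]; exact hRg 1
    have hC : ∀ i ∈ ({2, 3} : Finset (Fin 4)), aeval (R.root i) f = 0 := by
      intro i hi
      rcases Finset.mem_insert.1 hi with rfl | hi
      · exact hRf 0
      · rw [Finset.mem_singleton.1 hi]; exact hRf 1
    have h01 : ¬R.Adj 0 1 := by
      intro h
      refine R.lg_add_ne_zero h ?_
      have := R.sum_lg_factor hg (M.isUnit_coeff_zero_of_dvd hgd) _ hB (by rw [hg2]; decide)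
      rwa [Finset.sum_pair (by decide)] at this
    have h23 : ¬R.Adj 2 3 := by
      intro h
      refine R.lg_add_ne_zero h ?_
      have := R.sum_lg_factor hf (M.isUnit_coeff_zero_of_dvd hfd) _ hC (by rw [hf2]; decide)
      rwa [Finset.sum_pair (by decide)] at this
    obtain ⟨g₁, hg₁, hg₁'⟩ := R.exists_symm_of_factor hg hirrg (hB 0 (by decide))
      (hB 1 (by decide))
    obtain ⟨g₂, hg₂, hg₂'⟩ := R.exists_symm_of_factor hf hirrf (hC 2 (by decide))
      (hC 3 (by decide))
    have h1 := R.sum_edge_eq hg₁ _ (R.mem_iff_of_factor hf hC (by rw [hf2]; decide) hg₁) 0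
    have h2 := R.sum_edge_eq hg₂ _ (R.mem_iff_of_factor hg hB (by rw [hg2]; decide) hg₂) 2
    rw [hg₁', show ({2, 3} : Finset (Fin 4)).erase 1 = {2, 3} by decide,
      show ({2, 3} : Finset (Fin 4)).erase 0 = {2, 3} by decide] at h1
    rw [hg₂', show ({0, 1} : Finset (Fin 4)).erase 3 = {0, 1} by decide,
      show ({0, 1} : Finset (Fin 4)).erase 2 = {0, 1} by decide] at h2
    simp [R.edge_comm 2 0, R.edge_comm 2 1, R.edge_comm 3 0, R.edge_comm 3 1] at h1 h2
    exact inTable_of_opposite_edges R hL S (iff_of_false h01 h23)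
      (adj_iff_of_edge_eq R (by omega)) (adj_iff_of_edge_eq R (by omega))

/-! ### Five generators: irreducible `p` -/

section CyclicSymmetry

/-- The matrix of this system of linear equations is congruent to the identity modulo two, so its
determinant is odd. -/
theorem eq_zero_of_forall_add_eq_zero {n : ℕ} (x : Fin n → ℝ) (a b : Fin n → Fin n)
    (h : ∀ t, x t + 2 * x (a t) + 2 * x (b t) = 0) : x = 0 := by
  let A : Matrix (Fin n) (Fin n) ℤ := 1 + (2 : ℤ) • Matrix.of fun t s =>
    (if s = a t then 1 else 0) + (if s = b t then 1 else 0)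
  have hdet : A.det ≠ 0 := by
    intro h0
    have h1 : A.map (Int.castRingHom (ZMod 2)) = 1 := by
      ext t s
      simp only [A, Matrix.map_apply, Matrix.add_apply, Matrix.smul_apply, Matrix.of_apply,
        Matrix.one_apply]
      split_ifs <;> rfl
    have h2 := (Int.castRingHom (ZMod 2)).map_det A
    rw [RingHom.mapMatrix_apply, h1, h0, Matrix.det_one, map_zero] at h2
    exact zero_ne_one h2
  refine Matrix.eq_zero_of_mulVec_eq_zero (M := A.map (Int.castRingHom ℝ)) ?_ ?_
  · rw [← RingHom.mapMatrix_apply, ← RingHom.map_det]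
    simpa using hdet
  · ext t
    rw [Pi.zero_apply, ← h t]
    have e : ∀ s, A.map (Int.castRingHom ℝ) t s * x s = (if t = s then x s else 0) +
        ((if s = a t then 2 * x s else 0) + (if s = b t then 2 * x s else 0)) := by
      intro s
      simp only [A, Matrix.map_apply, Matrix.add_apply, Matrix.smul_apply, Matrix.of_apply,
        Matrix.one_apply]
      split_ifs <;> simp <;> ring
    simp only [Matrix.mulVec, dotProduct, e, Finset.sum_add_distrib]
    simp [add_assoc]

/-- By Cauchy's theorem a transitive group of permutations of five points contains a five-cycle,
and the points may be numbered along it. -/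
theorem exists_equiv_shift (G : Subgroup (Equiv.Perm (Fin 5)))
    (hG : ∀ i j, ∃ g ∈ G, g i = j) :
    ∃ g ∈ G, ∃ s : Equiv.Perm (Fin 5), ∀ i, g (s i) = s (i + 1) := by
  classical
  have : MulAction.IsPretransitive G (Fin 5) := ⟨fun i j => by
    obtain ⟨g, hg, h⟩ := hG i j
    exact ⟨⟨g, hg⟩, h⟩⟩
  have hdvd : 5 ∣ Nat.card G := by
    have := (MulAction.stabilizer G (0 : Fin 5)).index_dvd_card
    rwa [MulAction.index_stabilizer_of_transitive, Nat.card_fin] at this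
  have : Fact (Nat.Prime 5) := ⟨by norm_num⟩
  obtain ⟨⟨g, hg⟩, hord⟩ := exists_prime_orderOf_dvd_card' 5 hdvd
  rw [Subgroup.orderOf_mk] at hord
  have hcyc : g.IsCycle := Equiv.Perm.isCycle_of_prime_order' (by rw [hord]; norm_num)
    (by rw [hord]; simp)
  have hsupp : g.support = Finset.univ := by
    rw [← Finset.card_eq_iff_eq_univ, ← hcyc.orderOf, hord]
    simp
  have h0 : g 0 ≠ 0 := by
    rw [← Equiv.Perm.mem_support, hsupp]
    exact Finset.mem_univ _
  have hinj : Function.Injective fun k : Fin 5 => (g ^ (k : ℕ)) 0 := by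
    have key : ∀ i j : Fin 5, i < j → (g ^ (i : ℕ)) 0 ≠ (g ^ (j : ℕ)) 0 := by
      intro i j hij h
      have h1 : (g ^ ((j : ℕ) - i)) 0 = 0 := by
        apply (g ^ (i : ℕ)).injective
        rw [← Equiv.Perm.mul_apply, ← pow_add, h]
        congr 2
        omega
      have h2 := orderOf_dvd_of_pow_eq_one ((hcyc.pow_eq_one_iff' h0).2 h1)
      rw [hord] at h2
      omega
    intro i j h
    rcases lt_trichotomy i j with h1 | h1 | h1
    · exact absurd h (key i j h1)
    · exact h1
    · exact absurd h.symm (key j i h1)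
  refine ⟨g, hg, Equiv.ofBijective _ (Finite.injective_iff_bijective.1 hinj), fun i => ?_⟩
  simp only [Equiv.ofBijective_apply]
  rw [← Equiv.Perm.mul_apply, ← pow_succ']
  by_cases hi : i = 4
  · subst hi
    change (g ^ 5) 0 = (g ^ 0) 0
    have h5 := pow_orderOf_eq_one g
    rw [hord] at h5
    rw [h5, pow_zero]
  · congr 2
    revert i
    decide

variable {M : AnosovModel 5 m} {K : Type*} [Field K]

/-- The rotation `i ↦ i + 1` is induced by a field automorphism. -/
def IsCyclic (R : M.Roots K) : Prop := R.IsSymm fun i => i + 1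

namespace IsCyclic

variable {R : M.Roots K}

theorem of_symm {g : Equiv.Perm (Fin 5)} (hg : g ∈ R.symmGroup) {s : Equiv.Perm (Fin 5)}
    (hs : ∀ i, g (s i) = s (i + 1)) : IsCyclic (R.relabel s) := by
  obtain ⟨σ, hσ⟩ := hg
  refine ⟨σ, fun i => ?_⟩
  change σ (R.root (s i)) = R.root (s (i + 1))
  rw [hσ, hs]

theorem isSymm_add (hR : IsCyclic R) (t : Fin 5) : R.IsSymm fun i => i + t := by
  have key : ∀ k : ℕ, R.IsSymm fun i => i + Fin.ofNat 5 k := by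
    intro k
    induction k with
    | zero => exact ⟨RingEquiv.refl K, fun i => congrArg R.root (add_zero i).symm⟩
    | succ k ih =>
      obtain ⟨σ, hσ⟩ := ih
      obtain ⟨σ', hσ'⟩ := hR
      refine ⟨σ.trans σ', fun i => ?_⟩
      rw [RingEquiv.trans_apply, hσ, hσ']
      change R.root (i + Fin.ofNat 5 k + 1) = R.root (i + Fin.ofNat 5 (k + 1))
      rw [add_assoc]
      congr 2
      ext
      simp [Fin.val_add]
  have := key t
  rwa [Fin.ofNat_val_eq_self] at this

theorem adj_add (hR : IsCyclic R) (i j t : Fin 5) : R.Adj (i + t) (j + t) ↔ R.Adj i j :=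
  R.isSymm_adj (hR.isSymm_add t)

/-- The translates of a relation `x i + x j = x k + x l` and `∑ x = 0` give, for the fifth index
`e`, the relations `x (e + t) + 2 x (i + t) + 2 x (j + t) = 0`. -/
theorem simpleEdges (hR : IsCyclic R) : R.SimpleEdges := by
  intro i j k l hij hkl hik hil hjk hjl _ h
  obtain ⟨e, hne, he⟩ : ∃ e, e ∉ ({i, j, k, l} : Finset (Fin 5)) ∧
      ({i, j, k, l} : Finset (Fin 5)).card = 4 := by
    have hc : ({i, j, k, l} : Finset (Fin 5)).card = 4 := by
      rw [Finset.card_insert_of_notMem (by simp [hij, hik, hil]),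
        Finset.card_insert_of_notMem (by simp [hjk, hjl]), Finset.card_pair hkl]
    by_contra! hcon
    have := Finset.eq_univ_iff_forall.2 fun e => by_contra fun he => hcon e he hc
    rw [this] at hc
    simp at hc
  have hu : insert e ({i, j, k, l} : Finset (Fin 5)) = Finset.univ := by
    rw [← Finset.card_eq_iff_eq_univ, Finset.card_insert_of_notMem hne, he]
    rfl
  have hsum : ∀ t, R.lg (e + t) + 2 * R.lg (i + t) + 2 * R.lg (j + t) = 0 := by
    intro t
    have h1 : ∑ a, R.lg (a + t) = 0 := by
      rw [← R.sum_lg]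
      exact Equiv.sum_comp (Equiv.addRight t) R.lg
    have h2 := R.isSymm_lg (hR.isSymm_add t) h
    rw [← hu, Finset.sum_insert hne, Finset.sum_insert (by simp [hij, hik, hil]),
      Finset.sum_insert (by simp [hjk, hjl]), Finset.sum_pair hkl] at h1
    linarith
  have h0 := eq_zero_of_forall_add_eq_zero R.lg (fun t => i + (t - e)) (fun t => j + (t - e))
    (fun t => by simpa using hsum (t - e))
  exact R.lg_ne_zero 0 (congrFun h0 0)

theorem relabel_two_mul (hR : IsCyclic R) {s : Equiv.Perm (Fin 5)} (hs : ∀ i, s i = 2 * i) :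
    IsCyclic (R.relabel s) := by
  obtain ⟨σ, hσ⟩ := hR.isSymm_add 2
  refine ⟨σ, fun i => (hσ (s i)).trans (congrArg R.root ?_)⟩
  rw [hs, hs, mul_add, mul_one]

end IsCyclic

end CyclicSymmetry

section RealEigenvectors

theorem span_eq_top_of_span_ofRealVec {n : ℕ} {u : Fin n → Fin n → ℝ}
    (h : Submodule.span ℂ (Set.range fun i => ofRealVec n (u i)) = ⊤) :
    Submodule.span ℝ (Set.range u) = ⊤ := by
  have h1 : LinearIndependent ℂ fun i => ofRealVec n (u i) :=
    linearIndependent_of_top_le_span_of_card_eq_finrank h.ge (by simp)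
  have h2 : LinearIndependent ℝ u :=
    LinearIndependent.of_comp (ofRealVec n) (h1.restrict_scalars' ℝ)
  exact h2.span_eq_top_of_card_eq_finrank' (by simp)

variable {n : ℕ} {M : AnosovModel n m} {K : Type*} [Field K] (R : M.Roots K)

theorem AnosovModel.mulVec_star_of_mulVec {a b : ℂ} {z : Fin n → ℂ}
    (hz : M.AC.mulVec z = a • z) (hab : b = star a) :
    M.AC.mulVec (star z) = b • star z := by
  rw [M.AC_mulVec_star, hz, star_smul, hab]

/-- The real and the imaginary part of an eigenvector for a real eigenvalue are eigenvectors or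
zero. -/
theorem AnosovModel.exists_real_eigenvector {a : ℂ} (ha : a = star a) {z : Fin n → ℂ}
    (hz0 : z ≠ 0) (hz : M.AC.mulVec z = a • z) :
    ∃ v : Fin n → ℝ, ofRealVec n v ≠ 0 ∧ M.AC.mulVec (ofRealVec n v) = a • ofRealVec n v := by
  have h1 := AnosovModel.mulVec_star_of_mulVec hz ha
  by_cases h : z + star z = 0
  · refine ⟨fun i => (z i).im, ?_, ?_⟩
    · rw [ofRealVec_im, smul_ne_zero_iff]
      refine ⟨by simp, fun h2 => hz0 ?_⟩
      have h3 : (2 : ℂ) • z = (z + star z) + (z - star z) := by rw [two_smul]; abel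
      rw [h, h2, add_zero, smul_eq_zero] at h3
      exact h3.resolve_left two_ne_zero
    · rw [ofRealVec_im, Matrix.mulVec_smul, Matrix.mulVec_sub, hz, h1, ← smul_sub, smul_comm]
  · refine ⟨fun i => (z i).re, ?_, ?_⟩
    · rw [ofRealVec_re]
      exact smul_ne_zero (by norm_num) h
    · rw [ofRealVec_re, Matrix.mulVec_smul, Matrix.mulVec_add, hz, h1, ← smul_add, smul_comm]

end RealEigenvectors

section FiveCycle

variable {M : AnosovModel 5 m} {K : Type*} [Field K] {R : M.Roots K}

/-- An automorphism of order two of the pentagon is the identity or a reflection. -/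
theorem eq_or_eq_sub_of_pentagon {τ : Fin 5 → Fin 5} (hinv : ∀ i, τ (τ i) = i)
    (hτ : ∀ i, τ (i + 1) = τ i + 1 ∨ τ i = τ (i + 1) + 1) :
    (∀ i, τ i = i) ∨ ∃ c, ∀ i, τ i = c - i := by
  have key : ∀ a b, (b = a + 1 ∨ a = b + 1) → ∀ c, (c = b + 1 ∨ b = c + 1) →
      ∀ d, (d = c + 1 ∨ c = d + 1) → ∀ e, (e = d + 1 ∨ d = e + 1) → (a = e + 1 ∨ e = a + 1) →
      (∀ i, ![a, b, c, d, e] (![a, b, c, d, e] i) = i) →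
      (∀ i, ![a, b, c, d, e] i = i) ∨ ∃ k, ∀ i : Fin 5, ![a, b, c, d, e] i = k - i := by
    decide
  have h : τ = ![τ 0, τ 1, τ 2, τ 3, τ 4] := by
    ext i
    fin_cases i <;> rfl
  have := key (τ 0) (τ 1) (hτ 0) (τ 2) (hτ 1) (τ 3) (hτ 2) (τ 4) (hτ 3) (hτ 4)
  rw [← h] at this
  exact this hinv

theorem inTable_of_real_pentagon (hL : IsTwoStepOfType L 5 m) (S : Realization M L) (hm : m = 5)
    (h1 : ∀ i, ¬R.Adj i (i + 1)) (hτ : ∀ i, R.eig i = star (R.eig i)) : InTable L 5 m := by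
  obtain ⟨z⟩ := R.exists_eigenbasis
  choose v hv hv' using fun i =>
    AnosovModel.exists_real_eigenvector (hτ i) (z.ne_zero i) (z.mulVec i)
  let w : R.Eigenbasis := ⟨fun i => ofRealVec 5 (v i), hv, hv'⟩
  refine table_cyclic_five hL hm _ (S.generates v
    (span_eq_top_of_span_ofRealVec w.span_eq_top)) fun i => S.lie_eq_zero ?_
  by_contra h
  exact h1 i (w.adj_of_bil_ne_zero h)

/-- If complex conjugation fixes the zeroth root only, the real and imaginary parts of a suitable
basis of eigenvectors satisfy the relations of the dihedral ideal. -/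
theorem inTable_of_reflected_pentagon (hL : IsTwoStepOfType L 5 m) (S : Realization M L)
    (hm : m = 5) (h1 : ∀ i, ¬R.Adj i (i + 1)) (hτ : ∀ i, R.eig (-i) = star (R.eig i)) :
    InTable L 5 m := by
  obtain ⟨z⟩ := R.exists_eigenbasis
  obtain ⟨v, hv, hv'⟩ := AnosovModel.exists_real_eigenvector (hτ 0) (z.ne_zero 0) (z.mulVec 0)
  set a := z.vec 1 with ha
  set b := z.vec 2 with hb
  let w : R.Eigenbasis :=
    { vec := ![ofRealVec 5 v, a, b, star b, star a]
      ne_zero := by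
        intro i
        fin_cases i
        exacts [hv, z.ne_zero 1, z.ne_zero 2, star_ne_zero.2 (z.ne_zero 2),
          star_ne_zero.2 (z.ne_zero 1)]
      mulVec := by
        intro i
        fin_cases i
        exacts [hv', z.mulVec 1, z.mulVec 2,
          AnosovModel.mulVec_star_of_mulVec (z.mulVec 2) (hτ 2),
          AnosovModel.mulVec_star_of_mulVec (z.mulVec 1) (hτ 1)] }
  have hw : ∀ i, M.bil (w.vec i) (w.vec (i + 1)) = 0 := fun i => by
    by_contra h
    exact h1 i (w.adj_of_bil_ne_zero h)
  have e0 : M.bil (ofRealVec 5 v) a = 0 := hw 0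
  have e1 : M.bil a b = 0 := hw 1
  have e2 : M.bil b (star b) = 0 := hw 2
  have e3 : M.bil (star b) (star a) = 0 := hw 3
  have e4 : M.bil (star a) (ofRealVec 5 v) = 0 := hw 4
  have e2' : M.bil (star b) b = 0 := by rw [M.bil_skew, e2, neg_zero]
  have e3' : M.bil (star a) (star b) = 0 := by rw [M.bil_skew, e3, neg_zero]
  have e4' : M.bil (ofRealVec 5 v) (star a) = 0 := by rw [M.bil_skew, e4, neg_zero]
  let u : Fin 5 → Fin 5 → ℝ := ![v, fun i => (a i).re, fun i => (a i).im, fun i => (b i).re,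
    fun i => (b i).im]
  have hspan : Submodule.span ℝ (Set.range u) = ⊤ := by
    apply span_eq_top_of_span_ofRealVec
    have hu : ∀ i, ofRealVec 5 (u i) ∈
        Submodule.span ℂ (Set.range fun i => ofRealVec 5 (u i)) :=
      fun i => Submodule.subset_span ⟨i, rfl⟩
    have hre : ∀ c : Fin 5 → ℂ, c = ofRealVec 5 (fun i => (c i).re) +
        Complex.I • ofRealVec 5 (fun i => (c i).im) := by
      intro c
      ext i
      simp [mul_comm Complex.I, Complex.re_add_im]
    have hst : ∀ c : Fin 5 → ℂ, star c = ofRealVec 5 (fun i => (c i).re) -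
        Complex.I • ofRealVec 5 (fun i => (c i).im) := by
      intro c
      ext i
      apply Complex.ext <;> simp
    rw [eq_top_iff, ← w.span_eq_top, Submodule.span_le]
    rintro _ ⟨i, rfl⟩
    fin_cases i
    · exact hu 0
    · exact Set.mem_of_eq_of_mem (hre a) <| add_mem (hu 1) (Submodule.smul_mem _ _ (hu 2))
    · exact Set.mem_of_eq_of_mem (hre b) <| add_mem (hu 3) (Submodule.smul_mem _ _ (hu 4))
    · exact Set.mem_of_eq_of_mem (hst b) <| sub_mem (hu 3) (Submodule.smul_mem _ _ (hu 4))
    · exact Set.mem_of_eq_of_mem (hst a) <| sub_mem (hu 1) (Submodule.smul_mem _ _ (hu 2))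
  refine table_dihedral hL hm _ (S.generates u hspan) (S.lie_eq_zero ?_) (S.lie_eq_zero ?_)
    (S.lie_eq_zero ?_) ?_ ?_
  · change M.bil (ofRealVec 5 v) (ofRealVec 5 fun i => (a i).re) = 0
    rw [ofRealVec_re, map_smul, map_add, e0, e4', add_zero, smul_zero]
  · change M.bil (ofRealVec 5 v) (ofRealVec 5 fun i => (a i).im) = 0
    rw [ofRealVec_im, map_smul, map_sub, e0, e4', sub_zero, smul_zero]
  · change M.bil (ofRealVec 5 fun i => (b i).re) (ofRealVec 5 fun i => (b i).im) = 0
    rw [ofRealVec_re, ofRealVec_im]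
    simp [M.bil_self, e2, e2']
  · change ⁅S.E fun i => (a i).re, S.E fun i => (b i).re⁆ -
      ⁅S.E fun i => (a i).im, S.E fun i => (b i).im⁆ = 0
    have h : M.bil (ofRealVec 5 fun i => (a i).re) (ofRealVec 5 fun i => (b i).re) =
        M.bil (ofRealVec 5 fun i => (a i).im) (ofRealVec 5 fun i => (b i).im) := by
      rw [ofRealVec_re, ofRealVec_re, ofRealVec_im, ofRealVec_im]
      simp only [map_smul, LinearMap.smul_apply, map_add, LinearMap.add_apply, map_sub,
        LinearMap.sub_apply, e1, e3', smul_add, smul_sub, smul_smul, smul_zero]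
      have h4 : (1 / (2 * Complex.I) * (1 / (2 * Complex.I)) : ℂ) = -(1 / 2 * (1 / 2)) := by
        field_simp
        rw [Complex.I_sq]
        norm_num
      rw [h4]
      module
    rw [S.lie_eq, S.lie_eq, h, sub_self]
  · change ⁅S.E fun i => (a i).re, S.E fun i => (b i).im⁆ +
      ⁅S.E fun i => (a i).im, S.E fun i => (b i).re⁆ = 0
    have h : M.bil (ofRealVec 5 fun i => (a i).re) (ofRealVec 5 fun i => (b i).im) =
        M.bil (-ofRealVec 5 fun i => (a i).im) (ofRealVec 5 fun i => (b i).re) := by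
      rw [ofRealVec_re, ofRealVec_re, ofRealVec_im, ofRealVec_im]
      simp only [map_smul, LinearMap.smul_apply, map_add, LinearMap.add_apply, map_sub, map_neg,
        LinearMap.neg_apply, LinearMap.sub_apply, e1, e3']
      module
    rw [S.lie_eq, h, ← map_neg, ← S.lie_eq, map_neg, neg_lie, neg_add_cancel]

/-- The case of a pentagon of commuting eigenvectors. -/
theorem inTable_of_pentagon (hR : IsCyclic R) (hL : IsTwoStepOfType L 5 m) (S : Realization M L)
    (h1 : ¬R.Adj 0 1) (h2 : R.Adj 0 2) (hm : m = 5) : InTable L 5 m := by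
  have a1 : ∀ i, ¬R.Adj i (i + 1) := fun i h =>
    h1 ((hR.adj_add 0 1 i).1 (by rwa [zero_add, add_comm 1]))
  have a2 : ∀ i, R.Adj i (i + 2) := fun i => by
    have := (hR.adj_add 0 2 i).2 h2
    rwa [zero_add, add_comm 2] at this
  have hc : ∀ a b : Fin 5, a ≠ b → b = a + 1 ∨ a = b + 1 ∨ b = a + 2 ∨ a = b + 2 := by decide
  obtain ⟨τ, hτ⟩ := R.exists_conj
  have hinv := R.conj_conj hτ
  rcases eq_or_eq_sub_of_pentagon hinv (fun i => by
      have hne : τ i ≠ τ (i + 1) := fun h => by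
        have := congrArg τ h
        rw [hinv, hinv] at this
        simp at this
      have hadj : ¬R.Adj (τ i) (τ (i + 1)) := fun h => by
        have := R.adj_conj hτ h
        rw [hinv, hinv] at this
        exact a1 i this
      rcases hc _ _ hne with h | h | h | h
      · exact Or.inl h
      · exact Or.inr h
      · exact absurd (h ▸ a2 _) hadj
      · exact absurd (R.adj_symm (h ▸ a2 _)) hadj) with h | ⟨c, h⟩
  · exact inTable_of_real_pentagon hL S hm a1 fun i => by rw [← hτ, h]
  · -- The reflection `i ↦ c - i` fixes `c / 2 = 3 c`.
    refine inTable_of_reflected_pentagon (R := R.relabel (Equiv.addRight (3 * c))) hL S hm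
      (fun i hi => a1 (i + 3 * c) ?_) fun i => ?_
    · rw [add_right_comm]
      exact hi
    · change R.eig (-i + 3 * c) = star (R.eig (i + 3 * c))
      rw [← hτ, h]
      have key : ∀ i c : Fin 5, -i + 3 * c = c - (i + 3 * c) := by decide
      rw [key]

/-- The graph is invariant under rotation, so it is complete or one of two pentagons. -/
theorem inTable_of_isCyclic (hR : IsCyclic R) (hL : IsTwoStepOfType L 5 m)
    (S : Realization M L) : InTable L 5 m := by
  have hdim := R.dim_eq_sum_edge hR.simpleEdges
  rw [show (Finset.univ.filter fun x : Fin 5 × Fin 5 => x.2 < x.1) =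
    {(1, 0), (2, 1), (3, 2), (4, 3), (4, 0), (2, 0), (3, 1), (4, 2), (3, 0), (4, 1)} by
    decide] at hdim
  have hadd : ∀ i j t, R.edge (i + t) (j + t) = R.edge i j := fun i j t => by
    unfold AnosovModel.Roots.edge
    rw [hR.adj_add]
  have h1 : ∀ t, R.edge (1 + t) (0 + t) = R.edge 0 1 := fun t => by rw [hadd, R.edge_comm]
  have h2 : ∀ t, R.edge (2 + t) (0 + t) = R.edge 0 2 := fun t => by rw [hadd, R.edge_comm]
  have hsum : m = 5 * R.edge 0 1 + 5 * R.edge 0 2 := by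
    refine hdim.trans ?_
    simp only [Finset.sum_insert, Finset.sum_singleton, Finset.mem_insert, Finset.mem_singleton,
      Prod.mk.injEq, Fin.reduceEq, and_false, false_and, or_self, not_false_eq_true, and_self]
    have a0 := h1 0
    have a1 := h1 1
    have a2 := h1 2
    have a3 := h1 3
    have a4 := h1 4
    have b0 := h2 0
    have b1 := h2 1
    have b2 := h2 2
    have b3 := h2 3
    have b4 := h2 4
    simp only [Fin.reduceAdd] at a0 a1 a2 a3 a4 b0 b1 b2 b3 b4
    rw [R.edge_comm 4 0, R.edge_comm 3 0, R.edge_comm 4 1]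
    omega
  by_cases c1 : R.Adj 0 1 <;> by_cases c2 : R.Adj 0 2 <;>
    simp only [AnosovModel.Roots.edge, c1, c2, if_true, if_false] at hsum
  · obtain rfl : m = 10 := hsum
    exact inTable_of_free hL S (by decide) AnosovTable.free_five
  · -- Multiplication by two exchanges the two orbits of edges.
    let s : Equiv.Perm (Fin 5) := ⟨fun i => 2 * i, fun i => 3 * i, by decide, by decide⟩
    refine inTable_of_pentagon (R := R.relabel s) (hR.relabel_two_mul fun i => rfl) hL S c2 ?_
      hsum
    exact R.adj_symm ((hR.adj_add 0 1 4).2 c1)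
  · exact inTable_of_pentagon hR hL S c1 c2 hsum
  · exact absurd hsum M.pos.ne'

theorem inTable_five_of_irreducible (hL : IsTwoStepOfType L 5 m) (S : Realization M L)
    (hR : ∀ i j, ∃ g ∈ R.symmGroup, g i = j) : InTable L 5 m := by
  obtain ⟨g, hg, s, hs⟩ := exists_equiv_shift R.symmGroup hR
  exact inTable_of_isCyclic (IsCyclic.of_symm hg hs) hL S

end FiveCycle

/-! ### Five generators: a quadratic and a cubic factor -/

section QuadraticTimesCubic

variable {M : AnosovModel 5 m} {K : Type*} [Field K]

/-- The first two roots and the last three roots are the roots of two irreducible factors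
of `p`. -/
structure IsTwoThree (R : M.Roots K) : Prop where
  lt_two_iff : ∀ g ∈ R.symmGroup, ∀ i, g i < 2 ↔ i < 2
  exists_symm_zero_one : ∃ g ∈ R.symmGroup, g 0 = 1
  exists_symm : ∀ i j, 2 ≤ i → 2 ≤ j → ∃ g ∈ R.symmGroup, g i = j
  sum_two : R.lg 0 + R.lg 1 = 0
  sum_three : R.lg 2 + R.lg 3 + R.lg 4 = 0
  conj_lt_two : ∀ τ : Fin 5 → Fin 5, (∀ i, R.eig (τ i) = star (R.eig i)) → ∀ i < 2, τ i < 2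

namespace IsTwoThree

variable {R : M.Roots K}

theorem not_adj (h : IsTwoThree R) : ¬R.Adj 0 1 := fun h1 => R.lg_add_ne_zero h1 h.sum_two

theorem add_eq_zero (h : IsTwoThree R) {i j : Fin 5} (hi : i < 2) (hj : j < 2) (hij : i ≠ j) :
    R.lg i + R.lg j = 0 := by
  have hc : ∀ i j : Fin 5, i < 2 → j < 2 → i ≠ j → (i = 0 ∧ j = 1) ∨ (i = 1 ∧ j = 0) := by
    decide
  rcases hc i j hi hj hij with ⟨rfl, rfl⟩ | ⟨rfl, rfl⟩
  · exact h.sum_two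
  · rw [add_comm]; exact h.sum_two

theorem add_add_eq_zero (h : IsTwoThree R) {i j k : Fin 5} (hi : 2 ≤ i) (hj : 2 ≤ j) (hk : 2 ≤ k)
    (hij : i ≠ j) (hik : i ≠ k) (hjk : j ≠ k) : R.lg i + R.lg j + R.lg k = 0 := by
  have hu : ({i, j, k} : Finset (Fin 5)) = {2, 3, 4} := by
    refine Finset.eq_of_subset_of_card_le (fun a ha => ?_) ?_
    · have hc : ∀ a : Fin 5, 2 ≤ a → a ∈ ({2, 3, 4} : Finset (Fin 5)) := by decide
      simp only [Finset.mem_insert, Finset.mem_singleton] at ha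
      rcases ha with rfl | rfl | rfl
      exacts [hc _ hi, hc _ hj, hc _ hk]
    · rw [Finset.card_insert_of_notMem (by simp [hij, hik] : i ∉ {j, k}), Finset.card_pair hjk]
      rfl
  have h1 : ∑ a ∈ ({i, j, k} : Finset (Fin 5)), R.lg a = 0 := by
    rw [hu, Finset.sum_insert (by decide), Finset.sum_pair (by decide), ← add_assoc]
    exact h.sum_three
  rwa [Finset.sum_insert (by simp [hij, hik]), Finset.sum_pair hjk, ← add_assoc] at h1

/-- For every root `t` of the cubic factor some translate of the relation reads
`x 0 + 2 x t = 0` or `x 1 + 2 x t = 0`, whence `x t = ± x 0 / 2`. Three such numbers do not add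
up to zero. -/
theorem not_relation_two (h : IsTwoThree R) {b t : Fin 5} (hb : b < 2) (ht : 2 ≤ t)
    (hrel : ∀ g ∈ R.symmGroup, R.lg (g b) + 2 * R.lg (g t) = 0) : False := by
  have key : ∀ j, 2 ≤ j → R.lg 0 + 2 * R.lg j = 0 ∨ R.lg 1 + 2 * R.lg j = 0 := by
    intro j hj
    obtain ⟨g, hg, rfl⟩ := h.exists_symm t j ht hj
    have hc : ∀ a : Fin 5, a < 2 → a = 0 ∨ a = 1 := by decide
    rcases hc _ ((h.lt_two_iff g hg b).2 hb) with h1 | h1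
    · exact Or.inl (h1 ▸ hrel g hg)
    · exact Or.inr (h1 ▸ hrel g hg)
  have h0 := R.lg_ne_zero 0
  have s1 := h.sum_two
  have s2 := h.sum_three
  rcases key 2 (by decide) with h1 | h1 <;> rcases key 3 (by decide) with h2 | h2 <;>
    rcases key 4 (by decide) with h3 | h3 <;> exact h0 (by linarith)

/-- For every root `t` of the cubic factor some translate of the relation ends in `x t`. The
resulting linear system, together with `x 0 + x 1 = 0` and `x 2 + x 3 + x 4 = 0`, has no solution
with `x 0 ≠ 0`. -/
theorem not_relation_three (h : IsTwoThree R) {b j t : Fin 5} (hb : b < 2) (hj : 2 ≤ j)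
    (ht : 2 ≤ t) (hjt : j ≠ t)
    (hrel : ∀ g ∈ R.symmGroup, 2 * R.lg (g b) + 2 * R.lg (g j) + R.lg (g t) = 0) : False := by
  have key : ∀ k k₁ k₂, 2 ≤ k → (∀ i, 2 ≤ i → i ≠ k → i = k₁ ∨ i = k₂) →
      2 * R.lg 0 + 2 * R.lg k₁ + R.lg k = 0 ∨ 2 * R.lg 0 + 2 * R.lg k₂ + R.lg k = 0 ∨
      2 * R.lg 1 + 2 * R.lg k₁ + R.lg k = 0 ∨ 2 * R.lg 1 + 2 * R.lg k₂ + R.lg k = 0 := by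
    intro k k₁ k₂ hk hk'
    obtain ⟨g, hg, rfl⟩ := h.exists_symm t k ht hk
    have hc : ∀ a : Fin 5, a < 2 → a = 0 ∨ a = 1 := by decide
    have hr := hrel g hg
    rcases hc _ ((h.lt_two_iff g hg b).2 hb) with h1 | h1 <;>
      rcases hk' (g j) (not_lt.1 ((h.lt_two_iff g hg j).not.2 (not_lt.2 hj)))
        (g.injective.ne hjt) with h2 | h2 <;> rw [h1, h2] at hr <;> simp only [hr, true_or, or_true]
  have h0 := R.lg_ne_zero 0
  have s1 := h.sum_two
  have s2 := h.sum_three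
  rcases key 2 3 4 (by decide) (by decide) with h1 | h1 | h1 | h1 <;>
    rcases key 3 2 4 (by decide) (by decide) with h2 | h2 | h2 | h2 <;>
    rcases key 4 2 3 (by decide) (by decide) with h3 | h3 | h3 | h3 <;> exact h0 (by linarith)

theorem simpleEdges (h : IsTwoThree R) : R.SimpleEdges := by
  intro i j k l hij hkl hik hil hjk hjl hadj heq
  have hrel : ∀ g ∈ R.symmGroup, R.lg (g i) + R.lg (g j) = R.lg (g k) + R.lg (g l) :=
    fun g hg => R.isSymm_lg hg heq
  have hadj' : R.Adj k l := by
    unfold AnosovModel.Roots.Adj at hadj ⊢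
    rwa [← heq]
  have h01 : ∀ a b, a ≠ b → R.Adj a b → a < 2 → ¬b < 2 := fun a b hab had ha hb =>
    R.lg_add_ne_zero had (h.add_eq_zero ha hb hab)
  have a1 := h01 i j hij hadj
  have a2 := h01 k l hkl hadj'
  have hfifth : ∃ e, e ≠ i ∧ e ≠ j ∧ e ≠ k ∧ e ≠ l := by
    have : ({i, j, k, l} : Finset (Fin 5)).card < Fintype.card (Fin 5) :=
      lt_of_le_of_lt Finset.card_le_four (by simp)
    obtain ⟨e, he⟩ := Finset.exists_mem_notMem_of_card_lt_card (t := Finset.univ) this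
    simp only [Finset.mem_univ, Finset.mem_insert, Finset.mem_singleton, true_and, not_or] at he
    exact ⟨e, he⟩
  obtain ⟨e, hei, hej, hek, hel⟩ := hfifth
  have hlt : ∀ g ∈ R.symmGroup, ∀ a, a < 2 → g a < 2 := fun g hg a => (h.lt_two_iff g hg a).2
  have hge : ∀ g ∈ R.symmGroup, ∀ a, 2 ≤ a → 2 ≤ g a := fun g hg a ha =>
    not_lt.1 ((h.lt_two_iff g hg a).not.2 (not_lt.2 ha))
  -- The two edges meet the roots of the quadratic factor in `b` only.
  have hthree : ∀ b t k l, b ≠ t → k ≠ l → b ≠ k → b ≠ l → t ≠ k → t ≠ l → b < 2 → 2 ≤ t → 2 ≤ k →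
      2 ≤ l → (∀ g ∈ R.symmGroup, R.lg (g b) + R.lg (g t) = R.lg (g k) + R.lg (g l)) → False := by
    intro b t k l hbt hkl hbk hbl htk htl hb ht hk hl hr
    refine h.not_relation_two hb ht fun g hg => ?_
    have := h.add_add_eq_zero (hge g hg t ht) (hge g hg k hk) (hge g hg l hl)
      (g.injective.ne htk) (g.injective.ne htl) (g.injective.ne hkl)
    have := hr g hg
    linarith
  -- Each of the two edges joins a root of the quadratic factor to one of the cubic factor.
  have htwo : ∀ b t b' t' e, b ≠ b' → t ≠ t' → t ≠ e → t' ≠ e → b < 2 → b' < 2 → 2 ≤ t → 2 ≤ t' →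
      2 ≤ e → (∀ g ∈ R.symmGroup, R.lg (g b) + R.lg (g t) = R.lg (g b') + R.lg (g t')) →
      False := by
    intro b t b' t' e hbb htt hte hte' hb hb' ht ht' he hr
    refine h.not_relation_three hb ht he hte fun g hg => ?_
    have := h.add_add_eq_zero (hge g hg t ht) (hge g hg t' ht') (hge g hg e he)
      (g.injective.ne htt) (g.injective.ne hte) (g.injective.ne hte')
    have := h.add_eq_zero (hlt g hg b hb) (hlt g hg b' hb') (g.injective.ne hbb)
    have := hr g hg
    linarith
  rcases lt_or_ge i 2 with hi | hi <;> rcases lt_or_ge j 2 with hj | hj <;>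
    rcases lt_or_ge k 2 with hk | hk <;> rcases lt_or_ge l 2 with hl | hl <;>
    first
    | exact absurd hj (a1 hi)
    | exact absurd hl (a2 hk)
    | skip
  · exact htwo i j k l e hik hjl hej.symm hel.symm hi hk hj hl (by omega) hrel
  · exact htwo i j l k e hil hjk hej.symm hek.symm hi hl hj hk (by omega) fun g hg => by
      linarith [hrel g hg]
  · exact hthree i j k l hij hkl hik hil hjk hjl hi hj hk hl hrel
  · exact htwo j i k l e hjk hil hei.symm hel.symm hj hk hi hl (by omega) fun g hg => by
      linarith [hrel g hg]
  · exact htwo j i l k e hjl hik hei.symm hek.symm hj hl hi hk (by omega) fun g hg => by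
      linarith [hrel g hg]
  · exact hthree j i k l hij.symm hkl hjk hjl hik hil hj hi hk hl fun g hg => by
      linarith [hrel g hg]
  · exact hthree k l i j hkl hij hik.symm hjk.symm hil.symm hjl.symm hk hl hi hj fun g hg => by
      linarith [hrel g hg]
  · exact hthree l k i j hkl.symm hij hil.symm hjl.symm hik.symm hjk.symm hl hk hi hj
      fun g hg => by linarith [hrel g hg]
  · omega

end IsTwoThree

/-- By symmetry the two factors are joined by all edges or by none, and the roots of the cubic
factor are pairwise adjacent or pairwise not adjacent. -/
theorem inTable_of_isTwoThree (hL : IsTwoStepOfType L 5 m) (S : Realization M L) {R : M.Roots K}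
    (h : IsTwoThree R) : InTable L 5 m := by
  have hdim := R.dim_eq_sum_edge h.simpleEdges
  rw [show (Finset.univ.filter fun x : Fin 5 × Fin 5 => x.2 < x.1) =
    {(1, 0), (2, 1), (3, 2), (4, 3), (4, 0), (2, 0), (3, 1), (4, 2), (3, 0), (4, 1)} by
    decide] at hdim
  simp only [Finset.sum_insert, Finset.sum_singleton, Finset.mem_insert, Finset.mem_singleton,
    Prod.mk.injEq, Fin.reduceEq, and_false, false_and, or_self, not_false_eq_true, and_self]
    at hdim
  have hB : ∀ i : Fin 5, i ∈ ({0, 1} : Finset (Fin 5)) ↔ i < 2 := by decide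
  have hC : ∀ i : Fin 5, i ∈ ({2, 3, 4} : Finset (Fin 5)) ↔ ¬i < 2 := by decide
  have invB : ∀ g ∈ R.symmGroup, ∀ i, g i ∈ ({0, 1} : Finset (Fin 5)) ↔
      i ∈ ({0, 1} : Finset (Fin 5)) := fun g hg i => by
    rw [hB, hB, h.lt_two_iff g hg]
  have invC : ∀ g ∈ R.symmGroup, ∀ i, g i ∈ ({2, 3, 4} : Finset (Fin 5)) ↔
      i ∈ ({2, 3, 4} : Finset (Fin 5)) := fun g hg i => by
    rw [hC, hC, h.lt_two_iff g hg]
  obtain ⟨g, hg, hg'⟩ := h.exists_symm_zero_one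
  obtain ⟨g₃, hg₃, hg₃'⟩ := h.exists_symm 2 3 (by decide) (by decide)
  obtain ⟨g₄, hg₄, hg₄'⟩ := h.exists_symm 2 4 (by decide) (by decide)
  have c1 := R.sum_edge_eq hg _ (invC g hg) 0
  have b3 := R.sum_edge_eq hg₃ _ (invB g₃ hg₃) 2
  have b4 := R.sum_edge_eq hg₄ _ (invB g₄ hg₄) 2
  have c3 := R.sum_edge_eq hg₃ _ (invC g₃ hg₃) 2
  have c4 := R.sum_edge_eq hg₄ _ (invC g₄ hg₄) 2
  rw [hg', show ({2, 3, 4} : Finset (Fin 5)).erase 1 = {2, 3, 4} by decide,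
    show ({2, 3, 4} : Finset (Fin 5)).erase 0 = {2, 3, 4} by decide] at c1
  rw [hg₃', show ({0, 1} : Finset (Fin 5)).erase 3 = {0, 1} by decide,
    show ({0, 1} : Finset (Fin 5)).erase 2 = {0, 1} by decide] at b3
  rw [hg₄', show ({0, 1} : Finset (Fin 5)).erase 4 = {0, 1} by decide,
    show ({0, 1} : Finset (Fin 5)).erase 2 = {0, 1} by decide] at b4
  rw [hg₃', show ({2, 3, 4} : Finset (Fin 5)).erase 3 = {2, 4} by decide,
    show ({2, 3, 4} : Finset (Fin 5)).erase 2 = {3, 4} by decide] at c3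
  rw [hg₄', show ({2, 3, 4} : Finset (Fin 5)).erase 4 = {2, 3} by decide,
    show ({2, 3, 4} : Finset (Fin 5)).erase 2 = {3, 4} by decide] at c4
  simp only [Finset.sum_insert, Finset.sum_singleton, Finset.mem_insert, Finset.mem_singleton,
    Fin.reduceEq, or_self, not_false_eq_true] at c1 b3 b4 c3 c4
  simp only [R.edge_comm 1 0, R.edge_comm 2 0, R.edge_comm 2 1, R.edge_comm 3 0, R.edge_comm 3 1,
    R.edge_comm 3 2, R.edge_comm 4 0, R.edge_comm 4 1, R.edge_comm 4 2, R.edge_comm 4 3]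
    at hdim c1 b3 b4 c3 c4
  have e01 : R.edge 0 1 = 0 := by
    unfold AnosovModel.Roots.edge
    rw [if_neg h.not_adj]
  have l02 := R.edge_le 0 2
  have l03 := R.edge_le 0 3
  have l04 := R.edge_le 0 4
  have l12 := R.edge_le 1 2
  have l13 := R.edge_le 1 3
  have l14 := R.edge_le 1 4
  have l23 := R.edge_le 2 3
  obtain ⟨τ, hτ⟩ := R.exists_conj
  obtain ⟨z⟩ := R.exists_eigenbasis
  obtain ⟨u, u', hu, hu', hspan⟩ := R.exists_blocks z hτ {0, 1} (t := 2) (t' := 3)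
    (fun i hi => (hB _).2 (h.conj_lt_two τ hτ i ((hB _).1 hi))) (by decide) (by decide)
  rw [show ({0, 1} : Finset (Fin 5))ᶜ = {2, 3, 4} by decide] at hu'
  let v : Fin 5 → Fin 5 → ℝ := ![u 0, u 1, u' 0, u' 1, u' 2]
  have hv : Submodule.span ℝ (Set.range v) = ⊤ := by
    rw [eq_top_iff, ← hspan, sup_le_iff, Submodule.span_le, Submodule.span_le]
    constructor
    · rintro _ ⟨i, rfl⟩
      fin_cases i
      exacts [Submodule.subset_span ⟨0, rfl⟩, Submodule.subset_span ⟨1, rfl⟩]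
    · rintro _ ⟨i, rfl⟩
      fin_cases i
      exacts [Submodule.subset_span ⟨2, rfl⟩, Submodule.subset_span ⟨3, rfl⟩,
        Submodule.subset_span ⟨4, rfl⟩]
  have v1 : ∀ i < 2, ofRealVec 5 (v i) ∈
      Submodule.span ℂ (z.vec '' (({0, 1} : Finset (Fin 5)) : Set (Fin 5))) := by
    intro i hi
    fin_cases i
    exacts [hu 0, hu 1, absurd hi (by decide), absurd hi (by decide), absurd hi (by decide)]
  have v2 : ∀ i, 2 ≤ i → ofRealVec 5 (v i) ∈
      Submodule.span ℂ (z.vec '' (({2, 3, 4} : Finset (Fin 5)) : Set (Fin 5))) := by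
    intro i hi
    fin_cases i
    exacts [absurd hi (by decide), absurd hi (by decide), hu' 0, hu' 1, hu' 2]
  have w1 : ∀ i j, i < 2 → j < 2 → ⁅S.E (v i), S.E (v j)⁆ = 0 := fun i j hi hj =>
    S.lie_eq_zero (R.bil_eq_zero_of_mem_blocks z _ _ (fun a ha b hb hab hadj =>
      R.lg_add_ne_zero hadj (h.add_eq_zero ((hB a).1 ha) ((hB b).1 hb) hab)) (v1 i hi) (v1 j hj))
  have hbip : (R.edge 0 2 = 1 ∧ R.edge 0 3 = 1 ∧ R.edge 0 4 = 1 ∧ R.edge 1 2 = 1 ∧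
      R.edge 1 3 = 1 ∧ R.edge 1 4 = 1) ∨ (R.edge 0 2 = 0 ∧ R.edge 0 3 = 0 ∧ R.edge 0 4 = 0 ∧
      R.edge 1 2 = 0 ∧ R.edge 1 3 = 0 ∧ R.edge 1 4 = 0) := by omega
  have hcub : (R.edge 2 3 = 1 ∧ R.edge 2 4 = 1 ∧ R.edge 3 4 = 1) ∨
      (R.edge 2 3 = 0 ∧ R.edge 2 4 = 0 ∧ R.edge 3 4 = 0) := by omega
  have w2 : (R.edge 2 3 = 0 ∧ R.edge 2 4 = 0 ∧ R.edge 3 4 = 0) →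
      ∀ i j, 2 ≤ i → 2 ≤ j → ⁅S.E (v i), S.E (v j)⁆ = 0 := by
    rintro ⟨h1, h2, h3⟩ i j hi hj
    rw [R.edge_eq_zero_iff] at h1 h2 h3
    refine S.lie_eq_zero (R.bil_eq_zero_of_mem_blocks z _ _ (fun a ha b hb hab => ?_) (v2 i hi)
      (v2 j hj))
    simp only [Finset.mem_insert, Finset.mem_singleton] at ha hb
    rcases ha with rfl | rfl | rfl <;> rcases hb with rfl | rfl | rfl <;>
      first
      | exact absurd rfl hab
      | assumption
      | (rw [R.adj_comm]; assumption)
  have w3 : (R.edge 0 2 = 0 ∧ R.edge 0 3 = 0 ∧ R.edge 0 4 = 0 ∧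
      R.edge 1 2 = 0 ∧ R.edge 1 3 = 0 ∧ R.edge 1 4 = 0) →
      ∀ i j, i < 2 → ⁅S.E (v i), S.E (v j)⁆ = 0 := by
    rintro ⟨h1, h2, h3, h4, h5, h6⟩ i j hi
    rcases lt_or_ge j 2 with hj | hj
    · exact w1 i j hi hj
    rw [R.edge_eq_zero_iff] at h1 h2 h3 h4 h5 h6
    refine S.lie_eq_zero (R.bil_eq_zero_of_mem_blocks z _ _ (fun a ha b hb _ => ?_) (v1 i hi)
      (v2 j hj))
    simp only [Finset.mem_insert, Finset.mem_singleton] at ha hb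
    rcases ha with rfl | rfl <;> rcases hb with rfl | rfl | rfl <;> assumption
  have hpos := M.pos
  have hgen := S.generates v hv
  rcases hbip with hb | hb <;> rcases hcub with hc | hc
  · exact table_two_three_a hL (by omega) _ hgen w1
  · exact table_two_three_b hL (by omega) _ hgen w1 (w2 hc)
  · exact table_two_three_c hL (by omega) _ hgen (w3 hb)
  · omega

theorem inTable_five (hL : IsTwoStepOfType L 5 m) (S : Realization M L)
    (K : Type*) [Field K] [Algebra ℚ K] [IsAlgClosure ℚ K] : InTable L 5 m := by
  have : Normal ℚ K := IsAlgClosure.normal ℚ K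
  rcases M.irreducible_or_exists_factor (by norm_num) le_rfl with h | h
  · obtain ⟨R, hR⟩ := M.exists_roots_of_irreducible K h
    exact inTable_five_of_irreducible hL S hR
  · obtain ⟨f, g, hf, hg, hfg, hg2⟩ := h
    have hf3 : f.natDegree = 3 := by
      have := M.natDegree_p
      rw [← hfg, hf.natDegree_mul hg, hg2] at this
      omega
    have hfd : f ∣ M.p := Dvd.intro _ hfg
    have hgd : g ∣ M.p := Dvd.intro_left _ hfg
    have hirrf := M.irreducible_of_dvd hf hfd (by omega) hf3.le
    have hirrg := M.irreducible_of_dvd hg hgd hg2.ge (by omega)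
    have hne : f ≠ g := by
      rintro rfl
      omega
    obtain ⟨R, hRg, hRf⟩ := AnosovModel.exists_roots_of_mul K (k := 2) (l := 3) M hf hg hirrf
      hirrg hne hfg hg2 hf3
    have hB : ∀ i ∈ ({0, 1} : Finset (Fin 5)), aeval (R.root i) g = 0 := by
      intro i hi
      simp only [Finset.mem_insert, Finset.mem_singleton] at hi
      rcases hi with rfl | rfl
      exacts [hRg 0, hRg 1]
    have hC : ∀ i ∈ ({2, 3, 4} : Finset (Fin 5)), aeval (R.root i) f = 0 := by
      intro i hi
      simp only [Finset.mem_insert, Finset.mem_singleton] at hi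
      rcases hi with rfl | rfl | rfl
      exacts [hRf 0, hRf 1, hRf 2]
    have memB : ∀ i : Fin 5, i ∈ ({0, 1} : Finset (Fin 5)) ↔ i < 2 := by decide
    have memC : ∀ i : Fin 5, 2 ≤ i → i ∈ ({2, 3, 4} : Finset (Fin 5)) := by decide
    have cardB : ({0, 1} : Finset (Fin 5)).card = g.natDegree := by rw [hg2]; decide
    have cardC : ({2, 3, 4} : Finset (Fin 5)).card = f.natDegree := by rw [hf3]; decide
    refine inTable_of_isTwoThree hL S (R := R)
      { lt_two_iff := fun s hs i => ?_
        exists_symm_zero_one := R.exists_symm_of_factor hg hirrg (hB 0 (by decide))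
          (hB 1 (by decide))
        exists_symm := fun i j hi hj => R.exists_symm_of_factor hf hirrf (hC i (memC i hi))
          (hC j (memC j hj))
        sum_two := ?_
        sum_three := ?_
        conj_lt_two := fun τ hτ i hi => (memB _).1
          (R.conj_mem_of_factor hg hB cardB hτ i ((memB i).2 hi)) }
    · rw [← memB, ← memB]
      exact R.mem_iff_of_factor hg hB cardB hs i
    · have := R.sum_lg_factor hg (M.isUnit_coeff_zero_of_dvd hgd) _ hB cardB
      rwa [Finset.sum_pair (by decide)] at this
    · have := R.sum_lg_factor hf (M.isUnit_coeff_zero_of_dvd hfd) _ hC cardC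
      rwa [Finset.sum_insert (by decide), Finset.sum_pair (by decide), ← add_assoc] at this

end QuadraticTimesCubic

/-! ### Conclusion -/

/-- An algebraic closure of `ℚ`. With the field and its `ℚ`-algebra structure as variables, the
latter does not compete with the structure that every division ring of characteristic zero carries. -/
theorem exists_isAlgClosure_rat : ∃ (K : Type) (_ : Field K) (_ : Algebra ℚ K),
    IsAlgClosure ℚ K :=
  ⟨AlgebraicClosure ℚ, inferInstance, AlgebraicClosure.instAlgebra ℚ, inferInstance⟩

end TwoStepAnosov

open TwoStepAnosov in
theorem theorem1p1 {L : Type*} [LieRing L] [LieAlgebra ℝ L] (n₁ n₂ : ℕ)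
    (hL : IsAnosov L) (htype : IsTwoStepOfType L n₁ n₂) :
    ((n₁ = 3 ∨ n₁ = 4 ∨ n₁ = 5) →
      ∃ I : LieIdeal ℝ (FreeNilpotent n₁ 2), AnosovTable n₁ n₂ I ∧
        Nonempty (L ≃ₗ⁅ℝ⁆ (FreeNilpotent n₁ 2 ⧸ I))) ∧
    (∀ φ : L ≃ₗ⁅ℝ⁆ L, IsAnosovAut φ →
      ∀ p₁ p₂ : Polynomial ℤ, IsAssociatedPair φ n₁ p₁ p₂ →
        Irreducible (p₁.map (Int.castRingHom ℚ)) → GaloisDoublyTransitive p₁ →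
        Nonempty (L ≃ₗ⁅ℝ⁆ FreeNilpotent n₁ 2)) := by
  constructor
  · intro hn
    obtain ⟨M, ⟨S⟩⟩ := exists_model_of_isAnosov htype hL
    obtain ⟨K, _, _, _⟩ := exists_isAlgClosure_rat
    rcases hn with rfl | rfl | rfl
    exacts [inTable_three htype S K, inTable_four htype S K, inTable_five htype S K]
  · intro φ hφ p₁ p₂ hass hirr hdt
    obtain ⟨M, rfl, ⟨S⟩⟩ := exists_model_of_isAssociatedPair htype hφ hass
    exact nonempty_equiv_of_doublyTransitive htype S hirr hdt
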